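/- Let $c>0$, let $Q_c(x)=\frac{3c}{2}\cosh^{-2}\bigl(\frac{\sqrt c\,x}{2}\bigr)$, and let $\mathcal L_c=-\partial_x^2+c-2Q_c$. Let $s\ge 0$ be an integer. For $a\ge 0$ regard $\partial_x(\mathcal L_c+a)$ as an unbounded operator on the space $H^s(\mathbb R)$ of complex-valued functions, with domain $H^{s+3}(\mathbb R)$ and with norm $\|u\|_{H^s}^2=\sum_{j=0}^s\|\partial_x^ju\|_{L^2}^2$, and let $\sigma(\partial_x(\mathcal L_c+a))$ denote the spectrum of its realization on $L^2(\mathbb R)=H^0(\mathbb R)$. Then: (i) for every $a\ge0$ the maximum $$\mu(a)=\max\{\operatorname{Re}\lambda:\ \lambda\in\sigma(\partial_x(\mathcal L_c+a))\}$$ exists; (ii) for every $a\ge0$ the operator $\partial_x(\mathcal L_c+a)$ on $H^s(\mathbb R)$ is the generator of exactly one strongly continuous semigroup $(e^{t\partial_x(\mathcal L_c+a)})_{t\ge0}$ of bounded linear operators on $H^s(\mathbb R)$; (iii) for every $\varepsilon>0$ there exists $C>0$, depending only on $c$, $\varepsilon$ and $s$, such that for all $a\ge0$, all $u\in H^s(\mathbb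 R)$ and all $t>0$, $$\bigl\|e^{t\partial_x(\mathcal L_c+a)}u\bigr\|_{H^s(\mathbb R)}\le C\,e^{(\mu(a)+\varepsilon)t}\,\|u\|_{H^s(\mathbb R)} .$$ -/

import Mathlib

open MeasureTheory Filter Topology
open scoped NNReal ENNReal SchwartzMap LineDeriv

noncomputable section

namespace ZKLine

/-! ### Weak derivatives and the Sobolev spaces `H^s(ℝ)`, `s ∈ ℕ` -/

/-- The complex Hilbert space `L²(ℝ)`. -/
abbrev L2 : Type := Lp ℂ 2 (volume : Measure ℝ)

/-- `v ∈ L²(ℝ)` is the weak derivative of `u ∈ L²(ℝ)`: `u' = v` as (tempered) distributions. -/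
def IsWeakDeriv (u v : L2) : Prop :=
  ∂_{(1 : ℝ)} (u : 𝓢'(ℝ, ℂ)) = (v : 𝓢'(ℝ, ℂ))

lemma IsWeakDeriv.add {u v u' v' : L2} (h : IsWeakDeriv u v) (h' : IsWeakDeriv u' v') :
    IsWeakDeriv (u + u') (v + v') := by
  unfold IsWeakDeriv at *
  simp only [← Lp.toTemperedDistributionCLM_apply] at *
  rw [map_add, map_add, LineDeriv.lineDerivOp_add, h, h']

lemma IsWeakDeriv.smul (k : ℂ) {u v : L2} (h : IsWeakDeriv u v) :
    IsWeakDeriv (k • u) (k • v) := by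
  unfold IsWeakDeriv at *
  simp only [← Lp.toTemperedDistributionCLM_apply] at *
  rw [map_smul, map_smul, LineDeriv.lineDerivOp_smul, h]

lemma isWeakDeriv_zero : IsWeakDeriv 0 0 := by
  simpa using IsWeakDeriv.smul 0 (u := 0) (v := 0) (by
    unfold IsWeakDeriv
    simp only [← Lp.toTemperedDistributionCLM_apply]
    rw [map_zero, LineDeriv.lineDerivOp_zero])

lemma IsWeakDeriv.unique {u v w : L2} (h : IsWeakDeriv u v) (h' : IsWeakDeriv u w) : v = w := by
  unfold IsWeakDeriv at *
  have e : Lp.toTemperedDistributionCLM ℂ (volume : Measure ℝ) 2 v =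
      Lp.toTemperedDistributionCLM ℂ (volume : Measure ℝ) 2 w := by
    simp only [Lp.toTemperedDistributionCLM_apply]
    rw [← h, ← h']
  exact LinearMap.ker_eq_bot.1 (Lp.ker_toTemperedDistributionCLM_eq_bot) e

/-- The Sobolev space `H^s(ℝ)`: a function `u ∈ L²(ℝ)` whose weak derivatives up to order `s` are in
`L²(ℝ)` is represented by the tuple `(u, u', …, u^{(s)})`, which `u` determines. As a subspace of the
`ℓ²`-sum of `s + 1` copies of `L²(ℝ)` it carries the norm
`‖u‖²_{H^s} = ‖u‖²_{L²} + ‖u'‖²_{L²} + ⋯ + ‖u^{(s)}‖²_{L²}`. -/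
def Sobolev (s : ℕ) : Submodule ℂ (PiLp 2 (fun _ : Fin (s + 1) => L2)) where
  carrier := {U | ∀ j : Fin s, IsWeakDeriv (U j.castSucc) (U j.succ)}
  add_mem' := fun hU hV j => (hU j).add (hV j)
  zero_mem' := fun _ => isWeakDeriv_zero
  smul_mem' := fun k _ hU j => (hU j).smul k

/-- The `j`-th weak derivative of `u ∈ H^s(ℝ)`, `j ≤ s`, as an element of `L²(ℝ)`. -/
def wD {s : ℕ} (u : Sobolev s) (j : ℕ) (hj : j ≤ s := by omega) : L2 :=
  (u : PiLp 2 (fun _ : Fin (s + 1) => L2)) ⟨j, Nat.lt_succ_of_le hj⟩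

lemma wD_add {s : ℕ} (u v : Sobolev s) (j : ℕ) (hj : j ≤ s) :
    wD (u + v) j hj = wD u j hj + wD v j hj := rfl

lemma wD_smul {s : ℕ} (k : ℂ) (u : Sobolev s) (j : ℕ) (hj : j ≤ s) :
    wD (k • u) j hj = k • wD u j hj := rfl

lemma wD_succ {s : ℕ} (u : Sobolev s) (j : ℕ) (hj : j + 1 ≤ s) :
    IsWeakDeriv (wD u j) (wD u (j + 1)) :=
  u.2 ⟨j, hj⟩

lemma wD_congr {s r : ℕ} (u : Sobolev s) (v : Sobolev r) (h : wD u 0 = wD v 0) (j : ℕ)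
    (hs : j ≤ s) (hr : j ≤ r) : wD u j hs = wD v j hr := by
  induction j with
  | zero => exact h
  | succ j ih =>
    have e := ih (by omega) (by omega)
    have h1 := wD_succ u j hs
    rw [e] at h1
    exact h1.unique (wD_succ v j hr)

/-- An element of `H^s(ℝ)` is determined by the underlying function. -/
lemma ext_wD {s : ℕ} {u v : Sobolev s} (h : wD u 0 = wD v 0) : u = v := by
  apply Subtype.ext
  apply PiLp.ext
  intro j
  exact wD_congr u v h j (Nat.le_of_lt_succ j.2) (Nat.le_of_lt_succ j.2)

/-! ### Unbounded operators and strongly continuous semigroups -/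

section Semigroups

variable {X : Type*} [NormedAddCommGroup X] [NormedSpace ℂ X]

/-- The spectrum of an unbounded operator `A`: the complement of the set of `z ∈ ℂ` for which
`z - A : D(A) → X` has a bounded two-sided inverse `R : X → D(A)`. -/
def opSpectrum (A : X →ₗ.[ℂ] X) : Set ℂ :=
  {z | ¬ ∃ R : X →L[ℂ] X,
    (∀ f : X, ∃ h : R f ∈ A.domain, z • R f - A ⟨R f, h⟩ = f) ∧
    (∀ u : A.domain, R (z • (u : X) - A u) = u)}

variable (X) in
/-- A strongly continuous semigroup of bounded linear operators `T(t)`, `t ≥ 0`, on `X`. -/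
@[ext]
structure C0Semigroup where
  toFun : ℝ≥0 → X →L[ℂ] X
  map_zero : toFun 0 = ContinuousLinearMap.id ℂ X
  map_add : ∀ t r : ℝ≥0, toFun (t + r) = (toFun t).comp (toFun r)
  tendsto_zero : ∀ x : X, Tendsto (fun t : ℝ≥0 => toFun t x) (𝓝 0) (𝓝 x)

/-- `A` is the infinitesimal generator of the semigroup `T`, i.e. `T(t) = e^{tA}`: `x ∈ D(A)` and
`A x = y` if and only if `(T(h) x - x) / h → y` as `h ↓ 0`. -/
def C0Semigroup.HasGenerator (T : C0Semigroup X) (A : X →ₗ.[ℂ] X) : Prop :=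
  ∀ x y : X, (∃ h : x ∈ A.domain, A ⟨x, h⟩ = y) ↔
    Tendsto (fun h : ℝ≥0 => (((h : ℝ) : ℂ)⁻¹) • (T.toFun h x - x)) (𝓝[>] 0) (𝓝 y)

end Semigroups

/-! ### The linearized operator -/

/-- The soliton profile `Q_c(x) = (3c/2) cosh⁻²(√c x / 2)`. -/
def Q (c x : ℝ) : ℝ := 3 * c / 2 * (Real.cosh (Real.sqrt c * x / 2) ^ 2)⁻¹

/-- The graph of `∂ₓ(𝓛_c + a)` in `H^s(ℝ)`, where `𝓛_c = -∂ₓ² + c - 2 Q_c`, with domain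
`H^{s+3}(ℝ)`: the pairs `(u, f)` in `H^s × H^s` such that `u ∈ H^{s+3}(ℝ)` and `f` is the weak
derivative of `w = (𝓛_c + a) u = -u'' + (c + a - 2 Q_c) u`. -/
def linearizedGraph (c a : ℝ) (s : ℕ) : Submodule ℂ (Sobolev s × Sobolev s) where
  carrier := {p | ∃ v : Sobolev (s + 3), wD v 0 = wD p.1 0 ∧
    ∃ w : L2, (∀ᵐ x, w x = -(wD v 2 : ℝ → ℂ) x + ((c + a - 2 * Q c x : ℝ) : ℂ) * (wD v 0 : ℝ → ℂ) x) ∧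
      IsWeakDeriv w (wD p.2 0)}
  add_mem' := by
    rintro p q ⟨v, hv, w, hw, hd⟩ ⟨v', hv', w', hw', hd'⟩
    refine ⟨v + v', ?_, w + w', ?_, hd.add hd'⟩
    · rw [wD_add, hv, hv']; rfl
    · rw [wD_add, wD_add]
      filter_upwards [hw, hw', Lp.coeFn_add w w', Lp.coeFn_add (wD v 0) (wD v' 0),
        Lp.coeFn_add (wD v 2) (wD v' 2)] with x h1 h2 h3 h4 h5
      rw [h3, h4, h5, Pi.add_apply, Pi.add_apply, Pi.add_apply, h1, h2]
      ring
  zero_mem' := by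
    refine ⟨0, rfl, 0, ?_, isWeakDeriv_zero⟩
    have e0 : wD (0 : Sobolev (s + 3)) 0 = 0 := rfl
    have e2 : wD (0 : Sobolev (s + 3)) 2 = 0 := rfl
    rw [e0, e2]
    filter_upwards [Lp.coeFn_zero ℂ 2 (volume : Measure ℝ)] with x h
    simp [h]
  smul_mem' := by
    rintro k p ⟨v, hv, w, hw, hd⟩
    refine ⟨k • v, ?_, k • w, ?_, hd.smul k⟩
    · rw [wD_smul, hv]; rfl
    · rw [wD_smul, wD_smul]
      filter_upwards [hw, Lp.coeFn_smul k w, Lp.coeFn_smul k (wD v 0),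
        Lp.coeFn_smul k (wD v 2)] with x h1 h3 h4 h5
      rw [h3, h4, h5, Pi.smul_apply, Pi.smul_apply, Pi.smul_apply, h1]
      simp only [smul_eq_mul]
      ring

lemma linearizedGraph_functional (c a : ℝ) (s : ℕ) (p : Sobolev s × Sobolev s)
    (hp : p ∈ linearizedGraph c a s) (h0 : p.1 = 0) : p.2 = 0 := by
  obtain ⟨v, hv, w, hw, hd⟩ := hp
  have hv0 : v = 0 := ext_wD (by rw [hv, h0]; rfl)
  subst hv0
  have e0 : wD (0 : Sobolev (s + 3)) 0 = 0 := rfl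
  have e2 : wD (0 : Sobolev (s + 3)) 2 = 0 := rfl
  rw [e0, e2] at hw
  have hw0 : w = 0 := by
    rw [Lp.eq_zero_iff_ae_eq_zero]
    filter_upwards [hw, Lp.coeFn_zero ℂ 2 (volume : Measure ℝ)] with x h h'
    simp [h, h']
  subst hw0
  exact ext_wD (hd.unique isWeakDeriv_zero)

/-- The unbounded operator `∂ₓ(𝓛_c + a)` on `H^s(ℝ)`, with domain `H^{s+3}(ℝ)`. -/
def linearized (c a : ℝ) (s : ℕ) : Sobolev s →ₗ.[ℂ] Sobolev s :=
  (linearizedGraph c a s).toLinearPMap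

lemma linearized_graph (c a : ℝ) (s : ℕ) :
    (linearized c a s).graph = linearizedGraph c a s :=
  Submodule.toLinearPMap_graph_eq _ (linearizedGraph_functional c a s)

/-- The real parts of the points of the spectrum of `∂ₓ(𝓛_c + a)` on `L²(ℝ) = H⁰(ℝ)`. -/
def spectralAbscissae (c a : ℝ) : Set ℝ := Complex.re '' opSpectrum (linearized c a 0)

/-- The spectral bound `μ(a)` of `∂ₓ(𝓛_c + a)` on `L²(ℝ)`. -/
def specBound (c a : ℝ) : ℝ := sSup (spectralAbscissae c a)

end ZKLine

end

/-! The soliton and all weights are polynomials in θ = tanh(√c x/2), and the derivative of such a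
polynomial is divisible by 1 - θ². Pair ∂ₓ(𝓛_c + a)u with (1 + θ/2)u. The increasing weight produces
the Kato smoothing gain -κ∫(1-θ²)|u'|², the term a∂ₓ contributes with a favourable sign, and all
other terms are at most K∫(1-θ²)|u|² with K independent of a (`exists_re_inner_wt_le`). Hence for
large a the operator is dissipative in an equivalent norm (`exists_growth_large`). For every a, a
Poincaré inequality on small cells makes the bad term arbitrarily small up to a form of finite rank
(`exists_locForm_le`). After subtraction of a suitable finite rank operator the resolvent is
therefore bounded on Re λ ≥ w, uniformly in a ≥ 0, for any prescribed w > 0 (`nonempty_correction`).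

The spectrum in Re λ ≥ w is then the zero set of a perturbation determinant
(`Correction.mem_opSpectrum_iff`), holomorphic in λ inside the half plane, jointly continuous in (a,
λ), and of modulus at least 1/2 for large |λ| while a stays bounded. Since 0 always lies in the
spectrum, the maximum exists (`exists_isGreatest_re_opSpectrum`). The maximum principle for the
reciprocal of the determinant gives resolvent bounds on Re λ ≥ μ(a) + ε, uniform for a in [0, a₁],
without any continuity of μ (`exists_norm_le_of_re_ge`).

The semigroup comes from the Hille–Yosida theorem (`exists_semigroup`): the unweighted pairing is
quasi-dissipative with a constant independent of a, and the range condition follows by perturbing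
the Fourier multiplier resolvent of the free operator. A Gearhart–Prüss theorem whose constant
depends only on the initial growth and the resolvent bound (`gearhart_pruss`) gives uniform growth
in L² for a ≤ a₁; larger a are covered by dissipativity. To pass to H^s, a weighted energy combines
all derivative levels. The smoothing gain of each level absorbs the errors of the next, so only
∫(1-θ²)|u|² survives, and the L² bound controls it (`exists_growth`). -/

noncomputable section

set_option linter.unusedSectionVars false

/-! ### Operators on L²(ℝ): multiplication and weak differentiation. -/

namespace ZKLine

open Polynomial (X C)
open scoped Polynomial ComplexConjugate FourierTransform ContDiff

/-! ### Multiplication operators on `L²(ℝ)` -/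

/-- Bounded measurable functions. -/
def BddMeas (f : ℝ → ℂ) : Prop := Measurable f ∧ ∃ K : ℝ, ∀ x, ‖f x‖ ≤ K

lemma BddMeas.memLp_mul {f : ℝ → ℂ} (hf : BddMeas f) (u : L2) :
    MemLp (fun x => f x * u x) 2 volume := by
  obtain ⟨hm, K, hK⟩ := hf
  refine MemLp.of_le_mul (c := K) (Lp.memLp u)
    (hm.aestronglyMeasurable.mul (Lp.aestronglyMeasurable u)) (ae_of_all _ fun x => ?_)
  rw [norm_mul]
  exact mul_le_mul_of_nonneg_right (hK x) (norm_nonneg _)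

lemma norm_toLp_mul_le {f : ℝ → ℂ} (hf : BddMeas f) {K : ℝ} (hK : ∀ x, ‖f x‖ ≤ K) (u : L2) :
    ‖(hf.memLp_mul u).toLp‖ ≤ K * ‖u‖ := by
  refine Lp.norm_le_mul_norm_of_ae_le_mul ?_
  filter_upwards [(hf.memLp_mul u).coeFn_toLp] with x hx
  rw [hx, norm_mul]
  exact mul_le_mul_of_nonneg_right (hK x) (norm_nonneg _)

open Classical in
/-- Multiplication by a bounded measurable function, as a bounded operator on `L²(ℝ)`. -/
def mulOp (f : ℝ → ℂ) : L2 →L[ℂ] L2 :=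
  if hf : BddMeas f then
    LinearMap.mkContinuous
      { toFun := fun u => (hf.memLp_mul u).toLp
        map_add' := fun u v => by
          rw [← MemLp.toLp_add]
          refine MemLp.toLp_congr _ _ ?_
          filter_upwards [Lp.coeFn_add u v] with x hx
          rw [hx]
          exact mul_add _ _ _
        map_smul' := fun k u => by
          rw [RingHom.id_apply, ← MemLp.toLp_const_smul]
          refine MemLp.toLp_congr _ _ ?_
          filter_upwards [Lp.coeFn_smul k u] with x hx
          rw [hx]
          exact mul_left_comm _ _ _ }
      hf.2.choose (fun u => norm_toLp_mul_le hf hf.2.choose_spec u)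
  else 0

lemma coeFn_mulOp {f : ℝ → ℂ} (hf : BddMeas f) (u : L2) :
    mulOp f u =ᵐ[volume] fun x => f x * u x := by
  have : mulOp f u = (hf.memLp_mul u).toLp := by
    rw [mulOp, dif_pos hf]; rfl
  rw [this]
  exact (hf.memLp_mul u).coeFn_toLp

lemma norm_mulOp_le {f : ℝ → ℂ} (hf : Measurable f) {K : ℝ} (hK : ∀ x, ‖f x‖ ≤ K) (u : L2) :
    ‖mulOp f u‖ ≤ K * ‖u‖ := by
  have : mulOp f u = (BddMeas.memLp_mul ⟨hf, K, hK⟩ u).toLp := by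
    rw [mulOp, dif_pos ⟨hf, K, hK⟩]; rfl
  rw [this]
  exact norm_toLp_mul_le ⟨hf, K, hK⟩ hK u

lemma BddMeas.mul {f g : ℝ → ℂ} (hf : BddMeas f) (hg : BddMeas g) :
    BddMeas (fun x => f x * g x) := by
  obtain ⟨hm, K, hK⟩ := hf
  obtain ⟨hm', K', hK'⟩ := hg
  refine ⟨hm.mul hm', K * K', fun x => ?_⟩
  rw [norm_mul]
  exact mul_le_mul (hK x) (hK' x) (norm_nonneg _) ((norm_nonneg _).trans (hK x))

lemma BddMeas.add {f g : ℝ → ℂ} (hf : BddMeas f) (hg : BddMeas g) :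
    BddMeas (fun x => f x + g x) := by
  obtain ⟨hm, K, hK⟩ := hf
  obtain ⟨hm', K', hK'⟩ := hg
  exact ⟨hm.add hm', K + K', fun x => (norm_add_le _ _).trans (add_le_add (hK x) (hK' x))⟩

lemma mulOp_mulOp {f g : ℝ → ℂ} (hf : BddMeas f) (hg : BddMeas g) (u : L2) :
    mulOp f (mulOp g u) = mulOp (fun x => f x * g x) u := by
  refine Lp.ext ?_
  filter_upwards [coeFn_mulOp hf (mulOp g u), coeFn_mulOp hg u, coeFn_mulOp (hf.mul hg) u]
    with x h1 h2 h3
  rw [h1, h2, h3, mul_assoc]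

lemma mulOp_add {f g : ℝ → ℂ} (hf : BddMeas f) (hg : BddMeas g) (u : L2) :
    mulOp (fun x => f x + g x) u = mulOp f u + mulOp g u := by
  refine Lp.ext ?_
  filter_upwards [coeFn_mulOp hf u, coeFn_mulOp hg u, coeFn_mulOp (hf.add hg) u,
    Lp.coeFn_add (mulOp f u) (mulOp g u)] with x h1 h2 h3 h4
  rw [h4, Pi.add_apply, h1, h2, h3, add_mul]

lemma mulOp_const (k : ℂ) (u : L2) : mulOp (fun _ => k) u = k • u := by
  refine Lp.ext ?_
  filter_upwards [coeFn_mulOp (f := fun _ => k) ⟨measurable_const, ‖k‖, fun _ => le_rfl⟩ u,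
    Lp.coeFn_smul k u] with x h1 h2
  rw [h1, h2]; rfl

lemma inner_mulOp_left {f : ℝ → ℂ} (hf : BddMeas f) (u v : L2) :
    inner ℂ (mulOp f u) v = inner ℂ u (mulOp (fun x => conj (f x)) v) := by
  have hf' : BddMeas (fun x => conj (f x)) :=
    ⟨Complex.continuous_conj.measurable.comp hf.1, hf.2.imp fun K hK x => by simpa using hK x⟩
  rw [L2.inner_def, L2.inner_def]
  refine integral_congr_ae ?_
  filter_upwards [coeFn_mulOp hf u, coeFn_mulOp hf' v] with x h1 h2
  rw [h1, h2]
  simp only [RCLike.inner_apply, map_mul]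
  ring

lemma re_inner_mulOp_ofReal {f : ℝ → ℝ} (hf : BddMeas (fun x => (f x : ℂ))) (u : L2) :
    (inner ℂ (mulOp (fun x => (f x : ℂ)) u) u).re = ∫ x, f x * ‖u x‖ ^ 2 := by
  rw [L2.inner_def, ← RCLike.re_eq_complex_re, ← integral_re (L2.integrable_inner _ _)]
  refine integral_congr_ae ?_
  filter_upwards [coeFn_mulOp hf u] with x h1
  rw [h1]
  simp only [RCLike.inner_apply, map_mul, Complex.conj_ofReal]
  rw [mul_left_comm, Complex.mul_conj, Complex.normSq_eq_norm_sq, ← Complex.ofReal_mul]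
  exact Complex.ofReal_re _

lemma integrable_mul_sq {f : ℝ → ℝ} (hf : BddMeas (fun x => (f x : ℂ))) (u : L2) :
    Integrable (fun x => f x * ‖u x‖ ^ 2) := by
  have h := (L2.integrable_inner (𝕜 := ℂ) (mulOp (fun x => (f x : ℂ)) u) u).re
  refine h.congr ?_
  filter_upwards [coeFn_mulOp hf u] with x h1
  rw [h1]
  simp only [RCLike.inner_apply, map_mul, Complex.conj_ofReal]
  rw [mul_left_comm, Complex.mul_conj, Complex.normSq_eq_norm_sq, ← Complex.ofReal_mul]
  exact Complex.ofReal_re _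

lemma re_inner_mulOp_mono {f g : ℝ → ℝ} (hf : BddMeas (fun x => (f x : ℂ)))
    (hg : BddMeas (fun x => (g x : ℂ))) (h : ∀ x, f x ≤ g x) (u : L2) :
    (inner ℂ (mulOp (fun x => (f x : ℂ)) u) u).re ≤
      (inner ℂ (mulOp (fun x => (g x : ℂ)) u) u).re := by
  rw [re_inner_mulOp_ofReal hf, re_inner_mulOp_ofReal hg]
  exact integral_mono (integrable_mul_sq hf u) (integrable_mul_sq hg u)
    fun x => mul_le_mul_of_nonneg_right (h x) (by positivity)

/-! ### Weak derivatives on the Fourier side -/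

lemma isWeakDeriv_iff_integral {u v : L2} :
    IsWeakDeriv u v ↔ ∀ g : 𝓢(ℝ, ℂ), ∫ x, deriv g x * u x = -∫ x, g x * v x := by
  unfold IsWeakDeriv
  rw [UniformConvergenceCLM.ext_iff]
  refine forall_congr' fun g => ?_
  rw [TemperedDistribution.lineDerivOp_apply_apply, map_neg, Lp.toTemperedDistribution_apply,
    Lp.toTemperedDistribution_apply]
  have : ∀ x, (∂_{(1 : ℝ)} g : 𝓢(ℝ, ℂ)) x = deriv g x := fun x => by
    rw [SchwartzMap.lineDerivOp_apply_eq_fderiv, fderiv_apply_one_eq_deriv]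
  simp only [this, smul_eq_mul]
  exact neg_eq_iff_eq_neg

/-- The Fourier transform is injective on tempered distributions and turns ∂ₓ into multiplication by
2πiξ. A priori ξ û is only locally integrable, so the pointwise identity is recovered by testing
with compactly supported smooth functions. -/
lemma isWeakDeriv_iff_fourier {u v : L2} :
    IsWeakDeriv u v ↔
      ∀ᵐ ξ, (𝓕 v : L2) ξ = (2 * Real.pi * ξ : ℝ) * Complex.I * (𝓕 u : L2) ξ := by
  have hinj : ∀ a b : 𝓢'(ℝ, ℂ), a = b ↔ 𝓕 a = 𝓕 b := fun a b =>
    ⟨fun h => by rw [h], fun h => by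
      rw [← FourierTransform.fourierInv_fourier_eq (F := 𝓢'(ℝ, ℂ)) a, h,
        FourierTransform.fourierInv_fourier_eq]⟩
  unfold IsWeakDeriv
  rw [hinj, TemperedDistribution.fourier_lineDerivOp_eq, Lp.fourier_toTemperedDistribution_eq,
    Lp.fourier_toTemperedDistribution_eq, UniformConvergenceCLM.ext_iff]
  set U : L2 := 𝓕 u
  set V : L2 := 𝓕 v
  have htg : (fun x : ℝ => ((inner ℝ x (1 : ℝ) : ℝ) : ℂ)).HasTemperateGrowth := by fun_prop
  have key : ∀ g : 𝓢(ℝ, ℂ), ((2 * Real.pi * Complex.I) • TemperedDistribution.smulLeftCLM ℂ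
      (fun x : ℝ => ((inner ℝ x (1 : ℝ) : ℝ) : ℂ)) (U : 𝓢'(ℝ, ℂ))) g =
      ∫ x, g x • ((2 * Real.pi * x : ℝ) * Complex.I * U x) := fun g => by
    rw [UniformConvergenceCLM.smul_apply, TemperedDistribution.smulLeftCLM_apply_apply,
      Lp.toTemperedDistribution_apply, ← integral_smul]
    refine integral_congr_ae (ae_of_all _ fun x => ?_)
    simp only [SchwartzMap.smulLeftCLM_apply_apply htg, smul_eq_mul]
    simp
    ring
  simp only [key, Lp.toTemperedDistribution_apply]
  constructor
  · intro h
    have hl : LocallyIntegrable (fun x => (2 * Real.pi * x : ℝ) * Complex.I * U x) := by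
      have : LocallyIntegrable (fun x => U x) := (Lp.memLp U).locallyIntegrable (by norm_num)
      have h2 := this.continuous_smul (g := fun x : ℝ => ((2 * Real.pi * x : ℝ) * Complex.I : ℂ))
        (by fun_prop)
      exact h2
    have hV : LocallyIntegrable (fun x => V x) := (Lp.memLp V).locallyIntegrable (by norm_num)
    refine ae_eq_of_integral_contDiff_smul_eq hV hl fun g hg hc => ?_
    have hg₁ : HasCompactSupport (Complex.ofRealCLM ∘ g) := hc.comp_left rfl
    have hg₂ : ContDiff ℝ ∞ (Complex.ofRealCLM ∘ g) := by fun_prop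
    have := h (hg₁.toSchwartzMap hg₂)
    simpa using this.symm
  · intro h g
    refine integral_congr_ae ?_
    filter_upwards [h] with x hx
    rw [hx]

/-- Integration by parts without boundary terms: on the Fourier side the symbol 2πiξ is purely
imaginary. -/
lemma IsWeakDeriv.inner_eq {u u' v v' : L2} (hu : IsWeakDeriv u u') (hv : IsWeakDeriv v v') :
    inner ℂ u' v = -inner ℂ u v' := by
  rw [isWeakDeriv_iff_fourier] at hu hv
  rw [← Lp.inner_fourier_eq u' v, ← Lp.inner_fourier_eq u v', L2.inner_def, L2.inner_def,
    ← integral_neg]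
  refine integral_congr_ae ?_
  filter_upwards [hu, hv] with x h1 h2
  rw [h1, h2]
  simp only [RCLike.inner_apply, map_mul, Complex.conj_I, Complex.conj_ofReal]
  ring

lemma IsWeakDeriv.neg {u v : L2} (h : IsWeakDeriv u v) : IsWeakDeriv (-u) (-v) := by
  simpa using h.smul (-1)

lemma IsWeakDeriv.sub {u v u' v' : L2} (h : IsWeakDeriv u v) (h' : IsWeakDeriv u' v') :
    IsWeakDeriv (u - u') (v - v') := by
  simpa [sub_eq_add_neg] using h.add h'.neg

lemma IsWeakDeriv.sum {ι : Type*} (t : Finset ι) {u v : ι → L2}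
    (h : ∀ i ∈ t, IsWeakDeriv (u i) (v i)) : IsWeakDeriv (∑ i ∈ t, u i) (∑ i ∈ t, v i) := by
  classical
  induction t using Finset.induction_on with
  | empty => simpa using isWeakDeriv_zero
  | insert a t ha ih =>
    rw [Finset.sum_insert ha, Finset.sum_insert ha]
    exact (h a (Finset.mem_insert_self _ _)).add
      (ih fun i hi => h i (Finset.mem_insert_of_mem hi))

end ZKLine

/-! ### The algebra of polynomials in tanh. -/

namespace ZKLine

open Polynomial (X C)
open scoped Polynomial ComplexConjugate FourierTransform ContDiff

/-! ### Polynomials in `θ(x) = tanh(√c x / 2)` -/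

/-- `θ(x) = tanh(√c x / 2)`. -/
def theta (c x : ℝ) : ℝ := Real.tanh (Real.sqrt c * x / 2)

lemma one_sub_tanh_sq (x : ℝ) : 1 - Real.tanh x ^ 2 = (Real.cosh x ^ 2)⁻¹ := by
  have h := Real.cosh_pos x
  rw [Real.tanh_eq_sinh_div_cosh]
  field_simp
  linarith [Real.cosh_sq x]

lemma theta_sq_lt_one (c x : ℝ) : theta c x ^ 2 < 1 := by
  have h := one_sub_tanh_sq (Real.sqrt c * x / 2)
  have h' : 0 < (Real.cosh (Real.sqrt c * x / 2) ^ 2)⁻¹ := by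
    have := Real.cosh_pos (Real.sqrt c * x / 2)
    positivity
  rw [theta]; linarith

lemma theta_mem (c x : ℝ) : theta c x ∈ Set.Icc (-1 : ℝ) 1 := by
  have h := theta_sq_lt_one c x
  constructor <;> nlinarith

lemma hasDerivAt_theta (c x : ℝ) :
    HasDerivAt (theta c) (Real.sqrt c / 2 * (1 - theta c x ^ 2)) x := by
  have h1 : HasDerivAt (fun y : ℝ => Real.sqrt c * y / 2) (Real.sqrt c / 2) x := by
    simpa using ((hasDerivAt_id x).const_mul (Real.sqrt c)).div_const 2
  have h2 : HasDerivAt Real.tanh (1 - Real.tanh (Real.sqrt c * x / 2) ^ 2)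
      (Real.sqrt c * x / 2) := by
    have hc := Real.cosh_pos (Real.sqrt c * x / 2)
    have := (Real.hasDerivAt_sinh (Real.sqrt c * x / 2)).div
      (Real.hasDerivAt_cosh (Real.sqrt c * x / 2)) hc.ne'
    have e : (fun y => Real.sinh y / Real.cosh y) = Real.tanh := by
      funext y; rw [Real.tanh_eq_sinh_div_cosh]
    change HasDerivAt (fun y => Real.sinh y / Real.cosh y) _ _ at this
    rw [e] at this
    convert this using 1
    rw [Real.tanh_eq_sinh_div_cosh]
    field_simp
  have := h2.comp x h1
  rw [mul_comm] at this
  exact this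

/-- The derivation on polynomials in `θ` induced by `∂ₓ`. -/
def polyD (c : ℝ) (p : ℝ[X]) : ℝ[X] := C (Real.sqrt c / 2) * (1 - X ^ 2) * p.derivative

/-- The function `p(θ(x))`. -/
def thetaPoly (c : ℝ) (p : ℝ[X]) (x : ℝ) : ℝ := p.eval (theta c x)

lemma hasDerivAt_thetaPoly (c : ℝ) (p : ℝ[X]) (x : ℝ) :
    HasDerivAt (thetaPoly c p) (thetaPoly c (polyD c p) x) x := by
  have := (p.hasDerivAt (theta c x)).comp x (hasDerivAt_theta c x)
  refine HasDerivAt.congr_deriv (f := thetaPoly c p) this ?_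
  simp only [thetaPoly, polyD, Polynomial.eval_mul, Polynomial.eval_sub, Polynomial.eval_C,
    Polynomial.eval_one, Polynomial.eval_pow, Polynomial.eval_X]
  ring

lemma iteratedDeriv_thetaPoly (c : ℝ) (n : ℕ) (p : ℝ[X]) :
    iteratedDeriv n (thetaPoly c p) = thetaPoly c ((polyD c)^[n] p) := by
  induction n generalizing p with
  | zero => simp
  | succ n ih =>
    have : deriv (thetaPoly c p) = thetaPoly c (polyD c p) :=
      funext fun x => (hasDerivAt_thetaPoly c p x).deriv
    rw [iteratedDeriv_succ', this, ih, Function.iterate_succ_apply]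

lemma contDiff_thetaPoly (c : ℝ) (p : ℝ[X]) : ContDiff ℝ ∞ (thetaPoly c p) := by
  refine contDiff_of_differentiable_iteratedDeriv (n := ⊤) fun m _ => ?_
  rw [iteratedDeriv_thetaPoly]
  exact fun x => (hasDerivAt_thetaPoly c _ x).differentiableAt

lemma exists_bound_thetaPoly (c : ℝ) (p : ℝ[X]) : ∃ K, 0 < K ∧ ∀ x, |thetaPoly c p x| ≤ K := by
  obtain ⟨K, hK⟩ := isCompact_Icc.exists_bound_of_continuousOn (s := Set.Icc (-1 : ℝ) 1)
    (f := fun y => p.eval y) p.continuous.continuousOn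
  exact ⟨max K 1, by positivity, fun x => (hK _ (theta_mem c x)).trans (le_max_left _ _)⟩

lemma hasTemperateGrowth_thetaPoly (c : ℝ) (p : ℝ[X]) :
    (fun x => (thetaPoly c p x : ℂ)).HasTemperateGrowth := by
  have : (thetaPoly c p).HasTemperateGrowth := by
    refine ⟨contDiff_thetaPoly c p, fun n => ?_⟩
    obtain ⟨K, _, hK⟩ := exists_bound_thetaPoly c ((polyD c)^[n] p)
    refine ⟨0, K, fun x => ?_⟩
    rw [norm_iteratedFDeriv_eq_norm_iteratedDeriv, iteratedDeriv_thetaPoly]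
    simpa using hK x
  fun_prop

lemma continuous_thetaPoly (c : ℝ) (p : ℝ[X]) : Continuous (thetaPoly c p) :=
  (contDiff_thetaPoly c p).continuous

lemma bddMeas_thetaPoly (c : ℝ) (p : ℝ[X]) : BddMeas (fun x => (thetaPoly c p x : ℂ)) := by
  obtain ⟨K, _, hK⟩ := exists_bound_thetaPoly c p
  refine ⟨(Complex.continuous_ofReal.comp (continuous_thetaPoly c p)).measurable, K, fun x => ?_⟩
  simpa using hK x

/-- Multiplication by `p(θ)` on `L²(ℝ)`. -/
def thetaMul (c : ℝ) (p : ℝ[X]) : L2 →L[ℂ] L2 := mulOp (fun x => (thetaPoly c p x : ℂ))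

lemma coeFn_thetaMul (c : ℝ) (p : ℝ[X]) (u : L2) :
    thetaMul c p u =ᵐ[volume] fun x => (thetaPoly c p x : ℂ) * u x :=
  coeFn_mulOp (bddMeas_thetaPoly c p) u

lemma thetaMul_mul (c : ℝ) (p q : ℝ[X]) (u : L2) :
    thetaMul c (p * q) u = thetaMul c p (thetaMul c q u) := by
  rw [thetaMul, thetaMul, thetaMul, mulOp_mulOp (bddMeas_thetaPoly c p) (bddMeas_thetaPoly c q)]
  congr 2
  funext x
  simp [thetaPoly]

lemma thetaMul_add (c : ℝ) (p q : ℝ[X]) (u : L2) :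
    thetaMul c (p + q) u = thetaMul c p u + thetaMul c q u := by
  rw [thetaMul, thetaMul, thetaMul, ← mulOp_add (bddMeas_thetaPoly c p) (bddMeas_thetaPoly c q)]
  congr 2
  funext x
  simp [thetaPoly]

lemma thetaMul_C (c k : ℝ) (u : L2) : thetaMul c (C k) u = (k : ℂ) • u := by
  rw [thetaMul, ← mulOp_const]
  congr 2
  funext x
  simp [thetaPoly]

lemma thetaMul_one (c : ℝ) (u : L2) : thetaMul c 1 u = u := by
  simpa using thetaMul_C c 1 u

lemma thetaMul_C_mul (c k : ℝ) (p : ℝ[X]) (u : L2) :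
    thetaMul c (C k * p) u = (k : ℂ) • thetaMul c p u := by
  rw [thetaMul_mul, thetaMul_C]

lemma thetaMul_zero (c : ℝ) (u : L2) : thetaMul c 0 u = 0 := by
  simpa using thetaMul_C c 0 u

lemma inner_thetaMul_left (c : ℝ) (p : ℝ[X]) (u v : L2) :
    inner ℂ (thetaMul c p u) v = inner ℂ u (thetaMul c p v) := by
  rw [thetaMul, inner_mulOp_left (bddMeas_thetaPoly c p)]
  simp only [Complex.conj_ofReal]

/-- The quadratic form `∫ p(θ) |u|²`. -/
def thetaForm (c : ℝ) (p : ℝ[X]) (u : L2) : ℝ := (inner ℂ (thetaMul c p u) u).re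

/-- As θ takes values in [-1, 1], comparing weighted forms reduces to comparing polynomials on [-1,
1]; all weight estimates below are obtained in this way. -/
lemma thetaForm_mono (c : ℝ) {p q : ℝ[X]}
    (h : ∀ y ∈ Set.Icc (-1 : ℝ) 1, p.eval y ≤ q.eval y) (u : L2) :
    thetaForm c p u ≤ thetaForm c q u :=
  re_inner_mulOp_mono (bddMeas_thetaPoly c p) (bddMeas_thetaPoly c q)
    (fun x => h _ (theta_mem c x)) u

lemma thetaForm_C_mul (c k : ℝ) (p : ℝ[X]) (u : L2) :
    thetaForm c (C k * p) u = k * thetaForm c p u := by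
  rw [thetaForm, thetaMul_C_mul, inner_smul_left, Complex.conj_ofReal, Complex.re_ofReal_mul,
    thetaForm]

lemma thetaForm_add (c : ℝ) (p q : ℝ[X]) (u : L2) :
    thetaForm c (p + q) u = thetaForm c p u + thetaForm c q u := by
  rw [thetaForm, thetaMul_add, inner_add_left, Complex.add_re, thetaForm, thetaForm]

lemma thetaForm_one (c : ℝ) (u : L2) : thetaForm c 1 u = ‖u‖ ^ 2 := by
  rw [thetaForm, thetaMul_one, inner_self_eq_norm_sq_to_K]
  norm_cast

lemma thetaForm_C (c k : ℝ) (u : L2) : thetaForm c (C k) u = k * ‖u‖ ^ 2 := by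
  rw [← mul_one (C k), thetaForm_C_mul, thetaForm_one]

lemma thetaForm_nonneg (c : ℝ) {p : ℝ[X]}
    (h : ∀ y ∈ Set.Icc (-1 : ℝ) 1, 0 ≤ p.eval y) (u : L2) : 0 ≤ thetaForm c p u := by
  have := thetaForm_mono c (p := 0) (q := p) (by simpa using h) u
  simpa [thetaForm, thetaMul_zero] using this

lemma norm_thetaMul_sq (c : ℝ) (p : ℝ[X]) (u : L2) :
    ‖thetaMul c p u‖ ^ 2 = thetaForm c (p ^ 2) u := by
  rw [thetaForm, sq p, thetaMul_mul, inner_thetaMul_left, inner_self_eq_norm_sq_to_K]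
  norm_cast

/-- The product rule follows by inserting p(θ)g as a test function for u; it is Schwartz because
p(θ) has temperate growth. -/
lemma IsWeakDeriv.thetaMul (c : ℝ) (p : ℝ[X]) {u v : L2} (h : IsWeakDeriv u v) :
    IsWeakDeriv (thetaMul c p u) (thetaMul c (polyD c p) u + thetaMul c p v) := by
  rw [isWeakDeriv_iff_integral] at h ⊢
  intro g
  set w : ℝ → ℂ := fun x => (thetaPoly c p x : ℂ)
  have hw : w.HasTemperateGrowth := hasTemperateGrowth_thetaPoly c p
  have e := h (SchwartzMap.smulLeftCLM ℂ w g)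
  have hwg : ∀ x, SchwartzMap.smulLeftCLM ℂ w g x = w x * g x := fun x => by
    rw [SchwartzMap.smulLeftCLM_apply_apply hw]; rfl
  have hd : ∀ x, deriv (SchwartzMap.smulLeftCLM ℂ w g) x =
      (thetaPoly c (polyD c p) x : ℂ) * g x + w x * deriv g x := fun x => by
    have : (SchwartzMap.smulLeftCLM ℂ w g : ℝ → ℂ) = fun x => w x * g x := funext hwg
    rw [this]
    exact ((hasDerivAt_thetaPoly c p x).ofReal_comp.mul g.differentiableAt.hasDerivAt).deriv
  have hint : ∀ (f : 𝓢(ℝ, ℂ)) (z : L2), Integrable (fun x => f x * z x) := fun f z =>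
    MemLp.integrable_mul (p := 2) (q := 2) (f.memLp 2) (Lp.memLp z)
  have hint2 : Integrable (fun x => deriv g x * ZKLine.thetaMul c p u x) := by
    have := hint (SchwartzMap.derivCLM ℂ ℂ g) (ZKLine.thetaMul c p u)
    simpa using this
  have e1 : ∫ x, deriv (SchwartzMap.smulLeftCLM ℂ w g) x * u x =
      (∫ x, g x * ZKLine.thetaMul c (polyD c p) u x) +
        ∫ x, deriv g x * ZKLine.thetaMul c p u x := by
    rw [← integral_add (hint g _) hint2]
    refine integral_congr_ae ?_
    filter_upwards [coeFn_thetaMul c p u, coeFn_thetaMul c (polyD c p) u] with x h1 h2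
    rw [h1, h2, hd]
    ring
  have e2 : ∫ x, SchwartzMap.smulLeftCLM ℂ w g x * v x = ∫ x, g x * ZKLine.thetaMul c p v x := by
    refine integral_congr_ae ?_
    filter_upwards [coeFn_thetaMul c p v] with x h1
    rw [h1, hwg]
    ring
  have e3 : ∫ x, g x * (ZKLine.thetaMul c (polyD c p) u + ZKLine.thetaMul c p v : L2) x =
      (∫ x, g x * ZKLine.thetaMul c (polyD c p) u x) + ∫ x, g x * ZKLine.thetaMul c p v x := by
    rw [← integral_add (hint g _) (hint g _)]
    refine integral_congr_ae ?_
    filter_upwards [Lp.coeFn_add (ZKLine.thetaMul c (polyD c p) u) (ZKLine.thetaMul c p v)]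
      with x h1
    rw [h1, Pi.add_apply]
    ring
  rw [e1, e2] at e
  rw [e3]
  linear_combination e

/-- The soliton as a polynomial in `θ`. -/
def solitonPoly (c : ℝ) : ℝ[X] := C (3 * c / 2) * (1 - X ^ 2)

lemma thetaPoly_solitonPoly (c x : ℝ) : thetaPoly c (solitonPoly c) x = Q c x := by
  simp [thetaPoly, solitonPoly, Q, theta, one_sub_tanh_sq]

end ZKLine

/-! ### Weighted energy estimates, uniform in the parameter. -/

namespace ZKLine

open Polynomial (X C)
open scoped Polynomial ComplexConjugate FourierTransform ContDiff

/-! ### Energy identities -/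

/-- The localised form `∫ (1 - θ²) |u|²`. -/
def locForm (c : ℝ) (u : L2) : ℝ := thetaForm c (1 - X ^ 2) u

lemma locForm_nonneg (c : ℝ) (u : L2) : 0 ≤ locForm c u :=
  thetaForm_nonneg c (fun y hy => by
    simp only [Polynomial.eval_sub, Polynomial.eval_one, Polynomial.eval_pow, Polynomial.eval_X]
    nlinarith [hy.1, hy.2]) u

lemma locForm_le (c : ℝ) (u : L2) : locForm c u ≤ ‖u‖ ^ 2 := by
  rw [← thetaForm_one c]
  refine thetaForm_mono c (fun y _ => ?_) u
  simp only [Polynomial.eval_sub, Polynomial.eval_one, Polynomial.eval_pow, Polynomial.eval_X]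
  nlinarith [sq_nonneg y]

lemma thetaForm_add_add_sub (c : ℝ) (p : ℝ[X]) (u v : L2) :
    thetaForm c p (u + v) + thetaForm c p (u - v) = 2 * (thetaForm c p u + thetaForm c p v) := by
  simp only [thetaForm, map_add, map_sub, inner_add_left, inner_add_right, inner_sub_left,
    inner_sub_right, Complex.add_re, Complex.sub_re]
  ring

lemma re_inner_thetaMul_comm (c : ℝ) (p : ℝ[X]) (u v : L2) :
    (inner ℂ (thetaMul c p u) v).re = (inner ℂ (thetaMul c p v) u).re := by
  rw [inner_thetaMul_left, ← inner_conj_symm, Complex.conj_re]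

lemma thetaForm_add_sub_sub (c : ℝ) (p : ℝ[X]) (u v : L2) :
    thetaForm c p (u + v) - thetaForm c p (u - v) = 4 * (inner ℂ (thetaMul c p u) v).re := by
  have := re_inner_thetaMul_comm c p u v
  simp only [thetaForm, map_add, map_sub, inner_add_left, inner_add_right, inner_sub_left,
    inner_sub_right, Complex.add_re, Complex.sub_re]
  linarith

/-- The cofactor of 1 - X² is bounded on [-1, 1]. Divisibility by 1 - X² is the algebraic form of
localisation near the soliton. -/
lemma exists_abs_thetaForm_le (c : ℝ) {p : ℝ[X]} (hp : (1 - X ^ 2 : ℝ[X]) ∣ p) :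
    ∃ K, 0 ≤ K ∧ ∀ u, |thetaForm c p u| ≤ K * locForm c u := by
  obtain ⟨r, rfl⟩ := hp
  obtain ⟨K, hK⟩ := isCompact_Icc.exists_bound_of_continuousOn (s := Set.Icc (-1 : ℝ) 1)
    (f := fun y => r.eval y) r.continuous.continuousOn
  refine ⟨max K 0, le_max_right _ _, fun u => ?_⟩
  have hK' : ∀ y ∈ Set.Icc (-1 : ℝ) 1, |r.eval y| ≤ max K 0 := fun y hy =>
    (hK y hy).trans (le_max_left _ _)
  have h0 : ∀ y ∈ Set.Icc (-1 : ℝ) 1, 0 ≤ 1 - y ^ 2 := fun y hy => by nlinarith [hy.1, hy.2]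
  rw [abs_le, locForm]
  constructor
  · rw [← neg_mul, ← thetaForm_C_mul]
    refine thetaForm_mono c (fun y hy => ?_) u
    have := (abs_le.1 (hK' y hy)).1
    simp only [Polynomial.eval_mul, Polynomial.eval_C, Polynomial.eval_sub, Polynomial.eval_one,
      Polynomial.eval_pow, Polynomial.eval_X]
    nlinarith [h0 y hy]
  · rw [← thetaForm_C_mul]
    refine thetaForm_mono c (fun y hy => ?_) u
    have := (abs_le.1 (hK' y hy)).2
    simp only [Polynomial.eval_mul, Polynomial.eval_C, Polynomial.eval_sub, Polynomial.eval_one,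
      Polynomial.eval_pow, Polynomial.eval_X]
    nlinarith [h0 y hy]

/-- Polarisation reduces this to the quadratic bound at u ± v, and the parallelogram identity for
`locForm` recombines the two. -/
lemma exists_abs_re_inner_thetaMul_le (c : ℝ) {p : ℝ[X]} (hp : (1 - X ^ 2 : ℝ[X]) ∣ p) :
    ∃ K, 0 ≤ K ∧ ∀ u v, |(inner ℂ (thetaMul c p u) v).re| ≤ K * (locForm c u + locForm c v) := by
  obtain ⟨K, hK0, hK⟩ := exists_abs_thetaForm_le c hp
  refine ⟨K, hK0, fun u v => ?_⟩
  have h1 := thetaForm_add_sub_sub c p u v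
  have h2 := thetaForm_add_add_sub c (1 - X ^ 2) u v
  have h3 := hK (u + v)
  have h4 := hK (u - v)
  have h5 : 0 ≤ K * (locForm c u + locForm c v) :=
    mul_nonneg hK0 (add_nonneg (locForm_nonneg c u) (locForm_nonneg c v))
  have h6 : K * locForm c (u + v) + K * locForm c (u - v) =
      2 * (K * (locForm c u + locForm c v)) := by
    rw [← mul_add]; simp only [locForm]; rw [h2]; ring
  rw [abs_le] at *
  constructor <;> linarith [h3.1, h3.2, h4.1, h4.2]

lemma dvd_polyD (c : ℝ) (p : ℝ[X]) : (1 - X ^ 2 : ℝ[X]) ∣ polyD c p :=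
  Dvd.intro_left (C (Real.sqrt c / 2)) rfl |>.mul_right _

lemma re_inner_thetaMul_deriv (c : ℝ) (p : ℝ[X]) {v v' : L2} (h : IsWeakDeriv v v') :
    (inner ℂ (thetaMul c p v') v).re = -(thetaForm c (polyD c p) v) / 2 := by
  have h1 := congrArg Complex.re ((h.thetaMul c p).inner_eq h)
  rw [inner_add_left, Complex.add_re, Complex.neg_re, re_inner_thetaMul_comm c p v v'] at h1
  rw [thetaForm]
  linarith

lemma re_inner_thetaMul_deriv_two (c : ℝ) (p : ℝ[X]) {v v' v'' : L2} (h : IsWeakDeriv v v')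
    (h' : IsWeakDeriv v' v'') :
    (inner ℂ (thetaMul c p v'') v).re =
      thetaForm c (polyD c (polyD c p)) v / 2 - thetaForm c p v' := by
  have h1 := congrArg Complex.re ((h'.thetaMul c p).inner_eq h)
  rw [inner_add_left, Complex.add_re, Complex.neg_re] at h1
  have h2 := re_inner_thetaMul_deriv c (polyD c p) h
  simp only [thetaForm] at *
  linarith

/-- Source of Kato smoothing: the operator contains -∂ₓ³, so a weight increasing in x yields a
negative multiple of ∫ p'|v'|². -/
lemma re_inner_thetaMul_deriv_three (c : ℝ) (p : ℝ[X]) {v v' v'' v''' : L2}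
    (h : IsWeakDeriv v v') (h' : IsWeakDeriv v' v'') (h'' : IsWeakDeriv v'' v''') :
    (inner ℂ (thetaMul c p v''') v).re =
      3 / 2 * thetaForm c (polyD c p) v' -
        thetaForm c (polyD c (polyD c (polyD c p))) v / 2 := by
  have h1 := congrArg Complex.re ((h''.thetaMul c p).inner_eq h)
  rw [inner_add_left, Complex.add_re, Complex.neg_re] at h1
  have h2 := re_inner_thetaMul_deriv_two c (polyD c p) h h'
  have h3 := re_inner_thetaMul_deriv c p h'
  linarith

/-! ### Chains of weak derivatives and the Leibniz rule -/

/-- `v (j + 1)` is the weak derivative of `v j` for `j < n`. -/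
def IsChain (n : ℕ) (v : ℕ → L2) : Prop := ∀ j < n, IsWeakDeriv (v j) (v (j + 1))

lemma IsChain.mono {n m : ℕ} {v : ℕ → L2} (h : IsChain n v) (hm : m ≤ n) : IsChain m v :=
  fun j hj => h j (hj.trans_le hm)

lemma IsChain.eq {n : ℕ} {v w : ℕ → L2} (hv : IsChain n v) (hw : IsChain n w) (h0 : v 0 = w 0) :
    ∀ j ≤ n, v j = w j := by
  intro j
  induction j with
  | zero => exact fun _ => h0
  | succ j ih =>
    intro hj
    have h1 := hv j hj
    rw [ih (by omega)] at h1
    exact h1.unique (hw j hj)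

/-- The coefficients in `∂ᵐ(p v) = ∑ᵢ (leibniz m i) ∂ⁱv`. -/
def leibniz (c : ℝ) (p : ℝ[X]) : ℕ → ℕ → ℝ[X]
  | 0, 0 => p
  | 0, _ + 1 => 0
  | m + 1, 0 => polyD c (leibniz c p m 0)
  | m + 1, i + 1 => polyD c (leibniz c p m (i + 1)) + leibniz c p m i

lemma polyD_zero (c : ℝ) : polyD c 0 = 0 := by simp [polyD]

lemma leibniz_of_lt (c : ℝ) (p : ℝ[X]) (m : ℕ) : ∀ i, m < i → leibniz c p m i = 0 := by
  induction m with
  | zero =>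
    intro i hi
    obtain ⟨i, rfl⟩ := Nat.exists_eq_succ_of_ne_zero hi.ne'
    rfl
  | succ m ih =>
    intro i hi
    obtain ⟨i, rfl⟩ := Nat.exists_eq_succ_of_ne_zero (by omega : i ≠ 0)
    rw [Nat.succ_eq_add_one, leibniz, ih _ (by omega), ih _ (by omega), polyD_zero, add_zero]

lemma leibniz_self (c : ℝ) (p : ℝ[X]) (m : ℕ) : leibniz c p m m = p := by
  induction m with
  | zero => rfl
  | succ m ih => rw [leibniz, leibniz_of_lt c p m _ (by omega), ih, polyD_zero, zero_add]

lemma dvd_leibniz (c : ℝ) {p : ℝ[X]} (hp : (1 - X ^ 2 : ℝ[X]) ∣ p) (m : ℕ) :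
    ∀ i, (1 - X ^ 2 : ℝ[X]) ∣ leibniz c p m i := by
  induction m with
  | zero => rintro (_ | i); exacts [hp, dvd_zero _]
  | succ m ih => rintro (_ | i); exacts [dvd_polyD _ _, dvd_add (dvd_polyD _ _) (ih i)]

/-- The derivatives of the product `p(θ) v`. -/
def leibnizSum (c : ℝ) (p : ℝ[X]) (v : ℕ → L2) (m : ℕ) : L2 :=
  ∑ i ∈ Finset.range (m + 1), thetaMul c (leibniz c p m i) (v i)

lemma leibnizSum_zero (c : ℝ) (p : ℝ[X]) (v : ℕ → L2) :
    leibnizSum c p v 0 = thetaMul c p (v 0) := by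
  simp [leibnizSum, leibniz]

lemma leibnizSum_one (c : ℝ) (p : ℝ[X]) (v : ℕ → L2) :
    leibnizSum c p v 1 = thetaMul c (polyD c p) (v 0) + thetaMul c p (v 1) := by
  simp [leibnizSum, leibniz, Finset.sum_range_succ, polyD_zero]

lemma IsChain.leibnizSum (c : ℝ) (p : ℝ[X]) {n : ℕ} {v : ℕ → L2} (hv : IsChain n v) :
    IsChain n (leibnizSum c p v) := by
  intro m hm
  have h := IsWeakDeriv.sum (Finset.range (m + 1)) (u := fun i => thetaMul c (leibniz c p m i) (v i))
    (v := fun i => thetaMul c (polyD c (leibniz c p m i)) (v i) +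
      thetaMul c (leibniz c p m i) (v (i + 1)))
    (fun i hi => (hv i (by rw [Finset.mem_range] at hi; omega)).thetaMul c _)
  have e : ZKLine.leibnizSum c p v (m + 1) = ∑ i ∈ Finset.range (m + 1),
      (thetaMul c (polyD c (leibniz c p m i)) (v i) +
        thetaMul c (leibniz c p m i) (v (i + 1))) := by
    rw [ZKLine.leibnizSum, Finset.sum_range_succ', Finset.sum_add_distrib]
    simp only [leibniz, thetaMul_add]
    rw [Finset.sum_add_distrib,
      Finset.sum_range_succ' (fun i => thetaMul c (polyD c (leibniz c p m i)) (v i)),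
      Finset.sum_range_succ (fun i => thetaMul c (polyD c (leibniz c p m (i + 1))) (v (i + 1))),
      leibniz_of_lt c p m (m + 1) (by omega), polyD_zero, thetaMul_zero]
    abel
  rw [e]
  exact h

/-- The derivatives of `∂ₓ(-∂ₓ² + α - 2 Q_c) v`. -/
def linSeq (c α : ℝ) (v : ℕ → L2) (j : ℕ) : L2 :=
  -v (j + 3) + (α : ℂ) • v (j + 1) - (2 : ℂ) • leibnizSum c (solitonPoly c) v (j + 1)

lemma IsChain.linSeq (c α : ℝ) {n : ℕ} {v : ℕ → L2} (hv : IsChain (n + 3) v) :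
    IsChain n (linSeq c α v) := by
  intro j hj
  have h1 := hv (j + 3) (by omega)
  have h2 := hv (j + 1) (by omega)
  have h3 := hv.leibnizSum c (solitonPoly c) (j + 1) (by omega)
  exact (h1.neg.add (h2.smul _)).sub (h3.smul _)

/-- Only -∂ₓ³ and α∂ₓ leave explicit terms. The other coefficients are the third derivative of p(θ),
the derivative of p(θ)Q_c, and p times a Leibniz coefficient of the soliton, all divisible by 1 -
θ². Since α enters only through an explicit term, K does not depend on it. -/
lemma exists_re_inner_linSeq_le (c : ℝ) (p : ℝ[X]) (j : ℕ) :
    ∃ K, 0 ≤ K ∧ ∀ (α : ℝ) (v : ℕ → L2), IsChain (j + 3) v →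
      (inner ℂ (thetaMul c p (linSeq c α v j)) (v j)).re ≤
        -(3 / 2) * thetaForm c (polyD c p) (v (j + 1)) - α / 2 * thetaForm c (polyD c p) (v j) +
          K * ∑ i ∈ Finset.range (j + 1), locForm c (v i) := by
  have hq : (1 - X ^ 2 : ℝ[X]) ∣ solitonPoly c := Dvd.intro_left _ rfl
  obtain ⟨K1, hK1, h1⟩ := exists_abs_thetaForm_le c (dvd_polyD c (polyD c (polyD c p)))
  obtain ⟨K2, hK2, h2⟩ := exists_abs_thetaForm_le c (dvd_polyD c (p * solitonPoly c))
  choose K3 hK3 h3 using fun i => exists_abs_re_inner_thetaMul_le c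
    ((dvd_leibniz c hq (j + 1) i).mul_left p)
  refine ⟨K1 + K2 + 4 * ∑ i ∈ Finset.range (j + 1), K3 i,
    add_nonneg (add_nonneg hK1 hK2) (mul_nonneg (by norm_num)
      (Finset.sum_nonneg fun i _ => hK3 i)), fun α v hv => ?_⟩
  set S := ∑ i ∈ Finset.range (j + 1), locForm c (v i)
  have hS : ∀ i ∈ Finset.range (j + 1), locForm c (v i) ≤ S := fun i hi =>
    Finset.single_le_sum (f := fun i => locForm c (v i)) (fun i _ => locForm_nonneg c (v i)) hi
  have hSj := hS j (Finset.self_mem_range_succ j)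
  have e1 := re_inner_thetaMul_deriv_three c p (hv j (by omega)) (hv (j + 1) (by omega))
    (hv (j + 2) (by omega))
  have e2 := re_inner_thetaMul_deriv c p (hv j (by omega))
  have e3 := re_inner_thetaMul_deriv c (p * solitonPoly c) (hv j (by omega))
  -- The top Leibniz term contains v (j + 1), which the error bound does not allow. It is isolated
  -- because integration by parts (`e3`) turns it into a form in v j.
  have e4 : (inner ℂ (thetaMul c p (leibnizSum c (solitonPoly c) v (j + 1))) (v j)).re =
      ∑ i ∈ Finset.range (j + 1),
        (inner ℂ (thetaMul c (p * leibniz c (solitonPoly c) (j + 1) i) (v i)) (v j)).re +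
        (inner ℂ (thetaMul c (p * solitonPoly c) (v (j + 1))) (v j)).re := by
    rw [leibnizSum, map_sum, sum_inner, Complex.re_sum, Finset.sum_range_succ, leibniz_self]
    simp only [thetaMul_mul]
  have e5 : |∑ i ∈ Finset.range (j + 1),
      (inner ℂ (thetaMul c (p * leibniz c (solitonPoly c) (j + 1) i) (v i)) (v j)).re| ≤
      2 * (∑ i ∈ Finset.range (j + 1), K3 i) * S := by
    refine (Finset.abs_sum_le_sum_abs _ _).trans ?_
    rw [mul_assoc, Finset.sum_mul, Finset.mul_sum]
    refine Finset.sum_le_sum fun i hi => (h3 i _ _).trans ?_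
    nlinarith [hS i hi, hK3 i]
  have e6 : (inner ℂ (thetaMul c p (linSeq c α v j)) (v j)).re =
      -(inner ℂ (thetaMul c p (v (j + 3))) (v j)).re +
      α * (inner ℂ (thetaMul c p (v (j + 1))) (v j)).re -
      2 * (inner ℂ (thetaMul c p (leibnizSum c (solitonPoly c) v (j + 1))) (v j)).re := by
    rw [linSeq]
    simp only [map_add, map_sub, map_neg, map_smul, inner_add_left, inner_sub_left,
      inner_neg_left, inner_smul_left, Complex.add_re, Complex.sub_re, Complex.neg_re,
      Complex.conj_ofReal, Complex.re_ofReal_mul, map_ofNat]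
    simp
  have h1' := h1 (v j)
  have h2' := h2 (v j)
  have h1'' := mul_le_mul_of_nonneg_left hSj hK1
  have h2'' := mul_le_mul_of_nonneg_left hSj hK2
  rw [abs_le] at e5 h1' h2'
  have hS0 : 0 ≤ S := (locForm_nonneg c (v j)).trans hSj
  rw [e6, e1, e2, e4, e3]
  nlinarith [mul_nonneg hK1 hS0, mul_nonneg hK2 hS0, e5.1, e5.2, h1'.1, h1'.2, h2'.1, h2'.2]

/-! ### Weighted energies -/

/-- The weight `1 + θ/2`. -/
def wt : ℝ[X] := 1 + C (1 / 2) * X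

/-- The derivative of the weight is a multiple of 1 - θ² itself, so the gain is measured by exactly
the form `locForm` that measures the errors. -/
lemma polyD_wt (c : ℝ) : polyD c wt = C (Real.sqrt c / 4) * (1 - X ^ 2) := by
  simp only [polyD, wt, Polynomial.derivative_add, Polynomial.derivative_one, zero_add,
    Polynomial.derivative_C_mul, Polynomial.derivative_X, mul_one]
  rw [mul_right_comm, ← Polynomial.C_mul]
  congr 2
  ring

lemma thetaForm_wt_ge (c : ℝ) (u : L2) : 1 / 2 * ‖u‖ ^ 2 ≤ thetaForm c wt u := by
  rw [← thetaForm_C c]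
  refine thetaForm_mono c (fun y hy => ?_) u
  simp [wt]; linarith [hy.1]

lemma thetaForm_wt_le (c : ℝ) (u : L2) : thetaForm c wt u ≤ 3 / 2 * ‖u‖ ^ 2 := by
  rw [← thetaForm_C c]
  refine thetaForm_mono c (fun y hy => ?_) u
  simp [wt]; linarith [hy.2]

/-- Here κ = 3/2 · √c/4, and α∂ₓ contributes -α/2 · √c/4 = -κα/3. This second gain beats K once α is
large, while the first controls the local size of the derivative. -/
lemma exists_re_inner_wt_le {c : ℝ} (hc : 0 < c) :
    ∃ κ K : ℝ, 0 < κ ∧ 0 ≤ K ∧ ∀ (α : ℝ) (v : ℕ → L2), IsChain 3 v →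
      (inner ℂ (thetaMul c wt (linSeq c α v 0)) (v 0)).re ≤
        -κ * locForm c (v 1) + (K - κ / 3 * α) * locForm c (v 0) := by
  obtain ⟨K, hK, h⟩ := exists_re_inner_linSeq_le c wt 0
  refine ⟨3 / 8 * Real.sqrt c, K, by have := Real.sqrt_pos.2 hc; positivity, hK,
    fun α v hv => (h α v hv).trans (le_of_eq ?_)⟩
  rw [polyD_wt, thetaForm_C_mul, thetaForm_C_mul]
  simp [locForm]
  ring

/-- The errors at level j involve `locForm` at levels 0, …, j, and those at levels 1, …, j are gains
of the levels below. Weighting lower levels heavily enough leaves only the error at level 0. -/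
lemma exists_weights {c : ℝ} (hc : 0 < c) (s : ℕ) :
    ∃ (β : ℕ → ℝ) (K : ℝ), (∀ j, 0 < β j) ∧ 0 ≤ K ∧ ∀ (α : ℝ) (v : ℕ → L2), 0 ≤ α →
      IsChain (s + 3) v →
      ∑ j ∈ Finset.range (s + 1), β j * (inner ℂ (thetaMul c wt (linSeq c α v j)) (v j)).re ≤
        K * locForm c (v 0) - ∑ j ∈ Finset.range (s + 1), locForm c (v (j + 1)) := by
  have hsc := Real.sqrt_pos.2 hc
  have hone : ∀ j, ∃ (b K : ℝ), 0 < b ∧ 0 ≤ K ∧ ∀ (α : ℝ) (v : ℕ → L2), 0 ≤ α →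
      IsChain (j + 3) v → b * (inner ℂ (thetaMul c wt (linSeq c α v j)) (v j)).re ≤
        -locForm c (v (j + 1)) + K * ∑ i ∈ Finset.range (j + 1), locForm c (v i) := by
    intro j
    obtain ⟨K, hK, h⟩ := exists_re_inner_linSeq_le c wt j
    -- The inverse of the gain 3/2 · √c/4, which normalises the coefficient of the gain to 1.
    refine ⟨8 / (3 * Real.sqrt c), 8 / (3 * Real.sqrt c) * K, by positivity, by positivity,
      fun α v hα hv => ?_⟩
    have := h α v hv
    rw [polyD_wt, thetaForm_C_mul, thetaForm_C_mul] at this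
    have h2 := mul_le_mul_of_nonneg_left this (by positivity : 0 ≤ 8 / (3 * Real.sqrt c))
    refine h2.trans ?_
    have h3 : 0 ≤ α * locForm c (v j) := mul_nonneg hα (locForm_nonneg c _)
    have e : 8 / (3 * Real.sqrt c) * (-(3 / 2) * (Real.sqrt c / 4 * locForm c (v (j + 1))) -
        α / 2 * (Real.sqrt c / 4 * locForm c (v j)) +
        K * ∑ i ∈ Finset.range (j + 1), locForm c (v i)) = -locForm c (v (j + 1)) -
        1 / 3 * (α * locForm c (v j)) +
        8 / (3 * Real.sqrt c) * K * ∑ i ∈ Finset.range (j + 1), locForm c (v i) := by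
      field_simp
      ring
    simp only [locForm] at e h3 ⊢
    rw [e]
    linarith
  induction s with
  | zero =>
    obtain ⟨b, K, hb, hK, h⟩ := hone 0
    refine ⟨fun _ => b, K, fun _ => hb, hK, fun α v hα hv => ?_⟩
    have := h α v hα hv
    simp only [zero_add, Finset.sum_range_one] at this ⊢
    linarith
  | succ s ih =>
    obtain ⟨β, K, hβ, hK, h⟩ := ih
    obtain ⟨b, K', hb, hK', h'⟩ := hone (s + 1)
    -- With the old weights multiplied by K' + 1, K' copies of the old gain absorb the new error and
    -- one copy remains.
    refine ⟨fun j => if j < s + 1 then (K' + 1) * β j else b, (K' + 1) * K + K', fun j => ?_,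
      by positivity, fun α v hα hv => ?_⟩
    · dsimp only
      split_ifs
      · exact mul_pos (by positivity) (hβ j)
      · exact hb
    · have h1 := h α v hα (hv.mono (by omega))
      have h2 := h' α v hα hv
      rw [Finset.sum_range_succ, Finset.sum_range_succ (fun j => locForm c (v (j + 1)))]
      dsimp only
      rw [if_neg (lt_irrefl _)]
      have e : ∑ j ∈ Finset.range (s + 1), (if j < s + 1 then (K' + 1) * β j else b) *
          (inner ℂ (thetaMul c wt (linSeq c α v j)) (v j)).re =
          (K' + 1) * ∑ j ∈ Finset.range (s + 1),
            β j * (inner ℂ (thetaMul c wt (linSeq c α v j)) (v j)).re := by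
        rw [Finset.mul_sum]
        refine Finset.sum_congr rfl fun j hj => ?_
        rw [if_pos (Finset.mem_range.1 hj), mul_assoc]
      rw [e]
      rw [Finset.sum_range_succ'] at h2
      set S := ∑ j ∈ Finset.range (s + 1), locForm c (v (j + 1))
      have hS : 0 ≤ S := Finset.sum_nonneg fun j _ => locForm_nonneg c _
      have h3 := mul_le_mul_of_nonneg_left h1 (by positivity : 0 ≤ K' + 1)
      nlinarith

end ZKLine

/-! ### The operator on H^s: graph, quasi-dissipativity and range. -/

namespace ZKLine

open Polynomial (X C)
open scoped Polynomial ComplexConjugate FourierTransform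

/-! ### Sobolev spaces and chains -/

/-- The sequence of weak derivatives of `u ∈ H^s(ℝ)`, extended by zero. -/
def seq {s : ℕ} (u : Sobolev s) (j : ℕ) : L2 := if h : j ≤ s then wD u j h else 0

lemma seq_of_le {s : ℕ} (u : Sobolev s) {j : ℕ} (h : j ≤ s) : seq u j = wD u j h := dif_pos h

lemma isChain_seq {s : ℕ} (u : Sobolev s) : IsChain s (seq u) := fun j hj => by
  rw [seq_of_le u hj.le, seq_of_le u (Nat.succ_le_of_lt hj)]
  exact wD_succ u j hj

lemma seq_add {s : ℕ} (u v : Sobolev s) (j : ℕ) : seq (u + v) j = seq u j + seq v j := by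
  unfold seq
  split_ifs
  · exact wD_add u v j _
  · simp

lemma seq_smul {s : ℕ} (k : ℂ) (u : Sobolev s) (j : ℕ) : seq (k • u) j = k • seq u j := by
  unfold seq
  split_ifs
  · exact wD_smul k u j _
  · simp

/-- The element of `H^s(ℝ)` with a given sequence of weak derivatives. -/
def IsChain.toSobolev {s : ℕ} {v : ℕ → L2} (hv : IsChain s v) : Sobolev s :=
  ⟨WithLp.toLp 2 fun j => v j, fun j => by simpa using hv j j.2⟩

lemma IsChain.seq_toSobolev {s : ℕ} {v : ℕ → L2} (hv : IsChain s v) {j : ℕ} (hj : j ≤ s) :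
    seq hv.toSobolev j = v j := seq_of_le _ hj

lemma inner_sobolev {s : ℕ} (u v : Sobolev s) :
    inner ℂ u v = ∑ j ∈ Finset.range (s + 1), inner ℂ (seq u j) (seq v j) := by
  rw [Submodule.coe_inner, PiLp.inner_apply, Finset.sum_range]
  refine Finset.sum_congr rfl fun j _ => ?_
  rw [seq_of_le u (Nat.le_of_lt_succ j.2), seq_of_le v (Nat.le_of_lt_succ j.2)]
  rfl

lemma norm_sq_sobolev {s : ℕ} (u : Sobolev s) :
    ‖u‖ ^ 2 = ∑ j ∈ Finset.range (s + 1), ‖seq u j‖ ^ 2 := by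
  have h := congrArg Complex.re (inner_sobolev u u)
  have e : ∀ {E : Type} [NormedAddCommGroup E] [InnerProductSpace ℂ E] (x : E),
      (inner ℂ x x).re = ‖x‖ ^ 2 := fun x => inner_self_eq_norm_sq (𝕜 := ℂ) x
  simpa only [e, Complex.re_sum] using h

lemma norm_seq_le {s : ℕ} (u : Sobolev s) (j : ℕ) : ‖seq u j‖ ≤ ‖u‖ := by
  by_cases hj : j ≤ s
  · rw [← sq_le_sq₀ (norm_nonneg _) (norm_nonneg _), norm_sq_sobolev]
    exact Finset.single_le_sum (f := fun j => ‖seq u j‖ ^ 2) (fun i _ => by positivity)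
      (Finset.mem_range_succ_iff.2 hj)
  · simp [seq, hj]

/-- Differentiation and the embedding of L² are continuous into tempered distributions, so being a
weak derivative is a closed condition. -/
lemma isClosed_sobolev (s : ℕ) :
    IsClosed (Sobolev s : Set (PiLp 2 (fun _ : Fin (s + 1) => L2))) := by
  have : (Sobolev s : Set (PiLp 2 (fun _ : Fin (s + 1) => L2))) =
      ⋂ j : Fin s, {U | IsWeakDeriv (U j.castSucc) (U j.succ)} := by
    ext U; rw [Set.mem_iInter]; rfl
  rw [this]
  refine isClosed_iInter fun j => ?_
  have h1 := ((LineDeriv.lineDerivOpCLM ℂ 𝓢'(ℝ, ℂ) (1 : ℝ)).continuous.comp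
    (Lp.toTemperedDistributionCLM ℂ (volume : Measure ℝ) 2).continuous).comp
    (PiLp.continuous_apply 2 (fun _ : Fin (s + 1) => L2) j.castSucc)
  have h2 := (Lp.toTemperedDistributionCLM ℂ (volume : Measure ℝ) 2).continuous.comp
    (PiLp.continuous_apply 2 (fun _ : Fin (s + 1) => L2) j.succ)
  exact isClosed_eq h1 h2

instance (s : ℕ) : CompleteSpace (Sobolev s) := (isClosed_sobolev s).completeSpace_coe

/-! ### The graph of the linearized operator -/

/-- Rephrases the operator through all derivatives at once, so that energy estimates apply level by
level. By uniqueness of weak derivatives, the equation at level 0 implies those at the other levels.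
-/
lemma mem_linearizedGraph {c a : ℝ} {s : ℕ} {u f : Sobolev s} :
    (u, f) ∈ linearizedGraph c a s ↔ ∃ v : ℕ → L2, IsChain (s + 3) v ∧
      (∀ j ≤ s, v j = seq u j) ∧ ∀ j ≤ s, linSeq c (c + a) v j = seq f j := by
  have key : ∀ (v0 v2 w : L2),
      (∀ᵐ x, w x = -(v2 : ℝ → ℂ) x + ((c + a - 2 * Q c x : ℝ) : ℂ) * (v0 : ℝ → ℂ) x) ↔
      w = -v2 + ((c + a : ℝ) : ℂ) • v0 - (2 : ℂ) • thetaMul c (solitonPoly c) v0 := by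
    intro v0 v2 w
    have e : ∀ᵐ x, (-v2 + ((c + a : ℝ) : ℂ) • v0 -
        (2 : ℂ) • thetaMul c (solitonPoly c) v0 : L2) x =
        -(v2 : ℝ → ℂ) x + ((c + a - 2 * Q c x : ℝ) : ℂ) * (v0 : ℝ → ℂ) x := by
      filter_upwards [Lp.coeFn_sub (-v2 + ((c + a : ℝ) : ℂ) • v0)
        ((2 : ℂ) • thetaMul c (solitonPoly c) v0), Lp.coeFn_add (-v2) (((c + a : ℝ) : ℂ) • v0),
        Lp.coeFn_neg v2, Lp.coeFn_smul ((c + a : ℝ) : ℂ) v0,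
        Lp.coeFn_smul (2 : ℂ) (thetaMul c (solitonPoly c) v0),
        coeFn_thetaMul c (solitonPoly c) v0] with x h1 h2 h3 h4 h5 h6
      rw [h1, Pi.sub_apply, h2, Pi.add_apply, h3, h4, h5, Pi.neg_apply, Pi.smul_apply,
        Pi.smul_apply, h6, thetaPoly_solitonPoly]
      simp only [smul_eq_mul]
      push_cast
      ring
    constructor
    · intro h
      refine Lp.ext ?_
      filter_upwards [h, e] with x h1 h2
      rw [h1, h2]
    · rintro rfl
      exact e
  have hw : ∀ (n : ℕ) (v : ℕ → L2), IsChain (n + 3) v →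
      IsWeakDeriv (-(v 2) + ((c + a : ℝ) : ℂ) • (v 0) -
        (2 : ℂ) • thetaMul c (solitonPoly c) (v 0)) (linSeq c (c + a) v 0) := by
    intro n v hv
    have h3 := hv.leibnizSum c (solitonPoly c) 0 (by omega)
    rw [leibnizSum_zero] at h3
    exact ((hv 2 (by omega)).neg.add ((hv 0 (by omega)).smul _)).sub (h3.smul _)
  constructor
  · rintro ⟨v, hv, w, hww, hd⟩
    have hc := isChain_seq v
    rw [key] at hww
    have h0 := hw s (seq v) hc
    have e0 : seq v 0 = wD v 0 := seq_of_le v (by omega)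
    have e2 : seq v 2 = wD v 2 := seq_of_le v (by omega)
    rw [e0, e2] at h0
    rw [hww] at hd
    have e := h0.unique hd
    refine ⟨seq v, hc, ?_, ?_⟩
    · refine (hc.mono (by omega)).eq (isChain_seq u) ?_
      rw [e0, hv, seq_of_le u (Nat.zero_le s)]
    · refine (hc.linSeq c (c + a)).eq (isChain_seq f) ?_
      rw [e, seq_of_le f (Nat.zero_le s)]
  · rintro ⟨v, hc, hu, hf⟩
    refine ⟨hc.toSobolev, ?_, _, (key _ _ _).2 rfl, ?_⟩
    · have := hu 0 (Nat.zero_le s)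
      rw [seq_of_le u (Nat.zero_le s)] at this
      exact this
    · have := hw s v hc
      rw [hf 0 (Nat.zero_le s), seq_of_le f (Nat.zero_le s)] at this
      exact this

lemma linearized_apply_eq_iff {c a : ℝ} {s : ℕ} {u f : Sobolev s} :
    (∃ h : u ∈ (linearized c a s).domain, linearized c a s ⟨u, h⟩ = f) ↔
      ∃ v : ℕ → L2, IsChain (s + 3) v ∧
      (∀ j ≤ s, v j = seq u j) ∧ ∀ j ≤ s, linSeq c (c + a) v j = seq f j := by
  rw [← mem_linearizedGraph, ← linearized_graph, LinearPMap.mem_graph_iff]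
  constructor
  · rintro ⟨h, e⟩; exact ⟨⟨u, h⟩, rfl, e⟩
  · rintro ⟨⟨y, hy⟩, h1, h2⟩
    subst h1
    exact ⟨hy, h2⟩

lemma linearized_chain {c a : ℝ} {s : ℕ} (u : (linearized c a s).domain) :
    ∃ v : ℕ → L2, IsChain (s + 3) v ∧ (∀ j ≤ s, v j = seq (u : Sobolev s) j) ∧
      ∀ j ≤ s, linSeq c (c + a) v j = seq (linearized c a s u) j :=
  linearized_apply_eq_iff.1 ⟨u.2, rfl⟩

lemma polyD_one (c : ℝ) : polyD c 1 = 0 := by simp [polyD]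

/-- For the constant weight 1 the terms from ∂ₓ³ and α∂ₓ vanish, and only the soliton contributes.
This is why ω serves all a. -/
lemma linearized_dissipative (c : ℝ) (s : ℕ) :
    ∃ ω, 0 ≤ ω ∧ ∀ (a : ℝ) (u : (linearized c a s).domain),
      (inner ℂ (linearized c a s u) (u : Sobolev s)).re ≤ ω * ‖(u : Sobolev s)‖ ^ 2 := by
  choose K hK h using exists_re_inner_linSeq_le c 1
  refine ⟨∑ j ∈ Finset.range (s + 1), K j, Finset.sum_nonneg fun j _ => hK j, fun a u => ?_⟩
  obtain ⟨v, hv, hu, hf⟩ := linearized_chain u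
  rw [inner_sobolev, Complex.re_sum, Finset.sum_mul]
  refine Finset.sum_le_sum fun j hj => ?_
  have hj' := Finset.mem_range_succ_iff.1 hj
  rw [← hu j hj', ← hf j hj']
  have := h j (c + a) v (hv.mono (by omega))
  rw [thetaMul_one, polyD_one] at this
  simp only [thetaForm, thetaMul_zero, inner_zero_left, Complex.zero_re, mul_zero, sub_zero,
    zero_add] at this
  refine this.trans (mul_le_mul_of_nonneg_left ?_ (hK j))
  rw [norm_sq_sobolev]
  refine (Finset.sum_le_sum_of_subset_of_nonneg (Finset.range_mono (by omega : j + 1 ≤ s + 1))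
    fun i _ _ => locForm_nonneg c _).trans (Finset.sum_le_sum fun i hi => ?_)
  rw [← hu i (Finset.mem_range_succ_iff.1 hi)]
  exact locForm_le c _

/-! ### The range condition -/

/-- The symbol of `λ + ∂ₓ³ - α ∂ₓ`. -/
def freeSymbol (l α ξ : ℝ) : ℂ := l - Complex.I * ((2 * Real.pi * ξ) ^ 3 + α * (2 * Real.pi * ξ) : ℝ)

/-- The real part is κ³. For α ≥ 0 both summands of the imaginary part have the sign of ξ, so its
modulus is at least |2πξ|³. The claim follows from whichever of κ and |2πξ| is larger; the bound is
independent of α. -/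
lemma le_norm_freeSymbol {κ α : ℝ} (hκ : 0 < κ) (hα : 0 ≤ α) (ξ : ℝ) {j : ℕ} (hj : j ≤ 3) :
    κ ^ (3 - j) * |2 * Real.pi * ξ| ^ j ≤ ‖freeSymbol (κ ^ 3) α ξ‖ := by
  set k := 2 * Real.pi * ξ
  have hre : κ ^ 3 ≤ ‖freeSymbol (κ ^ 3) α ξ‖ := by
    have := Complex.abs_re_le_norm (freeSymbol (κ ^ 3) α ξ)
    have e : (freeSymbol (κ ^ 3) α ξ).re = κ ^ 3 := by
      simp only [freeSymbol, Complex.sub_re, Complex.ofReal_re, Complex.mul_re, Complex.I_re,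
        Complex.I_im, Complex.ofReal_im]
      ring
    rw [e] at this
    exact (le_abs_self _).trans this
  have him : |k| ^ 3 ≤ ‖freeSymbol (κ ^ 3) α ξ‖ := by
    have := Complex.abs_im_le_norm (freeSymbol (κ ^ 3) α ξ)
    have e : (freeSymbol (κ ^ 3) α ξ).im = -(k ^ 3 + α * k) := by
      simp only [freeSymbol, Complex.sub_im, Complex.ofReal_im, Complex.mul_im, Complex.I_re,
        Complex.I_im, Complex.ofReal_re]
      ring
    rw [e, abs_neg] at this
    refine le_trans ?_ this
    rcases le_total 0 k with hk | hk
    · rw [abs_of_nonneg hk, abs_of_nonneg (by positivity)]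
      nlinarith [mul_nonneg hα hk]
    · rw [abs_of_nonpos hk, abs_of_nonpos]
      · nlinarith [mul_nonneg hα (neg_nonneg.2 hk)]
      · have h1 : 0 ≤ (-k) ^ 3 := pow_nonneg (neg_nonneg.2 hk) 3
        nlinarith [mul_nonneg hα (neg_nonneg.2 hk)]
  rcases le_total |k| κ with h | h
  · refine le_trans ?_ hre
    calc κ ^ (3 - j) * |k| ^ j ≤ κ ^ (3 - j) * κ ^ j := by gcongr
      _ = κ ^ 3 := by rw [← pow_add]; congr 1; omega
  · refine le_trans ?_ him
    calc κ ^ (3 - j) * |k| ^ j ≤ |k| ^ (3 - j) * |k| ^ j := by gcongr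
      _ = |k| ^ 3 := by rw [← pow_add]; congr 1; omega

/-- The symbol of `∂ₓʲ (λ + ∂ₓ³ - α ∂ₓ)⁻¹`. -/
def resSymbol (l α : ℝ) (j : ℕ) (ξ : ℝ) : ℂ :=
  ((2 * Real.pi * ξ : ℝ) * Complex.I) ^ j / freeSymbol l α ξ

lemma norm_resSymbol_le {κ α : ℝ} (hκ : 0 < κ) (hα : 0 ≤ α) {j : ℕ} (hj : j ≤ 3) (ξ : ℝ) :
    ‖resSymbol (κ ^ 3) α j ξ‖ ≤ (κ ^ (3 - j))⁻¹ := by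
  have h := le_norm_freeSymbol hκ hα ξ hj
  have h0 : 0 < ‖freeSymbol (κ ^ 3) α ξ‖ :=
    lt_of_lt_of_le (by positivity) (le_norm_freeSymbol hκ hα ξ (Nat.zero_le 3))
  rw [resSymbol, norm_div, norm_pow, norm_mul, Complex.norm_I, mul_one, Complex.norm_real,
    Real.norm_eq_abs, div_le_iff₀ h0, inv_mul_eq_div, le_div_iff₀ (by positivity), mul_comm]
  exact h

lemma measurable_resSymbol (l α : ℝ) (j : ℕ) : Measurable (resSymbol l α j) := by
  unfold resSymbol freeSymbol
  fun_prop

/-- `∂ₓʲ (λ + ∂ₓ³ - α ∂ₓ)⁻¹` as a Fourier multiplier. -/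
def freeRes (l α : ℝ) (j : ℕ) : L2 →L[ℂ] L2 :=
  ((Lp.fourierTransformₗᵢ ℝ ℂ).symm : L2 →L[ℂ] L2) ∘L mulOp (resSymbol l α j) ∘L
    ((Lp.fourierTransformₗᵢ ℝ ℂ) : L2 →L[ℂ] L2)

lemma fourier_freeRes (l α : ℝ) (j : ℕ) (g : L2) :
    (𝓕 (freeRes l α j g) : L2) = mulOp (resSymbol l α j) (𝓕 g : L2) :=
  (Lp.fourierTransformₗᵢ ℝ ℂ).apply_symm_apply _

lemma norm_freeRes_le {κ α : ℝ} (hκ : 0 < κ) (hα : 0 ≤ α) {j : ℕ} (hj : j ≤ 3) (g : L2) :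
    ‖freeRes (κ ^ 3) α j g‖ ≤ (κ ^ (3 - j))⁻¹ * ‖g‖ := by
  rw [← Lp.norm_fourier_eq, fourier_freeRes, ← Lp.norm_fourier_eq g]
  exact norm_mulOp_le (measurable_resSymbol _ _ _) (norm_resSymbol_le hκ hα hj) _

lemma isChain_freeRes {κ α : ℝ} (hκ : 0 < κ) (hα : 0 ≤ α) (g : L2) :
    IsChain 3 (fun j => freeRes (κ ^ 3) α j g) := by
  intro j hj
  rw [isWeakDeriv_iff_fourier, fourier_freeRes, fourier_freeRes]
  filter_upwards [coeFn_mulOp ⟨measurable_resSymbol (κ ^ 3) α j, _,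
    norm_resSymbol_le hκ hα hj.le⟩ (𝓕 g : L2), coeFn_mulOp ⟨measurable_resSymbol (κ ^ 3) α (j + 1),
    _, norm_resSymbol_le hκ hα hj⟩ (𝓕 g : L2)] with ξ h1 h2
  rw [h1, h2, resSymbol, resSymbol]
  ring

lemma freeRes_eq {κ α : ℝ} (hκ : 0 < κ) (hα : 0 ≤ α) (g : L2) :
    ((κ ^ 3 : ℝ) : ℂ) • freeRes (κ ^ 3) α 0 g + freeRes (κ ^ 3) α 3 g -
      (α : ℂ) • freeRes (κ ^ 3) α 1 g = g := by
  have hb : ∀ j ≤ 3, BddMeas (resSymbol (κ ^ 3) α j) := fun j hj =>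
    ⟨measurable_resSymbol (κ ^ 3) α j, _, norm_resSymbol_le hκ hα hj⟩
  apply (Lp.fourierTransformₗᵢ ℝ ℂ).injective
  rw [map_sub, map_add, map_smul, map_smul]
  change ((κ ^ 3 : ℝ) : ℂ) • (𝓕 (freeRes (κ ^ 3) α 0 g) : L2) + (𝓕 (freeRes (κ ^ 3) α 3 g) : L2) -
      (α : ℂ) • (𝓕 (freeRes (κ ^ 3) α 1 g) : L2) = (𝓕 g : L2)
  rw [fourier_freeRes, fourier_freeRes, fourier_freeRes]
  set G : L2 := 𝓕 g
  refine Lp.ext ?_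
  filter_upwards [coeFn_mulOp (hb 0 (by norm_num)) G, coeFn_mulOp (hb 1 (by norm_num)) G,
    coeFn_mulOp (hb 3 (by norm_num)) G,
    Lp.coeFn_sub (((κ ^ 3 : ℝ) : ℂ) • mulOp (resSymbol (κ ^ 3) α 0) G +
      mulOp (resSymbol (κ ^ 3) α 3) G) ((α : ℂ) • mulOp (resSymbol (κ ^ 3) α 1) G),
    Lp.coeFn_add (((κ ^ 3 : ℝ) : ℂ) • mulOp (resSymbol (κ ^ 3) α 0) G)
      (mulOp (resSymbol (κ ^ 3) α 3) G),
    Lp.coeFn_smul (((κ ^ 3 : ℝ) : ℂ)) (mulOp (resSymbol (κ ^ 3) α 0) G),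
    Lp.coeFn_smul (α : ℂ) (mulOp (resSymbol (κ ^ 3) α 1) G)] with ξ h0 h1 h3 e1 e2 e3 e4
  have hne : freeSymbol (κ ^ 3) α ξ ≠ 0 := by
    rw [← norm_pos_iff]
    exact lt_of_lt_of_le (by positivity) (le_norm_freeSymbol hκ hα ξ (Nat.zero_le 3))
  rw [e1, Pi.sub_apply, e2, Pi.add_apply, e3, e4, Pi.smul_apply, Pi.smul_apply, h0, h1, h3]
  simp only [resSymbol, smul_eq_mul]
  field_simp
  have hI := Complex.I_sq
  simp only [freeSymbol]
  push_cast
  linear_combination (G ξ * ((2 * Real.pi * ξ) ^ 3 * Complex.I : ℂ)) * hI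

/-- On functions R₀g, with R₀ the free resolvent, the equation becomes g + 2∂ₓ(Q_c R₀g) = f. The
perturbation has norm O(1/κ) for l = κ³, uniformly in α, so a Neumann series solves it. -/
lemma exists_solution (c : ℝ) :
    ∃ l₀ : ℝ, 0 < l₀ ∧ ∀ l ≥ l₀, ∀ α : ℝ, 0 ≤ α → ∀ f : L2,
      ∃ v : ℕ → L2, IsChain 3 v ∧ (l : ℂ) • v 0 - linSeq c α v 0 = f := by
  set q := solitonPoly c
  set N := ‖thetaMul c (polyD c q)‖ + ‖thetaMul c q‖
  have hN : 0 ≤ N := by positivity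
  -- The threshold gives κ ≥ 2N + 2, hence 2N/κ < 1; also κ ≥ 1, so κ⁻³ and κ⁻² are both at most
  -- κ⁻¹.
  refine ⟨(2 * N + 2) ^ 3, by positivity, fun l hl α hα f => ?_⟩
  obtain ⟨κ, hκ, rfl⟩ : ∃ κ : ℝ, 2 * N + 2 ≤ κ ∧ κ ^ 3 = l := by
    have hl0 : (0 : ℝ) ≤ l := le_trans (by positivity) hl
    refine ⟨l ^ ((1 : ℝ) / 3), ?_, ?_⟩
    · have := Real.rpow_le_rpow (by positivity) hl (by norm_num : (0 : ℝ) ≤ 1 / 3)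
      rwa [← Real.rpow_natCast, ← Real.rpow_mul (by positivity), show ((3 : ℕ) : ℝ) * (1 / 3) = 1 by
        norm_num, Real.rpow_one] at this
    · rw [← Real.rpow_natCast, ← Real.rpow_mul hl0]
      norm_num
  have hκ0 : 0 < κ := by linarith
  set B : L2 →L[ℂ] L2 := (2 : ℂ) • (thetaMul c (polyD c q) ∘L freeRes (κ ^ 3) α 0 +
    thetaMul c q ∘L freeRes (κ ^ 3) α 1)
  have hB : ‖-B‖ < 1 := by
    rw [norm_neg]
    have hB' : ‖B‖ ≤ 2 * N / κ := by
      refine ContinuousLinearMap.opNorm_le_bound _ (by positivity) fun g => ?_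
      have h0 := norm_freeRes_le hκ0 hα (by norm_num : 0 ≤ 3) g
      have h1 := norm_freeRes_le hκ0 hα (by norm_num : 1 ≤ 3) g
      have hk : ∀ n : ℕ, (κ ^ (n + 1))⁻¹ ≤ κ⁻¹ := fun n => by
        refine inv_anti₀ hκ0 ?_
        rw [pow_succ]
        exact le_mul_of_one_le_left hκ0.le (one_le_pow₀ (by linarith))
      have h0' : ‖freeRes (κ ^ 3) α 0 g‖ ≤ κ⁻¹ * ‖g‖ :=
        h0.trans (mul_le_mul_of_nonneg_right (hk 2) (norm_nonneg _))
      have h1' : ‖freeRes (κ ^ 3) α 1 g‖ ≤ κ⁻¹ * ‖g‖ :=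
        h1.trans (mul_le_mul_of_nonneg_right (hk 1) (norm_nonneg _))
      calc ‖B g‖ = 2 * ‖thetaMul c (polyD c q) (freeRes (κ ^ 3) α 0 g) +
            thetaMul c q (freeRes (κ ^ 3) α 1 g)‖ := by
            change ‖(2 : ℂ) • (_ + _ : L2)‖ = _
            rw [norm_smul, Complex.norm_ofNat]
            rfl
        _ ≤ 2 * (‖thetaMul c (polyD c q)‖ * (κ⁻¹ * ‖g‖) + ‖thetaMul c q‖ * (κ⁻¹ * ‖g‖)) := by
            gcongr
            refine (norm_add_le _ _).trans (add_le_add ?_ ?_)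
            · exact (ContinuousLinearMap.le_opNorm _ _).trans (by gcongr)
            · exact (ContinuousLinearMap.le_opNorm _ _).trans (by gcongr)
        _ = 2 * N / κ * ‖g‖ := by ring
    refine hB'.trans_lt ?_
    rw [div_lt_one hκ0]
    linarith
  obtain ⟨S, hS⟩ := isUnit_one_sub_of_norm_lt_one hB
  set g : L2 := (↑S⁻¹ : L2 →L[ℂ] L2) f
  have hg : g + B g = f := by
    have := congrArg (fun T : L2 →L[ℂ] L2 => T f) S.mul_inv
    simp only [hS] at this
    simpa using this
  refine ⟨fun j => freeRes (κ ^ 3) α j g, isChain_freeRes hκ0 hα g, ?_⟩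
  have e := freeRes_eq hκ0 hα g
  rw [linSeq, zero_add, leibnizSum_one]
  have hBg : B g = (2 : ℂ) • (thetaMul c (polyD c q) (freeRes (κ ^ 3) α 0 g) +
    thetaMul c q (freeRes (κ ^ 3) α 1 g)) := rfl
  rw [← hg, hBg]
  calc _ = (((κ ^ 3 : ℝ) : ℂ) • freeRes (κ ^ 3) α 0 g + freeRes (κ ^ 3) α 3 g -
        (α : ℂ) • freeRes (κ ^ 3) α 1 g) + (2 : ℂ) • (thetaMul c (polyD c q)
          (freeRes (κ ^ 3) α 0 g) + thetaMul c q (freeRes (κ ^ 3) α 1 g)) := by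
        simp only [zero_add]
        abel
    _ = _ := by rw [e]

/-- Bootstrap: the equation expresses the derivative of order s + 3 through derivatives of order at
most s + 1 and the derivative of order s of f. Each further derivative of f therefore gives one of
the solution. -/
lemma exists_chain_of_solution (c l α : ℝ) {u f : ℕ → L2} (hu : IsChain 3 u)
    (he : (l : ℂ) • u 0 - linSeq c α u 0 = f 0) :
    ∀ s, IsChain s f → ∃ v, IsChain (s + 3) v ∧ v 0 = u 0 := by
  intro s
  induction s with
  | zero => exact fun _ => ⟨u, hu, rfl⟩
  | succ s ih =>
    intro hf
    obtain ⟨v, hv, h0⟩ := ih (hf.mono (Nat.le_succ s))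
    have hv3 := (hv.mono (by omega : 3 ≤ s + 3)).eq hu h0
    have hlin : linSeq c α v 0 = linSeq c α u 0 := by
      simp only [linSeq, leibnizSum_one, zero_add, hv3 3 le_rfl, hv3 1 (by norm_num), h0]
    have hs : linSeq c α v s = (l : ℂ) • v s - f s := by
      refine (hv.linSeq c α).eq (w := fun j => (l : ℂ) • v j - f j) (fun j hj =>
        ((hv j (by omega)).smul _).sub (hf j (by omega))) ?_ s le_rfl
      rw [hlin, h0, ← he]; abel
    have e : v (s + 3) = (α : ℂ) • v (s + 1) -
        (2 : ℂ) • leibnizSum c (solitonPoly c) v (s + 1) - ((l : ℂ) • v s - f s) := by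
      rw [← hs, linSeq]; abel
    have hd := (((hv (s + 1) (by omega)).smul (α : ℂ)).sub
      ((hv.leibnizSum c (solitonPoly c) (s + 1) (by omega)).smul 2)).sub
      (((hv s (by omega)).smul (l : ℂ)).sub (hf s (by omega)))
    rw [← e] at hd
    -- The chain is extended at the single new index s + 4, by the right side of the differentiated
    -- equation.
    refine ⟨Function.update v (s + 4) ((α : ℂ) • v (s + 1 + 1) -
      (2 : ℂ) • leibnizSum c (solitonPoly c) v (s + 1 + 1) - ((l : ℂ) • v (s + 1) - f (s + 1))),
      fun j hj => ?_, by simp [h0]⟩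
    · by_cases h : j = s + 3
      · subst h
        rw [Function.update_self, Function.update_of_ne (by omega)]
        exact hd
      · rw [Function.update_of_ne (by omega), Function.update_of_ne (by omega)]
        exact hv j (by omega)

lemma linearized_surjective (c : ℝ) (hc : 0 < c) (s : ℕ) :
    ∃ l₀ : ℝ, 0 < l₀ ∧ ∀ l ≥ l₀, ∀ a : ℝ, 0 ≤ a → ∀ f : Sobolev s,
      ∃ u : (linearized c a s).domain, (l : ℂ) • (u : Sobolev s) - linearized c a s u = f := by
  obtain ⟨l₀, hl₀, h⟩ := exists_solution c
  refine ⟨l₀, hl₀, fun l hl a ha f => ?_⟩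
  obtain ⟨w, hw, hwe⟩ := h l hl (c + a) (by linarith) (seq f 0)
  obtain ⟨v, hv, hv0⟩ := exists_chain_of_solution c l (c + a) hw hwe s (isChain_seq f)
  have hv3 := (hv.mono (by omega : 3 ≤ s + 3)).eq hw hv0
  have hlin : linSeq c (c + a) v 0 = linSeq c (c + a) w 0 := by
    simp only [linSeq, leibnizSum_one, zero_add, hv3 3 le_rfl, hv3 1 (by norm_num), hv0]
  set u : Sobolev s := (hv.mono (by omega : s ≤ s + 3)).toSobolev
  have hu : ∀ j ≤ s, v j = seq u j := fun j hj => (IsChain.seq_toSobolev _ hj).symm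
  have hls := hv.linSeq c (c + a)
  obtain ⟨hd, he⟩ := linearized_apply_eq_iff.2 ⟨v, hv, hu,
    fun j hj => (hls.seq_toSobolev hj).symm⟩
  refine ⟨⟨u, hd⟩, ?_⟩
  rw [he]
  have h0 : ∀ z : Sobolev s, wD z 0 (Nat.zero_le s) = seq z 0 := fun z =>
    (seq_of_le z (Nat.zero_le s)).symm
  apply ext_wD
  rw [h0, h0, ← hwe, ← hlin, sub_eq_add_neg, ← neg_one_smul ℂ hls.toSobolev, seq_add, seq_smul,
    seq_smul, hls.seq_toSobolev (Nat.zero_le s), ← hu 0 (Nat.zero_le s), hv0]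
  simp [sub_eq_add_neg]

end ZKLine

/-! ### Dissipative operators, resolvents and strongly continuous semigroups. -/

namespace ZKLine

/-! ### Differential inequalities -/

/-- Only right derivatives are assumed, since that is what a generator provides. The function
e^{-Kt} f(t) has nonpositive right derivative. -/
lemma gronwall_right {f f' : ℝ → ℝ} {K : ℝ} (hc : ContinuousOn f (Set.Ici 0))
    (hd : ∀ t, 0 ≤ t → HasDerivWithinAt f (f' t) (Set.Ici t) t)
    (h : ∀ t, 0 ≤ t → f' t ≤ K * f t) {t : ℝ} (ht : 0 ≤ t) : f t ≤ f 0 * Real.exp (K * t) := by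
  have hE : ∀ r : ℝ, HasDerivAt (fun r => Real.exp (-(K * r))) (-K * Real.exp (-(K * r))) r := by
    intro r
    have := ((hasDerivAt_id r).const_mul K).neg.exp
    simpa [mul_comm] using this
  have key := image_le_of_deriv_right_le_deriv_boundary
    (f := fun r => Real.exp (-(K * r)) * f r)
    (f' := fun r => -K * Real.exp (-(K * r)) * f r + Real.exp (-(K * r)) * f' r) (a := 0) (b := t)
    (B := fun _ => f 0) (B' := fun _ => 0)
    ((Continuous.continuousOn (by fun_prop)).mul (hc.mono Set.Icc_subset_Ici_self))
    (fun r hr => (hE r).hasDerivWithinAt.mul (hd r hr.1)) (by simp) continuousOn_const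
    (fun r _ => hasDerivWithinAt_const _ _ _)
    (fun r hr => by
      have := mul_le_mul_of_nonneg_left (h r hr.1) (Real.exp_pos (-(K * r))).le
      linarith) (Set.right_mem_Icc.2 ht)
  rw [Real.exp_neg, inv_mul_le_iff₀ (Real.exp_pos _)] at key
  linarith

section Abstract

variable {X : Type*} [NormedAddCommGroup X] [InnerProductSpace ℂ X]

lemma hasDerivWithinAt_form (P : X →L[ℂ] X) {y : ℝ → X} {y' : X} {s : Set ℝ} {t : ℝ}
    (hy : HasDerivWithinAt y y' s t) :
    HasDerivWithinAt (fun r => (inner ℂ (P (y r)) (y r)).re)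
      ((inner ℂ (P (y t)) y').re + (inner ℂ (P y') (y t)).re) s t := by
  have h1 : HasDerivWithinAt (fun r => P (y r)) (P y') s t :=
    ((P.restrictScalars ℝ).hasFDerivAt.comp_hasDerivWithinAt t hy)
  exact Complex.reCLM.hasFDerivAt.comp_hasDerivWithinAt t (h1.inner ℂ hy)

lemma hasDerivWithinAt_norm_sq' {y : ℝ → X} {y' : X} {s : Set ℝ} {t : ℝ}
    (hy : HasDerivWithinAt y y' s t) :
    HasDerivWithinAt (fun r => ‖y r‖ ^ 2) (2 * (inner ℂ y' (y t)).re) s t := by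
  have h := hasDerivWithinAt_form (ContinuousLinearMap.id ℂ X) hy
  simp only [ContinuousLinearMap.id_apply] at h
  have e : ∀ x : X, (inner ℂ x x).re = ‖x‖ ^ 2 := fun x => inner_self_eq_norm_sq (𝕜 := ℂ) x
  have e2 : (inner ℂ (y t) y').re = (inner ℂ y' (y t)).re := by
    rw [← inner_conj_symm, Complex.conj_re]
  simp only [e, e2] at h
  rwa [two_mul]

lemma norm_le_exp_of_dissipative {y y' : ℝ → X} {w : ℝ} (hc : ContinuousOn y (Set.Ici 0))
    (hd : ∀ t, 0 ≤ t → HasDerivWithinAt y (y' t) (Set.Ici t) t)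
    (h : ∀ t, 0 ≤ t → (inner ℂ (y' t) (y t)).re ≤ w * ‖y t‖ ^ 2) {t : ℝ} (ht : 0 ≤ t) :
    ‖y t‖ ≤ Real.exp (w * t) * ‖y 0‖ := by
  have := gronwall_right (f := fun r => ‖y r‖ ^ 2) (K := 2 * w) (hc.norm.pow 2)
    (fun r hr => hasDerivWithinAt_norm_sq' (hd r hr))
    (fun r hr => by have := h r hr; linarith) ht
  rw [← sq_le_sq₀ (norm_nonneg _) (by positivity), mul_pow, ← Real.exp_nat_mul]
  refine this.trans (le_of_eq ?_)
  rw [mul_comm]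
  congr 2
  push_cast
  ring

/-! ### Resolvents -/

/-- `R` is the inverse of `z - A`. -/
def IsRes (A : X →ₗ.[ℂ] X) (z : ℂ) (R : X →L[ℂ] X) : Prop :=
  (∀ f : X, ∃ h : R f ∈ A.domain, z • R f - A ⟨R f, h⟩ = f) ∧
    (∀ u : A.domain, R (z • (u : X) - A u) = u)

/-- The a priori bound gives injectivity, so the chosen preimages depend linearly on f; it also
bounds the resulting inverse. -/
lemma exists_isRes {A : X →ₗ.[ℂ] X} {z : ℂ} {M : ℝ}
    (hs : ∀ f, ∃ u : A.domain, z • (u : X) - A u = f)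
    (hb : ∀ u : A.domain, ‖(u : X)‖ ≤ M * ‖z • (u : X) - A u‖) :
    ∃ R, IsRes A z R ∧ ∀ f, ‖R f‖ ≤ M * ‖f‖ := by
  have hinj : ∀ u v : A.domain, z • (u : X) - A u = z • (v : X) - A v → u = v := by
    intro u v h
    have := hb (u - v)
    have e : z • ((u - v : A.domain) : X) - A (u - v) = 0 := by
      rw [Submodule.coe_sub, smul_sub, LinearPMap.map_sub, sub_sub_sub_comm, h, sub_self]
    rw [e, norm_zero, mul_zero] at this
    exact sub_eq_zero.1 (Subtype.ext (norm_le_zero_iff.1 this))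
  choose S hS using hs
  let L : X →ₗ[ℂ] X :=
    { toFun := fun f => (S f : X)
      map_add' := fun f g => by
        rw [← Submodule.coe_add]
        congr 1
        apply hinj
        rw [hS, Submodule.coe_add, smul_add, LinearPMap.map_add, add_sub_add_comm, hS, hS]
      map_smul' := fun k f => by
        rw [RingHom.id_apply, ← Submodule.coe_smul]
        congr 1
        apply hinj
        rw [hS, Submodule.coe_smul, smul_comm, LinearPMap.map_smul, ← smul_sub, hS] }
  have hL : ∀ f, ‖L f‖ ≤ M * ‖f‖ := fun f => by
    have := hb (S f)
    rwa [hS] at this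
  refine ⟨L.mkContinuous M hL, ⟨fun f => ⟨(S f).2, hS f⟩, fun u => ?_⟩, hL⟩
  exact congrArg Subtype.val (hinj _ _ (hS (z • (u : X) - A u)))

lemma norm_le_of_dissipative {A : X →ₗ.[ℂ] X} {w : ℝ}
    (hA : ∀ u : A.domain, (inner ℂ (A u) (u : X)).re ≤ w * ‖(u : X)‖ ^ 2) (l : ℝ)
    (u : A.domain) : (l - w) * ‖(u : X)‖ ≤ ‖(l : ℂ) • (u : X) - A u‖ := by
  have h1 : (l - w) * ‖(u : X)‖ ^ 2 ≤ (inner ℂ ((l : ℂ) • (u : X) - A u) (u : X)).re := by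
    rw [inner_sub_left, inner_smul_left, Complex.sub_re, Complex.conj_ofReal,
      Complex.re_ofReal_mul]
    have e : (inner ℂ (u : X) (u : X)).re = ‖(u : X)‖ ^ 2 := inner_self_eq_norm_sq (𝕜 := ℂ) _
    rw [e]
    have := hA u
    linarith
  have h2 : (inner ℂ ((l : ℂ) • (u : X) - A u) (u : X)).re ≤
      ‖(l : ℂ) • (u : X) - A u‖ * ‖(u : X)‖ :=
    (Complex.re_le_norm _).trans (norm_inner_le_norm _ _)
  rcases (norm_nonneg (u : X)).eq_or_lt with h0 | h0
  · rw [← h0, mul_zero]; exact norm_nonneg _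
  · refine le_of_mul_le_mul_right ?_ h0
    calc (l - w) * ‖(u : X)‖ * ‖(u : X)‖ = (l - w) * ‖(u : X)‖ ^ 2 := by ring
      _ ≤ _ := h1.trans h2

variable [CompleteSpace X]

/-- A vector orthogonal to the domain has the form (l - A)u. Pairing it with u gives (l - w)‖u‖² ≤
0, hence u = 0. -/
lemma dense_domain_of_dissipative {A : X →ₗ.[ℂ] X} {w l : ℝ}
    (hA : ∀ u : A.domain, (inner ℂ (A u) (u : X)).re ≤ w * ‖(u : X)‖ ^ 2) (hl : w < l)
    (hs : ∀ f, ∃ u : A.domain, (l : ℂ) • (u : X) - A u = f) : Dense (A.domain : Set X) := by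
  rw [Submodule.dense_iff_topologicalClosure_eq_top, Submodule.topologicalClosure_eq_top_iff,
    Submodule.eq_bot_iff]
  intro g hg
  obtain ⟨u, rfl⟩ := hs g
  have h0 := (Submodule.mem_orthogonal _ _).1 hg u u.2
  have h1 : (l - w) * ‖(u : X)‖ ^ 2 ≤ 0 := by
    have h2 := congrArg Complex.re h0
    rw [inner_sub_right, inner_smul_right, Complex.sub_re, Complex.re_ofReal_mul,
      ← inner_conj_symm (u : X) (A u), Complex.conj_re] at h2
    have e : (inner ℂ (u : X) (u : X)).re = ‖(u : X)‖ ^ 2 := inner_self_eq_norm_sq (𝕜 := ℂ) _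
    rw [e, Complex.zero_re] at h2
    have := hA u
    linarith
  have h3 : ‖(u : X)‖ = 0 := by
    have : 0 < l - w := by linarith
    nlinarith [sq_nonneg ‖(u : X)‖, norm_nonneg (u : X), mul_nonneg this.le (sq_nonneg ‖(u : X)‖),
      pow_eq_zero_iff (two_ne_zero) |>.1 (le_antisymm
        (nonpos_of_mul_nonpos_right h1 this) (sq_nonneg ‖(u : X)‖))]
  have h4 : u = 0 := Subtype.ext (norm_eq_zero.1 h3)
  subst h4
  simp

/-! ### Strongly continuous semigroups -/

namespace C0Semigroup

/-- Otherwise the norms are unbounded along some tₙ → 0, against the uniform boundedness principle,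
since T(tₙ)x converges for every x. -/
lemma exists_bound_near_zero (T : C0Semigroup X) :
    ∃ δ : ℝ≥0, 0 < δ ∧ ∃ N : ℝ, 1 ≤ N ∧ ∀ t ≤ δ, ‖T.toFun t‖ ≤ N := by
  by_contra! hcon
  have h1 : ∀ n : ℕ, ∃ t : ℝ≥0, t ≤ 1 / ((n : ℝ≥0) + 1) ∧ (n : ℝ) + 1 < ‖T.toFun t‖ := fun n =>
    hcon (1 / ((n : ℝ≥0) + 1)) (by positivity) ((n : ℝ) + 1) (by linarith [n.cast_nonneg (α := ℝ)])
  choose t ht hn using h1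
  have ht0 : Tendsto t atTop (𝓝 0) :=
    tendsto_of_tendsto_of_tendsto_of_le_of_le tendsto_const_nhds
      (tendsto_one_div_add_atTop_nhds_zero_nat (𝕜 := ℝ≥0)) (fun _ => zero_le) ht
  obtain ⟨C, hC⟩ := banach_steinhaus (g := fun n => T.toFun (t n)) (fun x => by
    have := ((T.tendsto_zero x).comp ht0).norm
    obtain ⟨C, hC⟩ := this.bddAbove_range
    exact ⟨C, fun i => hC ⟨i, rfl⟩⟩)
  obtain ⟨n, hn'⟩ := exists_nat_gt C
  linarith [hC n, hn n]

lemma exists_bound_le (T : C0Semigroup X) (b : ℝ≥0) : ∃ N : ℝ, 1 ≤ N ∧ ∀ t ≤ b, ‖T.toFun t‖ ≤ N := by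
  obtain ⟨δ, hδ, N, hN, h⟩ := T.exists_bound_near_zero
  have key : ∀ n : ℕ, ∀ t ≤ n * δ, ‖T.toFun t‖ ≤ N ^ n := by
    intro n
    induction n with
    | zero =>
      intro t ht
      have : t = 0 := by simpa using ht
      rw [this, T.map_zero, pow_zero]
      exact ContinuousLinearMap.norm_id_le
    | succ n ih =>
      intro t ht
      have e : t = (t - δ) + min t δ := by
        rcases le_total t δ with h' | h'
        · rw [tsub_eq_zero_of_le h', min_eq_left h', zero_add]
        · rw [min_eq_right h', tsub_add_cancel_of_le h']
      rw [e, T.map_add, pow_succ]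
      refine (ContinuousLinearMap.opNorm_comp_le _ _).trans (mul_le_mul (ih _ ?_)
        (h _ (min_le_right _ _)) (norm_nonneg _) (by positivity))
      rw [tsub_le_iff_right]
      refine ht.trans (le_of_eq ?_)
      push_cast
      ring
  obtain ⟨n, hn⟩ := exists_nat_ge (b / δ)
  refine ⟨N ^ n, one_le_pow₀ hN, fun t ht => key n t (ht.trans ?_)⟩
  rwa [div_le_iff₀ hδ] at hn

lemma norm_sub_le (T : C0Semigroup X) {b : ℝ≥0} {N : ℝ} (hN : ∀ t ≤ b, ‖T.toFun t‖ ≤ N)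
    {t r : ℝ≥0} (ht : t ≤ b) (hr : r ≤ b) (x : X) :
    ‖T.toFun t x - T.toFun r x‖ ≤ N * ‖T.toFun (nndist t r) x - x‖ := by
  wlog h : r ≤ t generalizing t r
  · rw [norm_sub_rev, nndist_comm]
    exact this hr ht (le_of_not_ge h)
  · have e : t = r + nndist t r := by
      apply NNReal.coe_injective
      rw [NNReal.coe_add, coe_nndist, NNReal.dist_eq, abs_of_nonneg (by simpa using h)]
      ring
    have e2 : T.toFun t x = T.toFun r (T.toFun (nndist t r) x) := by
      conv_lhs => rw [e, T.map_add]
      rfl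
    rw [e2, ← map_sub]
    exact (ContinuousLinearMap.le_opNorm _ _).trans
      (mul_le_mul_of_nonneg_right (hN r hr) (norm_nonneg _))

lemma continuous_apply (T : C0Semigroup X) (x : X) : Continuous (fun t => T.toFun t x) := by
  rw [continuous_iff_continuousAt]
  intro t₀
  obtain ⟨N, -, hN⟩ := T.exists_bound_le (t₀ + 1)
  rw [ContinuousAt, tendsto_iff_norm_sub_tendsto_zero]
  have h1 : Tendsto (fun t : ℝ≥0 => N * ‖T.toFun (nndist t t₀) x - x‖) (𝓝 t₀) (𝓝 0) := by
    have h2 : Tendsto (fun t : ℝ≥0 => nndist t t₀) (𝓝 t₀) (𝓝 0) := by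
      have : Continuous (fun t : ℝ≥0 => nndist t t₀) := by fun_prop
      simpa using this.tendsto t₀
    have h3 := (((T.tendsto_zero x).comp h2).sub_const x).norm.const_mul N
    simpa using h3
  refine squeeze_zero' (Eventually.of_forall fun _ => norm_nonneg _) ?_ h1
  have : ∀ᶠ t in 𝓝 t₀, t ≤ t₀ + 1 :=
    (eventually_lt_nhds (lt_add_one t₀)).mono fun _ h => h.le
  filter_upwards [this] with t ht
  exact T.norm_sub_le hN ht le_self_add x

/-- The orbit as a function of real time. -/
def orbit (T : C0Semigroup X) (x : X) (t : ℝ) : X := T.toFun t.toNNReal x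

lemma continuous_orbit (T : C0Semigroup X) (x : X) : Continuous (T.orbit x) :=
  (T.continuous_apply x).comp continuous_real_toNNReal

lemma orbit_zero (T : C0Semigroup X) (x : X) : T.orbit x 0 = x := by
  simp [orbit, T.map_zero]

lemma orbit_add (T : C0Semigroup X) (x : X) {t r : ℝ} (ht : 0 ≤ t) (hr : 0 ≤ r) :
    T.orbit x (t + r) = T.orbit (T.orbit x r) t := by
  rw [orbit, Real.toNNReal_add ht hr, T.map_add]; rfl

lemma orbit_coe (T : C0Semigroup X) (x : X) (t : ℝ≥0) : T.orbit x t = T.toFun t x := by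
  simp [orbit]

variable {A : X →ₗ.[ℂ] X}

lemma HasGenerator.domain_orbit {T : C0Semigroup X} (hT : T.HasGenerator A) (x : A.domain) (t : ℝ) :
    ∃ h : T.orbit x t ∈ A.domain, A ⟨T.orbit x t, h⟩ = T.orbit (A x) t := by
  rw [hT]
  have h := (hT x (A x)).1 ⟨x.2, rfl⟩
  have h2 := ((T.toFun t.toNNReal).continuous.tendsto (A x)).comp h
  refine h2.congr fun r => ?_
  simp only [Function.comp_apply, map_smul, map_sub, orbit]
  congr 2
  rw [← ContinuousLinearMap.comp_apply, ← ContinuousLinearMap.comp_apply, ← T.map_add,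
    ← T.map_add, add_comm]

lemma HasGenerator.hasDerivWithinAt {T : C0Semigroup X} (hT : T.HasGenerator A) (x : A.domain)
    {t : ℝ} (ht : 0 ≤ t) : HasDerivWithinAt (T.orbit x) (T.orbit (A x) t) (Set.Ici t) t := by
  have h := (hT _ _).1 (hT.domain_orbit x t)
  rw [← hasDerivWithinAt_Ioi_iff_Ici, hasDerivWithinAt_iff_tendsto_slope' Set.self_notMem_Ioi]
  have h1 : Tendsto (fun r : ℝ => (r - t).toNNReal) (𝓝[>] t) (𝓝[>] 0) := by
    refine tendsto_nhdsWithin_iff.2 ⟨?_, ?_⟩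
    · have : Continuous (fun r : ℝ => (r - t).toNNReal) := by fun_prop
      have := this.tendsto t
      simp only [sub_self, Real.toNNReal_zero] at this
      exact this.mono_left nhdsWithin_le_nhds
    · filter_upwards [self_mem_nhdsWithin] with r hr
      simpa using hr
  refine (h.comp h1).congr' ?_
  filter_upwards [self_mem_nhdsWithin] with r hr
  have hr' : 0 < r - t := sub_pos.2 hr
  simp only [Function.comp_apply]
  rw [slope_def_module, Real.coe_toNNReal _ hr'.le, ← Complex.ofReal_inv, Complex.coe_smul]
  congr 2
  have := T.orbit_add x hr'.le ht
  rw [sub_add_cancel] at this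
  rw [this]; rfl

lemma HasGenerator.orbit_le_of_dissipative {T : C0Semigroup X} (hT : T.HasGenerator A) {w : ℝ}
    (hA : ∀ u : A.domain, (inner ℂ (A u) (u : X)).re ≤ w * ‖(u : X)‖ ^ 2)
    (hd : Dense (A.domain : Set X)) (x : X) {t : ℝ} (ht : 0 ≤ t) :
    ‖T.orbit x t‖ ≤ Real.exp (w * t) * ‖x‖ := by
  refine hd.induction (P := fun x => ‖T.orbit x t‖ ≤ Real.exp (w * t) * ‖x‖) (fun x hx => ?_)
    (isClosed_le ?_ ?_) x
  · have := norm_le_exp_of_dissipative (y := T.orbit x) (y' := fun t => T.orbit (A ⟨x, hx⟩) t)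
      (w := w) (T.continuous_orbit x).continuousOn (fun r hr => hT.hasDerivWithinAt ⟨x, hx⟩ hr)
      (fun r _ => by
        obtain ⟨h1, h2⟩ := hT.domain_orbit ⟨x, hx⟩ r
        have := hA ⟨_, h1⟩
        rw [h2] at this
        exact this) ht
    rwa [T.orbit_zero] at this
  · exact (T.toFun t.toNNReal).continuous.norm
  · fun_prop

/-- The difference of two orbits from the same point of the domain solves the linear equation with
zero initial value, so dissipativity makes it vanish. Density of the domain does the rest. -/
lemma HasGenerator.unique {T S : C0Semigroup X} (hT : T.HasGenerator A) (hS : S.HasGenerator A)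
    {w : ℝ} (hA : ∀ u : A.domain, (inner ℂ (A u) (u : X)).re ≤ w * ‖(u : X)‖ ^ 2)
    (hd : Dense (A.domain : Set X)) : T = S := by
  ext t x
  refine hd.induction (P := fun x => T.toFun t x = S.toFun t x) (fun x hx => ?_)
    (isClosed_eq (T.toFun t).continuous (S.toFun t).continuous) x
  have := norm_le_exp_of_dissipative (y := fun r => T.orbit x r - S.orbit x r)
      (y' := fun r => T.orbit (A ⟨x, hx⟩) r - S.orbit (A ⟨x, hx⟩) r)
      (w := w) ((T.continuous_orbit x).sub (S.continuous_orbit x)).continuousOn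
      (fun r hr => (hT.hasDerivWithinAt ⟨x, hx⟩ hr).sub (hS.hasDerivWithinAt ⟨x, hx⟩ hr))
      (fun r _ => by
        obtain ⟨h1, h2⟩ := hT.domain_orbit ⟨x, hx⟩ r
        obtain ⟨h3, h4⟩ := hS.domain_orbit ⟨x, hx⟩ r
        have := hA (⟨_, h1⟩ - ⟨_, h3⟩)
        rw [LinearPMap.map_sub, h2, h4] at this
        exact this) t.2
  rw [T.orbit_zero, S.orbit_zero, sub_self, norm_zero, mul_zero, norm_le_zero_iff,
    sub_eq_zero] at this
  rw [← T.orbit_coe, ← S.orbit_coe]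
  exact this

end C0Semigroup

end Abstract

end ZKLine

/-! ### Generation of semigroups by Yosida approximation. -/

namespace ZKLine

section HilleYosida

variable {X : Type*} [NormedAddCommGroup X] [InnerProductSpace ℂ X] [CompleteSpace X]
variable {A : X →ₗ.[ℂ] X}

/-! ### Exponentials of bounded dissipative operators -/

lemma hasDerivAt_exp_apply (B : X →L[ℂ] X) (x : X) (t : ℝ) :
    HasDerivAt (fun r : ℝ => NormedSpace.exp (r • B) x) (B (NormedSpace.exp (t • B) x)) t := by
  have h := hasDerivAt_exp_smul_const' (𝕂 := ℝ) B t
  exact ((ContinuousLinearMap.apply ℂ X x).restrictScalars ℝ).hasFDerivAt.comp_hasDerivAt t h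

lemma norm_exp_apply_le {B : X →L[ℂ] X} {k : ℝ}
    (hB : ∀ x, (inner ℂ (B x) x).re ≤ k * ‖x‖ ^ 2) (x : X) {t : ℝ} (ht : 0 ≤ t) :
    ‖NormedSpace.exp (t • B) x‖ ≤ Real.exp (k * t) * ‖x‖ := by
  have := norm_le_exp_of_dissipative (y := fun r : ℝ => NormedSpace.exp (r • B) x)
    (y' := fun r : ℝ => B (NormedSpace.exp (r • B) x)) (w := k)
    (fun r _ => (hasDerivAt_exp_apply B x r).continuousAt.continuousWithinAt)
    (fun r _ => (hasDerivAt_exp_apply B x r).hasDerivWithinAt) (fun r _ => hB _) ht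
  simpa using this

/-- Interpolate by r ↦ exp(rB) exp((t-r)B')x. By commutation its derivative is exp(rB)
exp((t-r)B')(B - B')x, of norm at most e^{kt}‖(B - B')x‖. -/
lemma norm_exp_sub_exp_apply_le {B B' : X →L[ℂ] X} (hBB : Commute B B') {k : ℝ}
    (hB : ∀ x, (inner ℂ (B x) x).re ≤ k * ‖x‖ ^ 2)
    (hB' : ∀ x, (inner ℂ (B' x) x).re ≤ k * ‖x‖ ^ 2) (x : X) {t : ℝ} (ht : 0 ≤ t) :
    ‖NormedSpace.exp (t • B) x - NormedSpace.exp (t • B') x‖ ≤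
      Real.exp (k * t) * ‖B x - B' x‖ * t := by
  have hd : ∀ r : ℝ, HasDerivAt
      (fun r : ℝ => (NormedSpace.exp (r • B) * NormedSpace.exp ((t - r) • B')) x)
      (NormedSpace.exp (r • B) (NormedSpace.exp ((t - r) • B') (B x - B' x))) r := by
    intro r
    have h1 := hasDerivAt_exp_smul_const (𝕂 := ℝ) B r
    have h2 := (hasDerivAt_exp_smul_const (𝕂 := ℝ) B' (t - r)).scomp r
      ((hasDerivAt_id r).const_sub t)
    have h3 := ((ContinuousLinearMap.apply ℂ X x).restrictScalars ℝ).hasFDerivAt.comp_hasDerivAt r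
      (h1.mul h2)
    have hc : B * NormedSpace.exp ((t - r) • B') = NormedSpace.exp ((t - r) • B') * B :=
      ((hBB.smul_right (t - r)).exp_right).eq
    refine h3.congr_deriv ?_
    simp only [Function.comp_apply, neg_smul, one_smul]
    rw [mul_assoc, hc, map_sub, map_sub, mul_neg, ← sub_eq_add_neg]
    rfl
  have := norm_image_sub_le_of_norm_deriv_le_segment' (a := 0) (b := t)
    (C := Real.exp (k * t) * ‖B x - B' x‖) (fun r _ => (hd r).hasDerivWithinAt)
    (fun r hr => by
      refine (norm_exp_apply_le hB _ hr.1).trans ?_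
      have h1 := norm_exp_apply_le hB' (B x - B' x) (sub_nonneg.2 hr.2.le)
      calc Real.exp (k * r) * ‖NormedSpace.exp ((t - r) • B') (B x - B' x)‖
          ≤ Real.exp (k * r) * (Real.exp (k * (t - r)) * ‖B x - B' x‖) := by gcongr
        _ = Real.exp (k * t) * ‖B x - B' x‖ := by
          rw [← mul_assoc, ← Real.exp_add]; congr 2; ring) t (Set.right_mem_Icc.2 ht)
  simpa using this

/-! ### The Yosida approximation -/

/-- The Yosida approximation `l² R - l`. -/
def yosida (l : ℝ) (R : X →L[ℂ] X) : X →L[ℂ] X :=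
  (l : ℂ) • ((l : ℂ) • R - ContinuousLinearMap.id ℂ X)

lemma yosida_apply_of_mem {l : ℝ} {R : X →L[ℂ] X} (hR : IsRes A l R) (u : A.domain) :
    yosida l R u = (l : ℂ) • R (A u) := by
  have := hR.2 u
  rw [map_sub, map_smul] at this
  change (l : ℂ) • ((l : ℂ) • R u - (u : X)) = _
  congr 1
  nth_rewrite 2 [← this]
  abel

/-- Comparing the resolvent identity with the one obtained by exchanging R and S gives the
commutation when l ≠ m; for l = m the two operators agree. -/
lemma IsRes.comm {l m : ℝ} {R S : X →L[ℂ] X} (hR : IsRes A l R) (hS : IsRes A m S) :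
    Commute R S := by
  have key : ∀ {l m : ℝ} {R S : X →L[ℂ] X}, IsRes A l R → IsRes A m S → ∀ f,
      R f = S f + ((m : ℂ) - l) • S (R f) := by
    intro l m R S hR hS f
    obtain ⟨h, he⟩ := hR.1 f
    have h2 := hS.2 ⟨R f, h⟩
    have e : (m : ℂ) • R f - A ⟨R f, h⟩ = f + ((m : ℂ) - l) • R f := by
      calc (m : ℂ) • R f - A ⟨R f, h⟩ =
            ((l : ℂ) • R f - A ⟨R f, h⟩) + ((m : ℂ) - l) • R f := by rw [sub_smul]; abel
        _ = _ := by rw [he]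
    rw [e, map_add, map_smul] at h2
    exact h2.symm
  have h1 := key hR hS
  have h2 := key hS hR
  ext f
  change R (S f) = S (R f)
  by_cases hlm : (m : ℂ) - l = 0
  · have : ∀ f, R f = S f := fun f => by rw [h1 f, hlm, zero_smul, add_zero]
    rw [this, this]
  · have h3 := h1 f
    rw [h2 f, add_assoc, left_eq_add, ← neg_sub, neg_smul, neg_add_eq_zero] at h3
    exact smul_right_injective X hlm h3

lemma yosida_commute {l m : ℝ} {R S : X →L[ℂ] X} (hR : IsRes A l R) (hS : IsRes A m S) :
    Commute (yosida l R) (yosida m S) := by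
  have h := hR.comm hS
  have h1 : Commute ((l : ℂ) • R - 1) ((m : ℂ) • S - 1) :=
    (((h.smul_left _).smul_right _).sub_left (Commute.one_left _)).sub_right
      ((Commute.one_right _))
  exact (h1.smul_left _).smul_right _

/-- With u = Rx one has x = (l - A)u and the approximation is lAu, so the form equals l² Re⟨Au, u⟩ -
l‖Au‖² ≤ w l²‖u‖². Since ‖u‖ ≤ ‖x‖/(l - w) and l² ≤ 2(l - w)² for l > 4w, the constant 2w is uniform
in l. -/
lemma yosida_dissipative {w l : ℝ} (hw : 0 ≤ w) (hl : 4 * w < l)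
    (hA : ∀ u : A.domain, (inner ℂ (A u) (u : X)).re ≤ w * ‖(u : X)‖ ^ 2) {R : X →L[ℂ] X}
    (hR : IsRes A l R) (x : X) :
    (inner ℂ (yosida l R x) x).re ≤ 2 * w * ‖x‖ ^ 2 := by
  obtain ⟨h, he⟩ := hR.1 x
  set u : A.domain := ⟨R x, h⟩
  have h1 := hA u
  have h2 := norm_le_of_dissipative hA l u
  change (l : ℂ) • (u : X) - A u = x at he
  rw [he] at h2
  have e1 : yosida l R x = (l : ℂ) • A u := by
    change (l : ℂ) • ((l : ℂ) • (u : X) - x) = _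
    rw [← he]; abel_nf
  have e2 : inner ℂ (A u) x = (l : ℂ) * inner ℂ (A u) (u : X) - inner ℂ (A u) (A u) := by
    rw [← inner_smul_right, ← inner_sub_right, he]
  rw [e1, inner_smul_left, e2, Complex.conj_ofReal, Complex.re_ofReal_mul, Complex.sub_re,
    Complex.re_ofReal_mul]
  have e : (inner ℂ (A u) (A u)).re = ‖A u‖ ^ 2 := inner_self_eq_norm_sq (𝕜 := ℂ) _
  rw [e]
  have h3 : (l - w) ^ 2 * ‖(u : X)‖ ^ 2 ≤ ‖x‖ ^ 2 := by
    rw [← mul_pow]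
    exact pow_le_pow_left₀ (mul_nonneg (by linarith) (norm_nonneg _)) h2 2
  have h4 : l ^ 2 ≤ 2 * (l - w) ^ 2 := by nlinarith
  have hl0 : 0 ≤ l := by linarith
  calc l * (l * (inner ℂ (A u) (u : X)).re - ‖A u‖ ^ 2)
      ≤ l * (l * (w * ‖(u : X)‖ ^ 2)) := by
        refine mul_le_mul_of_nonneg_left ?_ hl0
        nlinarith [mul_le_mul_of_nonneg_left h1 hl0, sq_nonneg ‖A u‖]
    _ = w * ‖(u : X)‖ ^ 2 * l ^ 2 := by ring
    _ ≤ w * ‖(u : X)‖ ^ 2 * (2 * (l - w) ^ 2) := by gcongr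
    _ = 2 * w * ((l - w) ^ 2 * ‖(u : X)‖ ^ 2) := by ring
    _ ≤ _ := by gcongr

lemma tendsto_of_dense {S : ℕ → X →L[ℂ] X} {L : X →L[ℂ] X} {K : ℝ} (hK : ∀ n x, ‖S n x‖ ≤ K * ‖x‖)
    {D : Set X} (hD : Dense D) (h : ∀ x ∈ D, Tendsto (fun n => S n x) atTop (𝓝 (L x))) (x : X) :
    Tendsto (fun n => S n x) atTop (𝓝 (L x)) := by
  rw [Metric.tendsto_atTop]
  intro ε hε
  have hK0 : 0 ≤ max K 0 + ‖L‖ := by positivity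
  set η := ε / (2 * (max K 0 + ‖L‖ + 1))
  have hη : 0 < η := by positivity
  obtain ⟨z, hz, hxz⟩ := hD.exists_dist_lt x hη
  obtain ⟨N, hN⟩ := Metric.tendsto_atTop.1 (h z hz) (ε / 2) (by positivity)
  refine ⟨N, fun n hn => ?_⟩
  have h1 := hN n hn
  rw [dist_eq_norm] at h1 hxz ⊢
  have e : S n x - L x = S n (x - z) - L (x - z) + (S n z - L z) := by
    simp only [map_sub]; abel
  rw [e]
  have h2 : ‖S n (x - z)‖ ≤ max K 0 * ‖x - z‖ :=
    (hK n _).trans (mul_le_mul_of_nonneg_right (le_max_left _ _) (norm_nonneg _))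
  have h3 := L.le_opNorm (x - z)
  have h4 : (max K 0 + ‖L‖) * ‖x - z‖ ≤ ε / 2 := by
    calc (max K 0 + ‖L‖) * ‖x - z‖ ≤ (max K 0 + ‖L‖ + 1) * η :=
          mul_le_mul (by linarith) hxz.le (norm_nonneg _) (by positivity)
      _ = ε / 2 := by simp only [η]; field_simp
  have h5 := (norm_add_le (S n (x - z) - L (x - z)) (S n z - L z))
  have h6 := norm_sub_le (S n (x - z)) (L (x - z))
  linarith

lemma cauchySeq_of_dense {S : ℕ → X →L[ℂ] X} {K : ℝ} (hK : ∀ n x, ‖S n x‖ ≤ K * ‖x‖)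
    {D : Set X} (hD : Dense D) (h : ∀ x ∈ D, CauchySeq (fun n => S n x)) (x : X) :
    CauchySeq (fun n => S n x) := by
  rw [Metric.cauchySeq_iff]
  intro ε hε
  have hK0 : 0 ≤ max K 0 := le_max_right _ _
  set η := ε / (2 * (2 * max K 0 + 1))
  have hη : 0 < η := by positivity
  obtain ⟨z, hz, hxz⟩ := hD.exists_dist_lt x hη
  obtain ⟨N, hN⟩ := Metric.cauchySeq_iff.1 (h z hz) (ε / 2) (by positivity)
  refine ⟨N, fun m hm n hn => ?_⟩
  have h1 := hN m hm n hn
  rw [dist_eq_norm] at h1 hxz ⊢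
  have e : S m x - S n x = S m (x - z) - S n (x - z) + (S m z - S n z) := by
    simp only [map_sub]; abel
  rw [e]
  have h2 : ∀ n, ‖S n (x - z)‖ ≤ max K 0 * ‖x - z‖ := fun n =>
    (hK n _).trans (mul_le_mul_of_nonneg_right (le_max_left _ _) (norm_nonneg _))
  have h4 : (2 * max K 0) * ‖x - z‖ ≤ ε / 2 := by
    calc (2 * max K 0) * ‖x - z‖ ≤ (2 * max K 0 + 1) * η :=
          mul_le_mul (by linarith) hxz.le (norm_nonneg _) (by positivity)
      _ = ε / 2 := by simp only [η]; field_simp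
  have h5 := (norm_add_le (S m (x - z) - S n (x - z)) (S m z - S n z))
  have h6 := norm_sub_le (S m (x - z)) (S n (x - z))
  linarith [h2 m, h2 n]

/-- The Hille–Yosida theorem for quasi-dissipative operators on a Hilbert space. -/
theorem exists_semigroup {w l₀ : ℝ} (hw : 0 ≤ w)
    (hA : ∀ u : A.domain, (inner ℂ (A u) (u : X)).re ≤ w * ‖(u : X)‖ ^ 2)
    (hs : ∀ l ≥ l₀, ∀ f, ∃ u : A.domain, (l : ℂ) • (u : X) - A u = f) :
    ∃ T : C0Semigroup X, T.HasGenerator A := by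
  -- Beyond l₀ the equation is solvable; l > 4w is needed for `yosida_dissipative` and also gives
  -- l/(l - w) ≤ 2.
  set L : ℝ := max l₀ (4 * w + 1)
  have hL1 : l₀ ≤ L := le_max_left _ _
  have hL2 : 4 * w + 1 ≤ L := le_max_right _ _
  have hD : Dense (A.domain : Set X) :=
    dense_domain_of_dissipative (l := L) hA (by linarith) (hs L hL1)
  let l : ℕ → ℝ := fun n => L + n
  have hl : ∀ n, L ≤ l n := fun n => by simp [l]
  have hres : ∀ n, ∃ R, IsRes A (l n) R ∧ ∀ f, ‖R f‖ ≤ (l n - w)⁻¹ * ‖f‖ := fun n => by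
    refine exists_isRes (hs (l n) (hL1.trans (hl n))) fun u => ?_
    have h1 := norm_le_of_dissipative hA (l n) u
    have h2 : 0 < l n - w := by linarith [hl n]
    rwa [inv_mul_eq_div, le_div_iff₀ h2, mul_comm]
  choose R hR hRn using hres
  have hpos : ∀ n, 0 < l n - w := fun n => by linarith [hl n]
  -- strong convergence of `l R(l)` to the identity
  have hJn : ∀ n x, ‖(((l n : ℝ) : ℂ) • R n) x‖ ≤ 2 * ‖x‖ := fun n x => by
    have hln : 0 ≤ l n := by linarith [hl n]
    rw [_root_.smul_apply, norm_smul, Complex.norm_real, Real.norm_of_nonneg hln]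
    calc l n * ‖R n x‖ ≤ l n * ((l n - w)⁻¹ * ‖x‖) := by gcongr; exact hRn n x
      _ = l n / (l n - w) * ‖x‖ := by ring
      _ ≤ 2 * ‖x‖ := by
        gcongr
        rw [div_le_iff₀ (hpos n)]
        linarith [hl n]
  have hinv : Tendsto (fun n => (l n - w)⁻¹) atTop (𝓝 0) := by
    refine tendsto_inv_atTop_zero.comp ?_
    refine tendsto_atTop_add_const_right _ _ ?_
    exact tendsto_atTop_add_const_left _ _ tendsto_natCast_atTop_atTop
  have hJ : ∀ x, Tendsto (fun n => (((l n : ℝ) : ℂ) • R n) x) atTop (𝓝 x) := by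
    refine tendsto_of_dense (L := ContinuousLinearMap.id ℂ X) hJn hD fun x hx => ?_
    rw [tendsto_iff_norm_sub_tendsto_zero]
    refine squeeze_zero (fun _ => norm_nonneg _) (fun n => ?_)
      (by simpa using hinv.mul_const ‖A ⟨x, hx⟩‖)
    have h1 := (hR n).2 ⟨x, hx⟩
    rw [map_sub, map_smul] at h1
    have h2 : (((l n : ℝ) : ℂ) • R n) x - ContinuousLinearMap.id ℂ X x = R n (A ⟨x, hx⟩) := by
      rw [_root_.smul_apply, ContinuousLinearMap.id_apply]
      rw [sub_eq_iff_eq_add] at h1 ⊢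
      rw [h1, add_comm]
    rw [h2]
    exact hRn n _
  let B : ℕ → X →L[ℂ] X := fun n => yosida (l n) (R n)
  have hBd : ∀ n x, (inner ℂ (B n x) x).re ≤ 2 * w * ‖x‖ ^ 2 := fun n x =>
    yosida_dissipative hw (by linarith [hl n]) hA (hR n) x
  have hBc : ∀ m n, Commute (B m) (B n) := fun m n => yosida_commute (hR m) (hR n)
  have hBn : ∀ n (u : A.domain), ‖B n u‖ ≤ 2 * ‖A u‖ := fun n u => by
    simp only [B]
    rw [yosida_apply_of_mem (hR n)]
    exact hJn n _
  have hBA : ∀ u : A.domain, Tendsto (fun n => B n u) atTop (𝓝 (A u)) := fun u => by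
    refine (hJ (A u)).congr fun n => ?_
    simp only [B]
    rw [yosida_apply_of_mem (hR n)]; rfl
  let S : ℝ≥0 → ℕ → X →L[ℂ] X := fun t n => NormedSpace.exp ((t : ℝ) • B n)
  have hSn : ∀ t n x, ‖S t n x‖ ≤ Real.exp (2 * w * t) * ‖x‖ := fun t n x =>
    norm_exp_apply_le (hBd n) x t.2
  -- On the domain the approximants converge, and since they commute, the differences of their
  -- exponentials are controlled by the differences of the approximants. Uniform bounds extend this
  -- to all vectors.
  have hcau : ∀ t x, CauchySeq (fun n => S t n x) := fun t => by
    refine cauchySeq_of_dense (hSn t) hD fun x hx => ?_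
    have hc := (hBA ⟨x, hx⟩).cauchySeq
    rw [Metric.cauchySeq_iff] at hc ⊢
    intro ε hε
    obtain ⟨N, hN⟩ := hc (ε / (Real.exp (2 * w * t) * (t + 1))) (by positivity)
    refine ⟨N, fun m hm n hn => ?_⟩
    have h1 := hN m hm n hn
    rw [dist_eq_norm] at h1 ⊢
    refine (norm_exp_sub_exp_apply_le (hBc m n) (hBd m) (hBd n) x t.2).trans_lt ?_
    rw [lt_div_iff₀ (by positivity)] at h1
    change Real.exp (2 * w * t) * ‖B m x - B n x‖ * t < ε
    refine lt_of_le_of_lt ?_ h1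
    have : 0 ≤ Real.exp (2 * w * t) * ‖B m x - B n x‖ := by positivity
    nlinarith
  choose G hG using fun t x => cauchySeq_tendsto_of_complete (hcau t x)
  let T : ℝ≥0 → X →L[ℂ] X := fun t =>
    LinearMap.mkContinuous
      { toFun := G t
        map_add' := fun x y => tendsto_nhds_unique (hG t (x + y)) (by
          simpa only [map_add] using (hG t x).add (hG t y))
        map_smul' := fun k x => tendsto_nhds_unique (hG t (k • x)) (by
          simpa only [map_smul, RingHom.id_apply] using (hG t x).const_smul k) }
      (Real.exp (2 * w * t)) (fun x => le_of_tendsto (hG t x).norm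
        (Eventually.of_forall fun n => hSn t n x))
  have hT : ∀ t x, Tendsto (fun n => S t n x) atTop (𝓝 (T t x)) := hG
  have hTn : ∀ t x, ‖T t x‖ ≤ Real.exp (2 * w * t) * ‖x‖ := fun t x =>
    le_of_tendsto (hT t x).norm (Eventually.of_forall fun n => hSn t n x)
  -- equicontinuity at zero
  have hequi : ∀ y : X, ∀ ε > 0, ∃ δ : ℝ, 0 < δ ∧ ∀ r : ℝ, 0 ≤ r → r ≤ δ → ∀ n,
      ‖NormedSpace.exp (r • B n) y - y‖ ≤ ε := by
    intro y ε hε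
    set K := Real.exp (2 * w * 1)
    have hKpos : 0 < K := Real.exp_pos _
    obtain ⟨z, hz, hyz⟩ := hD.exists_dist_lt y (show 0 < ε / (2 * (K + 1)) by positivity)
    set a := ‖A ⟨z, hz⟩‖
    have ha : 0 ≤ a := norm_nonneg _
    refine ⟨min 1 (ε / (2 * (K * (2 * a) + 1))), by positivity, fun r hr0 hr n => ?_⟩
    have hr1 : r ≤ 1 := hr.trans (min_le_left _ _)
    have hr2 := hr.trans (min_le_right _ _)
    have hKr : Real.exp (2 * w * r) ≤ K := Real.exp_le_exp.2 (by gcongr)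
    rw [dist_eq_norm] at hyz
    have h1 : ‖NormedSpace.exp (r • B n) (y - z)‖ ≤ K * ‖y - z‖ :=
      (norm_exp_apply_le (hBd n) _ hr0).trans (by gcongr)
    have h2 : ‖NormedSpace.exp (r • B n) z - z‖ ≤ K * (2 * a) * r := by
      have := norm_exp_sub_exp_apply_le (B' := 0) (Commute.zero_right (B n)) (hBd n)
        (fun x => by simp; positivity) z hr0
      simp only [smul_zero, NormedSpace.exp_zero, one_apply_eq_self,
        _root_.zero_apply, sub_zero] at this
      refine this.trans ?_
      have := hBn n ⟨z, hz⟩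
      gcongr
    have e : NormedSpace.exp (r • B n) y - y = NormedSpace.exp (r • B n) (y - z) - (y - z) +
        (NormedSpace.exp (r • B n) z - z) := by
      rw [map_sub]; abel
    rw [e]
    have h3 := norm_add_le (NormedSpace.exp (r • B n) (y - z) - (y - z))
      (NormedSpace.exp (r • B n) z - z)
    have h4 := norm_sub_le (NormedSpace.exp (r • B n) (y - z)) (y - z)
    have h5 : (K + 1) * ‖y - z‖ ≤ ε / 2 := by
      calc (K + 1) * ‖y - z‖ ≤ (K + 1) * (ε / (2 * (K + 1))) := by gcongr
        _ = ε / 2 := by field_simp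
    have h6 : K * (2 * a) * r ≤ ε / 2 := by
      calc K * (2 * a) * r ≤ (K * (2 * a) + 1) * (ε / (2 * (K * (2 * a) + 1))) := by
            gcongr; linarith
        _ = ε / 2 := by
          have : 0 < K * (2 * a) + 1 := by positivity
          rw [mul_div_assoc', mul_comm (K * (2 * a) + 1) ε, mul_div_mul_right _ _ this.ne']
    linarith
  have hTcont : ∀ y : X, ∀ ε > 0, ∃ δ : ℝ, 0 < δ ∧ ∀ r : ℝ≥0, r ≤ δ → ‖T r y - y‖ ≤ ε := by
    intro y ε hε
    obtain ⟨δ, hδ, h⟩ := hequi y ε hε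
    exact ⟨δ, hδ, fun r hr => le_of_tendsto ((hT r y).sub_const y).norm
      (Eventually.of_forall fun n => h r r.2 hr n)⟩
  let TT : C0Semigroup X :=
    { toFun := T
      map_zero := by
        ext x
        exact tendsto_nhds_unique (hT 0 x) (by simp [S])
      map_add := fun t r => by
        ext x
        refine tendsto_nhds_unique (hT (t + r) x) ?_
        have h1 : ∀ n, S (t + r) n x = S t n (S r n x - T r x) + S t n (T r x) := fun n => by
          rw [← map_add, sub_add_cancel]
          simp only [S, NNReal.coe_add, add_smul]
          let : NormedAlgebra ℚ (X →L[ℂ] X) := .restrictScalars ℚ ℂ _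
          rw [NormedSpace.exp_add_of_commute
            (((Commute.refl (B n)).smul_left _).smul_right _)]
          rfl
        have h2 : Tendsto (fun n => S t n (S r n x - T r x)) atTop (𝓝 0) := by
          rw [tendsto_zero_iff_norm_tendsto_zero]
          refine squeeze_zero (fun _ => norm_nonneg _) (fun n => hSn t n _) ?_
          have := (tendsto_iff_norm_sub_tendsto_zero.1 (hT r x)).const_mul (Real.exp (2 * w * t))
          simpa using this
        simpa [h1] using h2.add (hT t (T r x))
      tendsto_zero := fun x => by
        rw [Metric.tendsto_nhds]
        intro ε hε
        obtain ⟨δ, hδ, h⟩ := hTcont x (ε / 2) (by positivity)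
        have : ∀ᶠ r : ℝ≥0 in 𝓝 0, (r : ℝ) < δ := by
          have h3 : Tendsto (fun r : ℝ≥0 => (r : ℝ)) (𝓝 0) (𝓝 ((0 : ℝ≥0) : ℝ)) :=
            NNReal.continuous_coe.tendsto 0
          exact h3.eventually (eventually_lt_nhds (by simpa using hδ))
        filter_upwards [this] with r hr
        rw [dist_eq_norm]
        exact (h r hr.le).trans_lt (by linarith) }
  -- The remainder exp(rBₙ)u - u - rBₙu is estimated by the mean value inequality. By `hequi` the
  -- estimate is uniform in n, so n → ∞ is possible before r → 0.
  have hdir : ∀ u : A.domain, Tendsto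
      (fun h : ℝ≥0 => (((h : ℝ) : ℂ)⁻¹) • (T h u - u)) (𝓝[>] 0) (𝓝 (A u)) := by
    intro u
    rw [Metric.tendsto_nhds]
    intro ε hε
    obtain ⟨δ, hδ, h⟩ := hequi (A u) (ε / 2) (by positivity)
    have h1 : ∀ᶠ r : ℝ≥0 in 𝓝[>] 0, (r : ℝ) < δ := by
      have h3 : Tendsto (fun r : ℝ≥0 => (r : ℝ)) (𝓝 0) (𝓝 ((0 : ℝ≥0) : ℝ)) :=
        NNReal.continuous_coe.tendsto 0
      exact (h3.eventually (eventually_lt_nhds (by simpa using hδ))).filter_mono nhdsWithin_le_nhds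
    filter_upwards [h1, self_mem_nhdsWithin] with r hr hr0
    have hr0' : (0 : ℝ) < r := hr0
    have key : ∀ n, ‖S r n u - u - (r : ℂ) • B n u‖ ≤
        (Real.exp (2 * w * r) * ‖B n u - A u‖ + ε / 2 + ‖B n u - A u‖) * r := by
      intro n
      have hd : ∀ t : ℝ, HasDerivAt (fun t : ℝ => NormedSpace.exp (t • B n) (u : X) - t • B n u)
          (NormedSpace.exp (t • B n) (B n u) - B n u) t := fun t => by
        have h2 := (hasDerivAt_exp_apply (B n) (u : X) t).sub
          ((hasDerivAt_id t).smul_const (B n u))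
        refine h2.congr_deriv ?_
        have hcm : B n * NormedSpace.exp (t • B n) = NormedSpace.exp (t • B n) * B n :=
          (((Commute.refl (B n)).smul_right t).exp_right).eq
        rw [one_smul]
        congr 1
        exact congrArg (fun F : X →L[ℂ] X => F u) hcm
      have h3 := norm_image_sub_le_of_norm_deriv_le_segment' (a := 0) (b := (r : ℝ))
        (C := Real.exp (2 * w * r) * ‖B n u - A u‖ + ε / 2 + ‖B n u - A u‖)
        (fun t _ => (hd t).hasDerivWithinAt) (fun t ht => by
          have e : NormedSpace.exp (t • B n) (B n u) - B n u =
              NormedSpace.exp (t • B n) (B n u - A u) +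
                (NormedSpace.exp (t • B n) (A u) - A u) - (B n u - A u) := by
            rw [map_sub]; abel
          rw [e]
          refine (norm_sub_le _ _).trans (add_le_add ((norm_add_le _ _).trans
            (add_le_add ?_ ?_)) le_rfl)
          · refine (norm_exp_apply_le (hBd n) _ ht.1).trans ?_
            gcongr
            exact ht.2.le
          · exact h t ht.1 (ht.2.le.trans hr.le) n) r (Set.right_mem_Icc.2 r.2)
      simp only [zero_smul, NormedSpace.exp_zero, one_apply_eq_self, sub_zero] at h3
      refine le_trans (le_of_eq ?_) h3
      rw [Complex.coe_smul]
      congr 1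
      simp only [S]
      abel
    have h4 : ‖T r u - u - (r : ℂ) • A u‖ ≤ (Real.exp (2 * w * r) * 0 + ε / 2 + 0) * r := by
      have h5 := tendsto_iff_norm_sub_tendsto_zero.1 (hBA u)
      refine le_of_tendsto_of_tendsto' (((hT r u).sub_const _).sub ((hBA u).const_smul _)).norm
        ((((h5.const_mul _).add_const _).add h5).mul_const _) key
    rw [dist_eq_norm]
    have hrc : ((r : ℝ) : ℂ) ≠ 0 := by exact_mod_cast hr0'.ne'
    have e : (((r : ℝ) : ℂ)⁻¹) • (T r u - u) - A u =
        (((r : ℝ) : ℂ)⁻¹) • (T r u - u - (r : ℂ) • A u) := by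
      rw [smul_sub _ (T r u - u), smul_smul, inv_mul_cancel₀ hrc, one_smul]
    rw [e, norm_smul, norm_inv, Complex.norm_real, Real.norm_of_nonneg hr0'.le,
      inv_mul_lt_iff₀ hr0']
    refine h4.trans_lt ?_
    nlinarith
  refine ⟨TT, fun x y => ⟨?_, fun hxy => ?_⟩⟩
  · rintro ⟨h, rfl⟩
    exact hdir ⟨x, h⟩
  -- The generator cannot properly extend A. As L - A is onto, x differs from some u in the domain
  -- by a vector z whose orbit has derivative Lz at 0. The orbit grows at most like e^{2wt} and L >
  -- 2w, so z = 0.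
  · obtain ⟨u, hu⟩ := hs L hL1 ((L : ℂ) • x - y)
    have hz : Tendsto (fun h : ℝ≥0 => (((h : ℝ) : ℂ)⁻¹) • (T h (x - u) - (x - u))) (𝓝[>] 0)
        (𝓝 ((L : ℂ) • (x - u))) := by
      have h1 := hxy.sub (hdir u)
      have e : y - A u = (L : ℂ) • (x - u) := by
        rw [smul_sub]
        rw [sub_eq_iff_eq_add] at hu
        rw [hu]; abel
      rw [e] at h1
      refine h1.congr fun h => ?_
      rw [← smul_sub, map_sub]
      congr 1
      change T h x - x - (T h u - u) = _
      abel
    set z := x - (u : X)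
    have hz0 : z = 0 := by
      have h1 : Tendsto (fun h : ℝ≥0 =>
          (inner ℂ ((((h : ℝ) : ℂ)⁻¹) • (T h z - z)) z).re) (𝓝[>] 0) (𝓝 (L * ‖z‖ ^ 2)) := by
        have h2 := (Complex.continuous_re.tendsto _).comp (hz.inner (tendsto_const_nhds (x := z)))
        have e : (inner ℂ ((L : ℂ) • z) z).re = L * ‖z‖ ^ 2 := by
          rw [inner_smul_left, Complex.conj_ofReal, Complex.re_ofReal_mul]
          congr 1
          exact inner_self_eq_norm_sq (𝕜 := ℂ) z
        rw [e] at h2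
        exact h2
      have h2 : Tendsto (fun h : ℝ≥0 => (h : ℝ)⁻¹ * (Real.exp (2 * w * h) - 1) * ‖z‖ ^ 2) (𝓝[>] 0)
          (𝓝 (2 * w * ‖z‖ ^ 2)) := by
        refine Tendsto.mul_const _ ?_
        have hd : HasDerivAt (fun h : ℝ => Real.exp (2 * w * h)) (2 * w) 0 := by
          have := ((hasDerivAt_id (0 : ℝ)).const_mul (2 * w)).exp
          simpa using this
        have h3 := hasDerivAt_iff_tendsto_slope.1 hd
        have h4 : Tendsto (fun h : ℝ≥0 => (h : ℝ)) (𝓝[>] 0) (𝓝[≠] 0) := by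
          refine tendsto_nhdsWithin_iff.2 ⟨?_, ?_⟩
          · exact (NNReal.continuous_coe.tendsto 0).mono_left nhdsWithin_le_nhds
          · filter_upwards [self_mem_nhdsWithin] with r hr
            simpa using (show (0 : ℝ≥0) < r from hr).ne'
        refine (h3.comp h4).congr fun h => ?_
        simp [slope_def_field, div_eq_inv_mul]
      have h3 : L * ‖z‖ ^ 2 ≤ 2 * w * ‖z‖ ^ 2 := by
        refine le_of_tendsto_of_tendsto h1 h2 ?_
        filter_upwards [self_mem_nhdsWithin] with r hr
        have hr0 : (0 : ℝ) < r := hr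
        rw [inner_smul_left, map_inv₀, Complex.conj_ofReal, ← Complex.ofReal_inv,
          Complex.re_ofReal_mul, mul_assoc]
        refine mul_le_mul_of_nonneg_left ?_ (by positivity)
        rw [inner_sub_left, Complex.sub_re]
        have e : (inner ℂ z z).re = ‖z‖ ^ 2 := inner_self_eq_norm_sq (𝕜 := ℂ) z
        rw [e, sub_mul, one_mul]
        refine sub_le_sub_right ?_ _
        calc (inner ℂ (T r z) z).re ≤ ‖T r z‖ * ‖z‖ :=
              (Complex.re_le_norm _).trans (norm_inner_le_norm _ _)
          _ ≤ Real.exp (2 * w * r) * ‖z‖ * ‖z‖ := by gcongr; exact hTn r z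
          _ = _ := by ring
      by_contra hne
      have : 0 < ‖z‖ ^ 2 := by
        have := norm_pos_iff.2 hne
        positivity
      nlinarith
    have hxu : x = u := sub_eq_zero.1 hz0
    subst hxu
    refine ⟨u.2, tendsto_nhds_unique (hdir u) hxy⟩

end HilleYosida

end ZKLine

/-! ### Plancherel's theorem and the Laplace transform of orbits. -/

namespace ZKLine

open scoped FourierTransform ContDiff

section GearhartPruss

variable {X : Type*} [NormedAddCommGroup X] [InnerProductSpace ℂ X] [CompleteSpace X]
variable {A : X →ₗ.[ℂ] X}

/-! ### Plancherel's theorem for `L¹ ∩ L²` -/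

lemma integral_norm_sq_eq {F : ℝ → X} (hF : MemLp F 2 volume) :
    ∫ t, ‖F t‖ ^ 2 = ‖hF.toLp F‖ ^ 2 := by
  have h : (inner ℂ (hF.toLp F) (hF.toLp F)).re = ‖hF.toLp F‖ ^ 2 :=
    inner_self_eq_norm_sq (𝕜 := ℂ) _
  rw [← h, L2.inner_def, ← RCLike.re_eq_complex_re, ← integral_re (L2.integrable_inner _ _)]
  refine integral_congr_ae ?_
  filter_upwards [hF.coeFn_toLp] with t ht
  rw [ht]
  exact (inner_self_eq_norm_sq (𝕜 := ℂ) _).symm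

/-- The L² transform is characterised by duality with Schwartz functions, and the integral transform
satisfies the same duality formula; both are locally integrable, so they agree. -/
lemma fourier_toLp_ae_eq {F : ℝ → X} (h1 : Integrable F) (h2 : MemLp F 2 volume) :
    (𝓕 (h2.toLp F) : Lp X 2 (volume : Measure ℝ)) =ᵐ[volume] 𝓕 F := by
  set V : Lp X 2 (volume : Measure ℝ) := 𝓕 (h2.toLp F)
  have hV : LocallyIntegrable (fun x => V x) := (Lp.memLp V).locallyIntegrable (by norm_num)
  have hcont : Continuous (𝓕 F) :=
    VectorFourier.fourierIntegral_continuous Real.continuous_fourierChar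
      (by fun_prop) h1
  refine ae_eq_of_integral_contDiff_smul_eq hV hcont.locallyIntegrable fun g hg hc => ?_
  have hg₁ : HasCompactSupport (Complex.ofRealCLM ∘ g) := hc.comp_left rfl
  have hg₂ : ContDiff ℝ ∞ (Complex.ofRealCLM ∘ g) := by fun_prop
  set G : 𝓢(ℝ, ℂ) := hg₁.toSchwartzMap hg₂
  have hG : ∀ x, G x = (g x : ℂ) := fun x => rfl
  have e1 := Lp.fourier_toTemperedDistribution_eq (h2.toLp F)
  have e2 := congrArg (fun D : 𝓢'(ℝ, X) => D G) e1
  simp only [TemperedDistribution.fourier_apply, Lp.toTemperedDistribution_apply] at e2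
  have e3 : ∫ x, (𝓕 G : 𝓢(ℝ, ℂ)) x • (h2.toLp F) x = ∫ x, (𝓕 G : 𝓢(ℝ, ℂ)) x • F x := by
    refine integral_congr_ae ?_
    filter_upwards [h2.coeFn_toLp] with x hx
    rw [hx]
  have e4 : ∫ x, (𝓕 G : 𝓢(ℝ, ℂ)) x • F x = ∫ x, G x • 𝓕 F x := by
    have := VectorFourier.integral_fourierIntegral_smul_eq_flip (L := innerₗ ℝ)
      Real.continuous_fourierChar (by fun_prop) (G.integrable (μ := volume)) h1
    simp only [flip_innerₗ] at this
    rw [SchwartzMap.fourier_coe]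
    exact this
  rw [e3, e4] at e2
  simp only [hG, Complex.coe_smul] at e2
  exact e2.symm

lemma memLp_fourier {F : ℝ → X} (h1 : Integrable F) (h2 : MemLp F 2 volume) :
    MemLp (𝓕 F) 2 volume :=
  (Lp.memLp _).ae_eq (fourier_toLp_ae_eq h1 h2)

lemma integral_norm_fourier_sq {F : ℝ → X} (h1 : Integrable F) (h2 : MemLp F 2 volume) :
    ∫ t, ‖𝓕 F t‖ ^ 2 = ∫ t, ‖F t‖ ^ 2 := by
  rw [integral_norm_sq_eq h2, integral_norm_sq_eq (memLp_fourier h1 h2),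
    ← Lp.norm_fourier_eq (h2.toLp F)]
  congr 2
  refine Lp.ext ?_
  exact (memLp_fourier h1 h2).coeFn_toLp.trans (fourier_toLp_ae_eq h1 h2).symm

/-! ### The Laplace transform of a semigroup -/

namespace C0Semigroup

/-- `‖T(t)‖ ≤ N e^{wt}`. -/
def Growth (T : C0Semigroup X) (N w : ℝ) : Prop :=
  ∀ x t, 0 ≤ t → ‖T.orbit x t‖ ≤ N * Real.exp (w * t) * ‖x‖

/-- The weighted orbit `e^{-λt} T(t) x`, extended by zero to negative times. -/
def wOrbit (T : C0Semigroup X) (l : ℂ) (x : X) : ℝ → X :=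
  (Set.Ioi (0 : ℝ)).indicator fun t => Complex.exp (-l * t) • T.orbit x t

lemma continuous_exp_smul_orbit (T : C0Semigroup X) (l : ℂ) (x : X) :
    Continuous fun t : ℝ => Complex.exp (-l * t) • T.orbit x t :=
  (by fun_prop : Continuous fun t : ℝ => Complex.exp (-l * t)).smul (T.continuous_orbit x)

lemma aestronglyMeasurable_wOrbit (T : C0Semigroup X) (l : ℂ) (x : X) :
    AEStronglyMeasurable (T.wOrbit l x) volume :=
  (T.continuous_exp_smul_orbit l x).aestronglyMeasurable.indicator measurableSet_Ioi

lemma norm_exp_neg_mul (l : ℂ) (t : ℝ) : ‖Complex.exp (-l * t)‖ = Real.exp (-l.re * t) := by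
  rw [Complex.norm_exp]; simp

lemma norm_wOrbit_of_pos (T : C0Semigroup X) (l : ℂ) (x : X) {t : ℝ} (ht : 0 < t) :
    ‖T.wOrbit l x t‖ = Real.exp (-l.re * t) * ‖T.orbit x t‖ := by
  rw [wOrbit, Set.indicator_of_mem (Set.mem_Ioi.2 ht), norm_smul, norm_exp_neg_mul]

lemma Growth.norm_wOrbit_le {T : C0Semigroup X} {N w : ℝ} (h : T.Growth N w) (l : ℂ) (x : X)
    (t : ℝ) : ‖T.wOrbit l x t‖ ≤
      (Set.Ioi (0 : ℝ)).indicator (fun t => N * ‖x‖ * Real.exp ((w - l.re) * t)) t := by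
  by_cases ht : 0 < t
  · rw [T.norm_wOrbit_of_pos l x ht, Set.indicator_of_mem (Set.mem_Ioi.2 ht)]
    calc Real.exp (-l.re * t) * ‖T.orbit x t‖
        ≤ Real.exp (-l.re * t) * (N * Real.exp (w * t) * ‖x‖) := by
          gcongr; exact h x t ht.le
      _ = N * ‖x‖ * (Real.exp (-l.re * t) * Real.exp (w * t)) := by ring
      _ = _ := by rw [← Real.exp_add]; congr 2; ring
  · have : t ∉ Set.Ioi (0 : ℝ) := ht
    rw [wOrbit, Set.indicator_of_notMem this, Set.indicator_of_notMem this, norm_zero]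

lemma Growth.integrable_wOrbit {T : C0Semigroup X} {N w : ℝ} (h : T.Growth N w) {l : ℂ}
    (hl : w < l.re) (x : X) : Integrable (T.wOrbit l x) := by
  refine Integrable.mono' ?_ (T.aestronglyMeasurable_wOrbit l x)
    (ae_of_all _ (h.norm_wOrbit_le l x))
  rw [integrable_indicator_iff measurableSet_Ioi]
  exact (integrableOn_exp_mul_Ioi (by linarith) 0).const_mul _

lemma integrable_indicator_exp_sq {K a : ℝ} (ha : a < 0) : Integrable fun t : ℝ =>
    ((Set.Ioi (0 : ℝ)).indicator (fun t => K * Real.exp (a * t)) t) ^ 2 := by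
  have : (fun t : ℝ => ((Set.Ioi (0 : ℝ)).indicator (fun t => K * Real.exp (a * t)) t) ^ 2) =
      (Set.Ioi (0 : ℝ)).indicator (fun t => K ^ 2 * Real.exp (2 * a * t)) := by
    funext t
    by_cases ht : t ∈ Set.Ioi (0 : ℝ)
    · rw [Set.indicator_of_mem ht, Set.indicator_of_mem ht, mul_pow, ← Real.exp_nat_mul]
      congr 2; push_cast; ring
    · rw [Set.indicator_of_notMem ht, Set.indicator_of_notMem ht]; simp
  rw [this, integrable_indicator_iff measurableSet_Ioi]
  exact (integrableOn_exp_mul_Ioi (by linarith) 0).const_mul _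

lemma Growth.memLp_wOrbit {T : C0Semigroup X} {N w : ℝ} (h : T.Growth N w) {l : ℂ}
    (hl : w < l.re) (x : X) : MemLp (T.wOrbit l x) 2 volume := by
  rw [memLp_two_iff_integrable_sq_norm (T.aestronglyMeasurable_wOrbit l x)]
  refine Integrable.mono' (integrable_indicator_exp_sq (K := N * ‖x‖) (sub_neg.2 hl))
    ((T.aestronglyMeasurable_wOrbit l x).norm.pow 2) (ae_of_all _ fun t => ?_)
  rw [Real.norm_of_nonneg (by positivity)]
  exact pow_le_pow_left₀ (norm_nonneg _) (h.norm_wOrbit_le l x t) 2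

lemma Growth.integral_wOrbit_sq_le {T : C0Semigroup X} {N w : ℝ} (h : T.Growth N w) {l : ℂ}
    (hl : l.re = w + 1) (x : X) : ∫ t, ‖T.wOrbit l x t‖ ^ 2 ≤ N ^ 2 * ‖x‖ ^ 2 / 2 := by
  have h1 := (h.memLp_wOrbit (l := l) (by linarith) x).integrable_norm_pow (by norm_num)
  have hle : ∫ t, ‖T.wOrbit l x t‖ ^ 2 ≤ ∫ t in Set.Ioi (0 : ℝ),
      (N * ‖x‖) ^ 2 * Real.exp (-2 * t) := by
    rw [← integral_indicator measurableSet_Ioi]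
    refine integral_mono h1 ?_ fun t => ?_
    · rw [integrable_indicator_iff measurableSet_Ioi]
      exact (integrableOn_exp_mul_Ioi (by norm_num) 0).const_mul _
    · refine (pow_le_pow_left₀ (norm_nonneg _) (h.norm_wOrbit_le l x t) 2).trans (le_of_eq ?_)
      by_cases ht : t ∈ Set.Ioi (0 : ℝ)
      · rw [Set.indicator_of_mem ht, Set.indicator_of_mem ht, mul_pow _ (Real.exp _),
          ← Real.exp_nat_mul, hl]
        congr 2; push_cast; ring
      · rw [Set.indicator_of_notMem ht, Set.indicator_of_notMem ht]; simp
  refine hle.trans (le_of_eq ?_)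
  rw [integral_const_mul, integral_exp_mul_Ioi (by norm_num)]
  simp
  ring

/-- The Laplace transform `∫₀^∞ e^{-λt} T(t) x dt`. -/
def laplace (T : C0Semigroup X) (l : ℂ) (x : X) : X := ∫ t, T.wOrbit l x t

lemma tendsto_of_hasDerivWithinAt_orbit {T : C0Semigroup X} {x y : X}
    (h : HasDerivWithinAt (T.orbit x) y (Set.Ici 0) 0) :
    Tendsto (fun h : ℝ≥0 => (((h : ℝ) : ℂ)⁻¹) • (T.toFun h x - x)) (𝓝[>] 0) (𝓝 y) := by
  rw [← hasDerivWithinAt_Ioi_iff_Ici, hasDerivWithinAt_iff_tendsto_slope' Set.self_notMem_Ioi] at h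
  have h4 : Tendsto (fun h : ℝ≥0 => (h : ℝ)) (𝓝[>] 0) (𝓝[>] 0) := by
    refine tendsto_nhdsWithin_iff.2 ⟨?_, ?_⟩
    · exact (NNReal.continuous_coe.tendsto 0).mono_left nhdsWithin_le_nhds
    · filter_upwards [self_mem_nhdsWithin] with r hr
      exact hr
  refine (h.comp h4).congr fun r => ?_
  simp only [Function.comp_apply]
  rw [slope_def_module, T.orbit_coe, T.orbit_zero, sub_zero, ← Complex.ofReal_inv,
    Complex.coe_smul]

/-- Applying T(r) to L = ∫₀^∞ e^{-lt}T(t)x dt gives e^{lr} times the tail of the integral beyond r.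
Its right derivative at r = 0 is lL - x, which the generator property identifies with AL. -/
lemma Growth.laplace_spec {T : C0Semigroup X} {N w : ℝ} (h : T.Growth N w)
    (hT : T.HasGenerator A) {l : ℂ} (hl : w < l.re) (x : X) :
    ∃ hd : T.laplace l x ∈ A.domain, l • T.laplace l x - A ⟨_, hd⟩ = x := by
  set g : ℝ → X := fun t => Complex.exp (-l * t) • T.orbit x t
  have hg : Continuous g := T.continuous_exp_smul_orbit l x
  have hint : IntegrableOn g (Set.Ioi 0) := by
    rw [← integrable_indicator_iff measurableSet_Ioi]
    exact h.integrable_wOrbit hl x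
  set L := T.laplace l x
  have hL : L = ∫ t in Set.Ioi (0 : ℝ), g t := integral_indicator measurableSet_Ioi
  have horb : ∀ r : ℝ, 0 ≤ r → T.orbit L r =
      Complex.exp (l * r) • (L - ∫ t in (0 : ℝ)..r, g t) := by
    intro r hr
    have e1 : L - ∫ t in (0 : ℝ)..r, g t = ∫ t in Set.Ioi r, g t := by
      rw [hL, ← intervalIntegral.integral_Ioi_sub_Ioi hint hr]
      abel
    have e2 : ∫ t in Set.Ioi r, g t = ∫ t in Set.Ioi (0 : ℝ), g (t + r) := by
      rw [← integral_indicator measurableSet_Ioi, ← integral_indicator measurableSet_Ioi,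
        ← integral_add_right_eq_self _ r]
      refine integral_congr_ae (ae_of_all _ fun t => ?_)
      simp [Set.indicator_apply]
    rw [e1, e2, ← integral_smul, orbit, hL, ← ContinuousLinearMap.integral_comp_comm _ hint]
    refine setIntegral_congr_fun measurableSet_Ioi fun t ht => ?_
    have ht0 : 0 ≤ t := (Set.mem_Ioi.1 ht).le
    simp only [g]
    rw [map_smul, smul_smul, ← Complex.exp_add, add_comm t r, T.orbit_add x hr ht0]
    have : l * r + -l * ((r + t : ℝ) : ℂ) = -l * t := by push_cast; ring
    rw [this]
    rfl
  have hder : HasDerivWithinAt (T.orbit L) (l • L - x) (Set.Ici 0) 0 := by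
    have h1 : HasDerivAt (fun r : ℝ => ∫ t in (0 : ℝ)..r, g t) (g 0) 0 :=
      intervalIntegral.integral_hasDerivAt_right (hg.intervalIntegrable _ _)
        (hg.stronglyMeasurableAtFilter _ _) hg.continuousAt
    have h2 : HasDerivAt (fun r : ℝ => Complex.exp (l * r)) l 0 := by
      have := ((hasDerivAt_id (0 : ℝ)).ofReal_comp.const_mul l).cexp
      simpa using this
    have h3 := h2.smul (h1.const_sub L)
    have e0 : g 0 = x := by simp [g, T.orbit_zero]
    simp only [Complex.ofReal_zero, mul_zero, Complex.exp_zero, one_smul, sub_zero,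
      intervalIntegral.integral_same, e0, smul_neg] at h3
    refine ((h3.congr_deriv (by abel)).hasDerivWithinAt).congr (fun r hr => horb r hr)
      (horb 0 le_rfl)
  obtain ⟨hd, he⟩ := (hT L (l • L - x)).2 (tendsto_of_hasDerivWithinAt_orbit hder)
  exact ⟨hd, by rw [he]; abel⟩

/-- Along a vertical line the Laplace transform is a Fourier transform, with frequency τ
corresponding to the imaginary part 2πτ. -/
lemma fourier_wOrbit (T : C0Semigroup X) (v : ℝ) (x : X) (τ : ℝ) :
    𝓕 (T.wOrbit v x) τ = T.laplace (v + (2 * Real.pi * τ : ℝ) * Complex.I) x := by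
  rw [Real.fourier_real_eq_integral_exp_smul, laplace]
  refine integral_congr_ae (ae_of_all _ fun t => ?_)
  by_cases ht : t ∈ Set.Ioi (0 : ℝ)
  · simp only [wOrbit, Set.indicator_of_mem ht]
    rw [smul_smul, ← Complex.exp_add]
    congr 2
    push_cast
    ring
  · simp only [wOrbit, Set.indicator_of_notMem ht, smul_zero]

end C0Semigroup

end GearhartPruss

end ZKLine

/-! ### From resolvent bounds to growth bounds. -/

namespace ZKLine

open scoped FourierTransform

section GearhartPruss

variable {X : Type*} [NormedAddCommGroup X] [InnerProductSpace ℂ X] [CompleteSpace X]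
variable {A : X →ₗ.[ℂ] X}

/-! ### The Gearhart–Prüss theorem with explicit constants -/

namespace C0Semigroup

/-- The difference of the Laplace transforms at l and m is mapped by l - A to (m - l) times the
transform at m, and the resolvent bound applies to it. The growth rates only ensure convergence and
do not enter the estimate. -/
lemma Growth.norm_laplace_le {T : C0Semigroup X} {N w N' w' M v : ℝ} (h : T.Growth N w)
    (h' : T.Growth N' w') (hT : T.HasGenerator A)
    (hM : ∀ l : ℂ, v ≤ l.re → ∀ u : A.domain, ‖(u : X)‖ ≤ M * ‖l • (u : X) - A u‖)
    {l m : ℂ} (hv : v ≤ l.re) (hl : w < l.re) (hm : w' < m.re) (x : X) :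
    ‖T.laplace l x‖ ≤ (1 + ‖m - l‖ * M) * ‖T.laplace m x‖ := by
  obtain ⟨hd, he⟩ := h.laplace_spec hT hl x
  obtain ⟨hd', he'⟩ := h'.laplace_spec hT hm x
  have h1 := hM l hv (⟨_, hd⟩ - ⟨_, hd'⟩)
  rw [LinearPMap.map_sub, Submodule.coe_sub, smul_sub, sub_sub_sub_comm, he] at h1
  have e : x - (l • T.laplace m x - A ⟨T.laplace m x, hd'⟩) = (m - l) • T.laplace m x := by
    nth_rewrite 1 [← he']
    rw [sub_smul]; abel
  dsimp only at h1
  rw [e, norm_smul] at h1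
  have h2 := norm_le_insert' (T.laplace l x) (T.laplace m x)
  linarith

/-- The constant in the weighted `L²` bound for orbits. -/
def gpConst (N ω M : ℝ) : ℝ := (1 + (ω + 1) * M) ^ 2 * (N ^ 2 / 2)

/-- By Plancherel, the transform on Re λ = v is compared with the one on Re λ = ω + 1, where the
known growth bounds it. The auxiliary pair N', w' is absent from the constant, which makes an
iteration possible. -/
lemma Growth.integral_wOrbit_sq_le_gpConst {T : C0Semigroup X} {N ω N' w' M w v : ℝ}
    (h : T.Growth N ω) (h' : T.Growth N' w') (hT : T.HasGenerator A) (hM0 : 0 ≤ M) (hv0 : 0 ≤ v)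
    (hM : ∀ l : ℂ, w ≤ l.re → ∀ u : A.domain, ‖(u : X)‖ ≤ M * ‖l • (u : X) - A u‖)
    (hwv : w ≤ v) (hv : w' < v) (hvω : v ≤ ω + 1) (x : X) :
    ∫ t, ‖T.wOrbit v x t‖ ^ 2 ≤ gpConst N ω M * ‖x‖ ^ 2 := by
  have i1 : Integrable (T.wOrbit v x) := h'.integrable_wOrbit (by simpa using hv) x
  have i2 : MemLp (T.wOrbit v x) 2 volume := h'.memLp_wOrbit (by simpa using hv) x
  have j1 : Integrable (T.wOrbit (ω + 1 : ℝ) x) := h.integrable_wOrbit (by simp) x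
  have j2 : MemLp (T.wOrbit (ω + 1 : ℝ) x) 2 volume := h.memLp_wOrbit (by simp) x
  rw [← integral_norm_fourier_sq i1 i2]
  have hle : ∀ τ, ‖𝓕 (T.wOrbit v x) τ‖ ^ 2 ≤
      (1 + (ω + 1) * M) ^ 2 * ‖𝓕 (T.wOrbit (ω + 1 : ℝ) x) τ‖ ^ 2 := fun τ => by
    rw [← mul_pow]
    refine pow_le_pow_left₀ (norm_nonneg _) ?_ 2
    rw [fourier_wOrbit, fourier_wOrbit]
    refine (h'.norm_laplace_le h hT hM (m := (ω + 1 : ℝ) + (2 * Real.pi * τ : ℝ) * Complex.I)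
      (by simpa using hwv) (by simpa using hv) (by simp) x).trans ?_
    have e : (((ω + 1 : ℝ) : ℂ) + (2 * Real.pi * τ : ℝ) * Complex.I) -
        ((v : ℂ) + (2 * Real.pi * τ : ℝ) * Complex.I) = ((ω + 1 - v : ℝ) : ℂ) := by
      push_cast; ring
    rw [e, Complex.norm_real, Real.norm_of_nonneg (by linarith)]
    gcongr
    linarith
  calc ∫ τ, ‖𝓕 (T.wOrbit v x) τ‖ ^ 2
      ≤ ∫ τ, (1 + (ω + 1) * M) ^ 2 * ‖𝓕 (T.wOrbit (ω + 1 : ℝ) x) τ‖ ^ 2 :=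
        integral_mono ((memLp_fourier i1 i2).integrable_norm_pow (by norm_num))
          (((memLp_fourier j1 j2).integrable_norm_pow (by norm_num)).const_mul _) hle
    _ = (1 + (ω + 1) * M) ^ 2 * ∫ t, ‖T.wOrbit (ω + 1 : ℝ) x t‖ ^ 2 := by
        rw [integral_const_mul, integral_norm_fourier_sq j1 j2]
    _ ≤ (1 + (ω + 1) * M) ^ 2 * (N ^ 2 * ‖x‖ ^ 2 / 2) := by
        gcongr
        exact h.integral_wOrbit_sq_le (by simp) x
    _ = _ := by rw [gpConst]; ring

lemma mul_le_of_forall_le_mul_wOrbit {T : C0Semigroup X} {v : ℂ} {x : X} {q k a b I : ℝ}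
    (h2 : MemLp (T.wOrbit v x) 2 volume) (hI : ∫ t, ‖T.wOrbit v x t‖ ^ 2 ≤ I)
    (hk : 0 ≤ k) (hab : a ≤ b)
    (h : ∀ t, a < t → t ≤ b → q ≤ k * ‖T.wOrbit v x t‖ ^ 2) : q * (b - a) ≤ k * I := by
  have hi := h2.integrable_norm_pow (p := 2) (by norm_num)
  have e : ∫ _ in Set.Ioc a b, q = q * (b - a) := by
    rw [setIntegral_const, Real.volume_real_Ioc_of_le hab, smul_eq_mul, mul_comm]
  rw [← e]
  calc ∫ _ in Set.Ioc a b, q ≤ ∫ t in Set.Ioc a b, k * ‖T.wOrbit v x t‖ ^ 2 := by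
        refine setIntegral_mono_on (by simp) (hi.const_mul k).integrableOn measurableSet_Ioc ?_
        exact fun t ht => h t ht.1 ht.2
    _ ≤ ∫ t, k * ‖T.wOrbit v x t‖ ^ 2 :=
        setIntegral_le_integral (hi.const_mul k) (ae_of_all _ fun t => by positivity)
    _ ≤ k * I := by
        rw [integral_const_mul]
        gcongr

/-- The constant in the pointwise bound. -/
def gpBound (N ω M : ℝ) : ℝ := N ^ 2 * Real.exp (2 * ω) * (1 + gpConst N ω M)

lemma gpConst_nonneg (N ω M : ℝ) : 0 ≤ gpConst N ω M := by unfold gpConst; positivity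

lemma gpBound_nonneg (N ω M : ℝ) : 0 ≤ gpBound N ω M := by
  have := gpConst_nonneg N ω M
  unfold gpBound; positivity

/-- For t ≤ 1 the initial growth bound suffices. For t ≥ 1, T(t)x is dominated by T(r)x for all r in
(t-1, t], and averaging over this interval converts the integral bound into a pointwise one. -/
lemma Growth.sq_le_gpBound {T : C0Semigroup X} {N ω M v : ℝ} (h : T.Growth N ω) (hω : 0 ≤ ω)
    (hv0 : 0 ≤ v) {x : X} (h2 : MemLp (T.wOrbit v x) 2 volume)
    (hI : ∫ t, ‖T.wOrbit v x t‖ ^ 2 ≤ gpConst N ω M * ‖x‖ ^ 2) {t : ℝ} (ht : 0 ≤ t) :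
    (Real.exp (-v * t) * ‖T.orbit x t‖) ^ 2 ≤ gpBound N ω M * ‖x‖ ^ 2 := by
  have hg := gpConst_nonneg N ω M
  have e2 : Real.exp (2 * ω) = Real.exp ω ^ 2 := by rw [← Real.exp_nat_mul]; push_cast; rfl
  rcases le_total t 1 with h1 | h1
  · have h3 : Real.exp (-v * t) * ‖T.orbit x t‖ ≤ Real.exp ω * (N * ‖x‖) := by
      calc Real.exp (-v * t) * ‖T.orbit x t‖ ≤ 1 * (N * Real.exp (ω * t) * ‖x‖) := by
            refine mul_le_mul ?_ (h x t ht) (norm_nonneg _) zero_le_one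
            rw [Real.exp_le_one_iff]
            nlinarith
        _ = Real.exp (ω * t) * (N * ‖x‖) := by ring
        _ ≤ _ := by
            rcases (norm_nonneg x).eq_or_lt with hx | hx
            · simp [← hx]
            have hN : 0 ≤ N * ‖x‖ := by
              have := h x 0 le_rfl
              rw [T.orbit_zero] at this
              simp at this
              linarith [norm_nonneg x]
            gcongr
            nlinarith
    calc (Real.exp (-v * t) * ‖T.orbit x t‖) ^ 2 ≤ (Real.exp ω * (N * ‖x‖)) ^ 2 := by gcongr
      _ = N ^ 2 * Real.exp (2 * ω) * ‖x‖ ^ 2 * 1 := by rw [e2]; ring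
      _ ≤ N ^ 2 * Real.exp (2 * ω) * ‖x‖ ^ 2 * (1 + gpConst N ω M) := by gcongr; linarith
      _ = _ := by rw [gpBound]; ring
  · have key := mul_le_of_forall_le_mul_wOrbit (a := t - 1) (b := t)
      (q := (Real.exp (-v * t) * ‖T.orbit x t‖) ^ 2) (k := N ^ 2 * Real.exp (2 * ω)) h2 hI
      (by positivity) (by linarith) (fun r hr hrt => by
        have hr0 : 0 < r := by linarith
        rw [T.norm_wOrbit_of_pos v x hr0, e2, ← mul_pow, ← mul_pow]
        refine pow_le_pow_left₀ (by positivity) ?_ 2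
        have e1 : T.orbit x t = T.orbit (T.orbit x r) (t - r) := by
          rw [← T.orbit_add x (by linarith) hr0.le]; congr 1; ring
        have h4 := h (T.orbit x r) (t - r) (by linarith)
        rw [← e1] at h4
        have h5 : N * Real.exp (ω * (t - r)) * ‖T.orbit x r‖ ≤
            N * Real.exp ω * ‖T.orbit x r‖ := by
          rcases (norm_nonneg (T.orbit x r)).eq_or_lt with hx | hx
          · simp [← hx]
          have hN : 0 ≤ N := by
            have := h (T.orbit x r) 0 le_rfl
            rw [T.orbit_zero] at this
            simp at this
            nlinarith
          gcongr
          nlinarith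
        calc Real.exp (-v * t) * ‖T.orbit x t‖
            ≤ Real.exp (-v * r) * (N * Real.exp ω * ‖T.orbit x r‖) := by
              refine mul_le_mul ?_ (h4.trans h5) (norm_nonneg _) (Real.exp_pos _).le
              exact Real.exp_le_exp.2 (by nlinarith)
          _ = N * Real.exp ω * (Real.exp (-(v : ℂ).re * r) * ‖T.orbit x r‖) := by
              simp; ring)
    rw [sub_sub_cancel, mul_one] at key
    refine key.trans ?_
    calc N ^ 2 * Real.exp (2 * ω) * (gpConst N ω M * ‖x‖ ^ 2)
        ≤ N ^ 2 * Real.exp (2 * ω) * ((1 + gpConst N ω M) * ‖x‖ ^ 2) := by gcongr; linarith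
      _ = _ := by rw [gpBound]; ring

/-- Time after which the weighted semigroup is a strict contraction. -/
def gpTime (N ω M : ℝ) : ℝ := 4 * (gpBound N ω M * gpConst N ω M) + 1

lemma one_le_gpTime (N ω M : ℝ) : 1 ≤ gpTime N ω M := by
  have := mul_nonneg (gpBound_nonneg N ω M) (gpConst_nonneg N ω M)
  unfold gpTime; linarith

/-- Datko's argument: the squared weighted norm at t₀ is at most `gpBound` times its value at any
earlier r. Integration over r bounds t₀ times it by `gpBound` · `gpConst` · ‖x‖², which is at most
t₀/4 · ‖x‖² by the choice of t₀. -/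
lemma norm_orbit_gpTime_le {T : C0Semigroup X} {N ω M v : ℝ}
    (hI : ∀ x, MemLp (T.wOrbit v x) 2 volume ∧
      ∫ t, ‖T.wOrbit v x t‖ ^ 2 ≤ gpConst N ω M * ‖x‖ ^ 2)
    (hp : ∀ x t, 0 ≤ t → (Real.exp (-v * t) * ‖T.orbit x t‖) ^ 2 ≤ gpBound N ω M * ‖x‖ ^ 2)
    (x : X) : ‖T.orbit x (gpTime N ω M)‖ ≤ 1 / 2 * Real.exp (v * gpTime N ω M) * ‖x‖ := by
  set t₀ := gpTime N ω M with ht₀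
  have h1 : 1 ≤ t₀ := one_le_gpTime N ω M
  have key := mul_le_of_forall_le_mul_wOrbit (a := 0) (b := t₀)
    (q := (Real.exp (-v * t₀) * ‖T.orbit x t₀‖) ^ 2) (k := gpBound N ω M) (hI x).1 (hI x).2
    (gpBound_nonneg N ω M) (by linarith) (fun r hr hrt => by
      rw [T.norm_wOrbit_of_pos v x hr, Complex.ofReal_re, mul_pow (Real.exp (-v * r)), mul_left_comm]
      have e1 : T.orbit x t₀ = T.orbit (T.orbit x r) (t₀ - r) := by
        rw [← T.orbit_add x (by linarith) hr.le]; congr 1; ring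
      have h3 := hp (T.orbit x r) (t₀ - r) (by linarith)
      rw [← e1] at h3
      have e3 : Real.exp (-v * t₀) = Real.exp (-v * r) * Real.exp (-v * (t₀ - r)) := by
        rw [← Real.exp_add]; congr 1; ring
      rw [e3, mul_assoc, mul_pow]
      gcongr)
  rw [sub_zero] at key
  have h4 : (Real.exp (-v * t₀) * ‖T.orbit x t₀‖) ^ 2 ≤ (1 / 2 * ‖x‖) ^ 2 := by
    have h5 : gpBound N ω M * (gpConst N ω M * ‖x‖ ^ 2) ≤ t₀ * (1 / 4 * ‖x‖ ^ 2) := by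
      rw [ht₀, gpTime]
      nlinarith [sq_nonneg ‖x‖]
    have h6 := key.trans h5
    rw [mul_comm] at h6
    have := le_of_mul_le_mul_left h6 (by linarith : 0 < t₀)
    linarith
  have h5 := (sq_le_sq₀ (by positivity) (by positivity)).1 h4
  rw [neg_mul, Real.exp_neg, inv_mul_le_iff₀ (Real.exp_pos _)] at h5
  linarith

/-- Halving the weighted norm every t₀ lowers the rate by log 2/t₀. Only the initial N and ω enter
the new prefactor, through the incomplete last period. -/
lemma Growth.of_norm_orbit_le {T : C0Semigroup X} {N ω v t₀ δ : ℝ} (h : T.Growth N ω)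
    (hN : 0 ≤ N) (hω : 0 ≤ ω) (hv : 0 ≤ v) (ht₀ : 1 ≤ t₀) (hδ : δ = Real.log 2 / t₀)
    (hc : ∀ x, ‖T.orbit x t₀‖ ≤ 1 / 2 * Real.exp (v * t₀) * ‖x‖) :
    T.Growth (2 * N * Real.exp (ω * t₀)) (v - δ) := by
  have hδt : δ * t₀ = Real.log 2 := by rw [hδ]; field_simp
  have hδ0 : 0 ≤ δ := by rw [hδ]; exact div_nonneg (Real.log_nonneg (by norm_num)) (by linarith)
  have e : 1 / 2 * Real.exp (v * t₀) = Real.exp ((v - δ) * t₀) := by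
    rw [sub_mul, hδt, Real.exp_sub, Real.exp_log (by norm_num)]; ring
  have hn : ∀ n : ℕ, ∀ x, ‖T.orbit x (n * t₀)‖ ≤ Real.exp ((v - δ) * (n * t₀)) * ‖x‖ := by
    intro n
    induction n with
    | zero => intro x; simp [T.orbit_zero]
    | succ n ih =>
      intro x
      have e1 : ((n + 1 : ℕ) : ℝ) * t₀ = t₀ + n * t₀ := by push_cast; ring
      rw [e1, T.orbit_add x (by linarith) (by positivity), mul_add, Real.exp_add, ← e, mul_assoc]
      refine (hc _).trans ?_
      gcongr
      exact ih x
  intro x t ht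
  set n := ⌊t / t₀⌋₊
  have h1 : (n : ℝ) * t₀ ≤ t := by
    have := Nat.floor_le (div_nonneg ht (by linarith : 0 ≤ t₀))
    rwa [le_div_iff₀ (by linarith)] at this
  have h2 : t < (n + 1) * t₀ := by
    have := Nat.lt_floor_add_one (t / t₀)
    rwa [div_lt_iff₀ (by linarith)] at this
  set r := t - n * t₀
  have hr0 : 0 ≤ r := by simp only [r]; linarith
  have hr1 : r ≤ t₀ := by simp only [r]; linarith
  have e2 : t = n * t₀ + r := by simp only [r]; ring
  have h3 : Real.exp ((v - δ) * (n * t₀)) ≤ 2 * Real.exp ((v - δ) * t) := by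
    have : (2 : ℝ) = Real.exp (δ * t₀) := by rw [hδt, Real.exp_log (by norm_num)]
    rw [this, ← Real.exp_add]
    refine Real.exp_le_exp.2 ?_
    rw [e2]
    nlinarith [mul_nonneg hδ0 (sub_nonneg.2 hr1), mul_nonneg hv hr0]
  have h4 : ‖T.orbit x r‖ ≤ N * Real.exp (ω * t₀) * ‖x‖ := (h x r hr0).trans (by gcongr)
  calc ‖T.orbit x t‖ = ‖T.orbit (T.orbit x r) (n * t₀)‖ := by
        rw [← T.orbit_add x (by positivity) hr0, ← e2]
    _ ≤ Real.exp ((v - δ) * (n * t₀)) * ‖T.orbit x r‖ := hn n _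
    _ ≤ 2 * Real.exp ((v - δ) * t) * (N * Real.exp (ω * t₀) * ‖x‖) := by gcongr
    _ = _ := by ring

/-- The rate is lowered from ω in steps of δ/2, with δ depending only on N, ω and M: a known rate ρ
allows the estimates at v = ρ + δ/2, and the resulting contraction gives the rate v - δ = ρ - δ/2.
Once the rate is below w, the pointwise bound at v = w holds with a constant that does not see the
number of steps. -/
theorem Growth.gearhart_pruss {T : C0Semigroup X} {N ω M w : ℝ} (h : T.Growth N ω)
    (hN : 0 ≤ N) (hω : 0 ≤ ω) (hT : T.HasGenerator A) (hM0 : 0 ≤ M) (hw0 : 0 ≤ w)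
    (hwω : w ≤ ω + 1)
    (hM : ∀ l : ℂ, w ≤ l.re → ∀ u : A.domain, ‖(u : X)‖ ≤ M * ‖l • (u : X) - A u‖) :
    T.Growth (Real.sqrt (gpBound N ω M)) w := by
  set t₀ := gpTime N ω M with ht₀
  have ht1 : 1 ≤ t₀ := one_le_gpTime N ω M
  set δ := Real.log 2 / t₀ with hδ
  have hlog : 0 < Real.log 2 := Real.log_pos (by norm_num)
  have hδ0 : 0 < δ := div_pos hlog (by linarith)
  -- This keeps the exponent v = ρ + δ/2 of each step below ω + 1.
  have hδ1 : δ ≤ 1 := by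
    rw [hδ, div_le_one (by linarith)]
    have := Real.log_two_lt_d9
    linarith
  have hp : ∀ {N' w' v : ℝ}, T.Growth N' w' → w' < v → w ≤ v → v ≤ ω + 1 →
      (∀ x, MemLp (T.wOrbit v x) 2 volume ∧
        ∫ t, ‖T.wOrbit v x t‖ ^ 2 ≤ gpConst N ω M * ‖x‖ ^ 2) ∧
      (∀ x t, 0 ≤ t → (Real.exp (-v * t) * ‖T.orbit x t‖) ^ 2 ≤ gpBound N ω M * ‖x‖ ^ 2) := by
    intro N' w' v h' h1 h2 h3
    have hv0 := hw0.trans h2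
    have hI : ∀ x, MemLp (T.wOrbit v x) 2 volume ∧
        ∫ t, ‖T.wOrbit v x t‖ ^ 2 ≤ gpConst N ω M * ‖x‖ ^ 2 := fun x =>
      ⟨h'.memLp_wOrbit (by simpa using h1) x,
        h.integral_wOrbit_sq_le_gpConst h' hT hM0 hv0 hM h2 h1 h3 x⟩
    exact ⟨hI, fun x t ht => h.sq_le_gpBound hω hv0 (hI x).1 (hI x).2 ht⟩
  have hstep : ∀ n : ℕ, (∃ N', T.Growth N' (ω - n * (δ / 2))) ∨ ∃ N' w', w' < w ∧ T.Growth N' w' := by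
    intro n
    induction n with
    | zero => exact Or.inl ⟨N, by simpa using h⟩
    | succ n ih =>
      rcases ih with ⟨N', h'⟩ | h'
      · by_cases hlt : ω - n * (δ / 2) < w
        · exact Or.inr ⟨N', _, hlt, h'⟩
        · rw [not_lt] at hlt
          have hnn : 0 ≤ (n : ℝ) * (δ / 2) := by positivity
          obtain ⟨h1, h2⟩ := hp h' (v := ω - n * (δ / 2) + δ / 2) (by linarith) (by linarith)
            (by linarith)
          have h3 := h.of_norm_orbit_le hN hω (by linarith) ht1 hδ (norm_orbit_gpTime_le h1 h2)
          refine Or.inl ⟨2 * N * Real.exp (ω * t₀), ?_⟩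
          convert h3 using 1
          push_cast
          ring
      · exact Or.inr h'
  obtain ⟨N', w', hw', h'⟩ : ∃ N' w', w' < w ∧ T.Growth N' w' := by
    obtain ⟨n, hn⟩ := exists_nat_gt ((ω - w) / (δ / 2))
    rw [div_lt_iff₀ (by positivity)] at hn
    rcases hstep n with ⟨N', h'⟩ | h'
    · exact ⟨N', _, by linarith, h'⟩
    · exact h'
  obtain ⟨-, h2⟩ := hp h' hw' le_rfl hwω
  intro x t ht
  have h3 := Real.sqrt_le_sqrt (h2 x t ht)
  rw [Real.sqrt_sq (by positivity), Real.sqrt_mul (gpBound_nonneg N ω M),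
    Real.sqrt_sq (norm_nonneg _), neg_mul, Real.exp_neg, inv_mul_le_iff₀ (Real.exp_pos _)] at h3
  linarith

end C0Semigroup

end GearhartPruss

end ZKLine

/-! ### Local compactness by cell averages. -/

namespace ZKLine

open Polynomial (X C)
open scoped Polynomial ComplexConjugate

/-! ### Restriction to intervals and a Poincaré inequality -/

lemma norm_sq_eq_integral (u : L2) : ‖u‖ ^ 2 = ∫ x, ‖u x‖ ^ 2 := by
  rw [integral_norm_sq_eq (Lp.memLp u), Lp.toLp_coeFn]

lemma integrable_norm_sq (u : L2) : Integrable (fun x => ‖u x‖ ^ 2) :=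
  (Lp.memLp u).integrable_norm_pow (by norm_num)

/-- Restriction of functions to a set, as an operator on `L²(ℝ)`. -/
def indOp (S : Set ℝ) : L2 →L[ℂ] L2 := mulOp (S.indicator 1)

lemma bddMeas_indicator {S : Set ℝ} (hS : MeasurableSet S) : BddMeas (S.indicator 1) := by
  refine ⟨measurable_one.indicator hS, 1, fun x => ?_⟩
  by_cases h : x ∈ S <;> simp [h]

lemma coeFn_indOp {S : Set ℝ} (hS : MeasurableSet S) (u : L2) :
    indOp S u =ᵐ[volume] S.indicator u := by
  filter_upwards [coeFn_mulOp (bddMeas_indicator hS) u] with x hx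
  rw [indOp, hx]
  by_cases h : x ∈ S <;> simp [h]

lemma indOp_eq_self {S : Set ℝ} (hS : MeasurableSet S) {u : L2} (h : ∀ᵐ x, x ∉ S → u x = 0) :
    indOp S u = u := by
  refine Lp.ext ?_
  filter_upwards [coeFn_indOp hS u, h] with x hx h
  rw [hx]
  by_cases hx : x ∈ S
  · simp [hx]
  · simp [hx, h hx]

lemma indOp_eq_zero {S : Set ℝ} (hS : MeasurableSet S) (u : L2) :
    ∀ᵐ x, x ∉ S → indOp S u x = 0 := by
  filter_upwards [coeFn_indOp hS u] with x hx h
  simp [hx, h]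

lemma inner_indOp_left {S : Set ℝ} (hS : MeasurableSet S) (u v : L2) :
    inner ℂ (indOp S u) v = inner ℂ u (indOp S v) := by
  rw [indOp, inner_mulOp_left (bddMeas_indicator hS)]
  congr 3
  ext x
  by_cases h : x ∈ S <;> simp [h]

lemma norm_indOp_sq {S : Set ℝ} (hS : MeasurableSet S) (u : L2) :
    ‖indOp S u‖ ^ 2 = ∫ x, S.indicator (fun x => ‖u x‖ ^ 2) x := by
  rw [norm_sq_eq_integral]
  refine integral_congr_ae ?_
  filter_upwards [coeFn_indOp hS u] with x hx
  rw [hx]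
  by_cases h : x ∈ S <;> simp [h]

/-- The indicator function of the interval `[a, b)`, as an element of `L²(ℝ)`. -/
def chi (a b : ℝ) : L2 := indicatorConstLp 2 (measurableSet_Ico (a := a) (b := b)) (by simp) (1 : ℂ)

lemma inner_chi {a b : ℝ} (u : L2) : inner ℂ (chi a b) u = ∫ x in Set.Ico a b, u x :=
  L2.inner_indicatorConstLp_one _ _ _

lemma norm_chi_sq {a b : ℝ} (h : a ≤ b) : ‖chi a b‖ ^ 2 = b - a := by
  rw [chi, norm_indicatorConstLp (by norm_num) (by norm_num)]
  have h2 : ((b - a) ^ (1 / 2 : ℝ)) ^ 2 = b - a := by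
    rw [← Real.sqrt_eq_rpow, Real.sq_sqrt (sub_nonneg.2 h)]
  simpa [measureReal_def, h] using h2

lemma chi_eq_zero (a b : ℝ) : ∀ᵐ x, x ∉ Set.Ico a b → chi a b x = 0 := by
  filter_upwards [indicatorConstLp_coeFn (p := 2) (hs := measurableSet_Ico (a := a) (b := b))
    (hμs := by simp) (c := (1 : ℂ)) (μ := volume)] with x hx h
  rw [chi, hx, Set.indicator_of_notMem h]

lemma integrable_of_support {a b : ℝ} {g : L2} (hg : ∀ᵐ x, x ∉ Set.Ico a b → g x = 0) :
    Integrable g := by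
  have h : IntegrableOn g (Set.Ico a b) :=
    ((Lp.memLp g).restrict (Set.Ico a b)).integrable (by norm_num)
  refine ((integrable_indicator_iff measurableSet_Ico).2 h).congr ?_
  filter_upwards [hg] with x hx
  by_cases h : x ∈ Set.Ico a b
  · simp [h]
  · simp [h, hx h]

lemma setIntegral_eq_inner_chi {a b : ℝ} {g : L2} (hg : ∀ᵐ x, x ∉ Set.Ico a b → g x = 0) (x : ℝ) :
    ∃ y, ∫ t in Set.Iic x, g t = inner ℂ (chi a y) g ∧
      ‖chi a y‖ ^ 2 ≤ max (b - a) 0 := by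
  refine ⟨min x b, ?_, ?_⟩
  · rw [inner_chi, ← integral_indicator measurableSet_Iic, ← integral_indicator measurableSet_Ico]
    refine integral_congr_ae ?_
    filter_upwards [hg, Measure.ae_ne volume x] with t ht htx
    by_cases h1 : t ∈ Set.Ico a b
    · by_cases h2 : t ≤ x
      · rw [Set.indicator_of_mem (Set.mem_Iic.2 h2), Set.indicator_of_mem]
        exact ⟨h1.1, lt_min (lt_of_le_of_ne h2 htx) h1.2⟩
      · rw [Set.indicator_of_notMem (by simpa using h2), Set.indicator_of_notMem]
        rintro ⟨-, h3⟩
        exact h2 (h3.le.trans (min_le_left _ _))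
    · simp [Set.indicator, ht h1]
  · rcases le_total a (min x b) with h | h
    · rw [norm_chi_sq h]
      exact (sub_le_sub_right (min_le_right _ _) _).trans (le_max_left _ _)
    · have : chi a (min x b) = 0 := by
        rw [chi]
        have : Set.Ico a (min x b) = ∅ := Set.Ico_eq_empty (not_lt.2 h)
        simp only [this, indicatorConstLp_empty]
      rw [this]
      simp

/-- Fubini, together with ∫_t^∞ f' = -f(t) for a Schwartz function. -/
lemma integral_deriv_mul_primitive {g : ℝ → ℂ} (hg : Integrable g) (f : 𝓢(ℝ, ℂ)) :
    ∫ x, deriv f x * ∫ t in Set.Iic x, g t = -∫ x, f x * g x := by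
  have hf' : Integrable (deriv f) := (SchwartzMap.derivCLM ℂ ℂ f).integrable
  have h1 : ∀ x, deriv f x * ∫ t in Set.Iic x, g t =
      ∫ t, (Set.Iic x).indicator (fun t => deriv f x * g t) t := by
    intro x
    rw [integral_indicator measurableSet_Iic, integral_const_mul]
  have hint : Integrable (Function.uncurry fun x t =>
      (Set.Iic x).indicator (fun t => deriv f x * g t) t) (volume.prod volume) := by
    have h2 := (hf'.mul_prod hg).indicator (measurableSet_le measurable_snd measurable_fst)
    refine h2.congr (ae_of_all _ ?_)
    rintro ⟨x, t⟩
    by_cases h : t ≤ x <;> simp [Function.uncurry, Set.indicator, h]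
  simp_rw [h1]
  rw [integral_integral_swap hint, ← integral_neg]
  refine integral_congr_ae (ae_of_all _ fun t => ?_)
  have h3 : ∀ x, (Set.Iic x).indicator (fun t => deriv f x * g t) t =
      (Set.Ici t).indicator (fun x => deriv f x * g t) x := by
    intro x
    by_cases h : t ≤ x <;> simp [Set.indicator, h]
  simp_rw [h3]
  rw [integral_indicator measurableSet_Ici, integral_mul_const, integral_Ici_eq_integral_Ioi,
    integral_Ioi_of_hasDerivAt_of_tendsto (m := 0) f.continuous.continuousWithinAt
      (fun x _ => f.differentiableAt.hasDerivAt) hf'.integrableOn]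
  · ring
  · exact (f.toZeroAtInfty.zero_at_infty').mono_left atTop_le_cocompact

/-- Mean zero makes the primitive vanish beyond b as well as before a. Cauchy–Schwarz bounds its
supremum by √(b-a)‖g‖, and integrating over the interval costs another √(b-a). -/
lemma exists_primitive {a b : ℝ} (hab : a ≤ b) {g : L2} (hg : ∀ᵐ x, x ∉ Set.Ico a b → g x = 0)
    (h0 : ∫ x, g x = 0) :
    ∃ ψ : L2, IsWeakDeriv ψ g ∧ ‖ψ‖ ≤ (b - a) * ‖g‖ ∧ ∀ᵐ x, x ∉ Set.Ico a b → ψ x = 0 := by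
  have hgi := integrable_of_support hg
  have hs := sub_nonneg.2 hab
  set G : ℝ → ℂ := fun x => ∫ t in Set.Iic x, g t with hG
  have hGc : Continuous G := by
    have : G = fun x => G a + ∫ t in a..x, g t := by
      funext x
      rw [← intervalIntegral.integral_Iic_sub_Iic hgi.integrableOn hgi.integrableOn]
      simp [hG]
    rw [this]
    exact continuous_const.add (intervalIntegral.continuous_primitive
      (fun _ _ => hgi.intervalIntegrable) a)
  have hGb : ∀ x, ‖G x‖ ≤ √(b - a) * ‖g‖ := by
    intro x
    obtain ⟨y, h1, h2⟩ := setIntegral_eq_inner_chi hg x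
    rw [hG]
    simp only [h1]
    refine (norm_inner_le_norm _ _).trans (mul_le_mul_of_nonneg_right ?_ (norm_nonneg _))
    rw [max_eq_left hs] at h2
    exact Real.le_sqrt_of_sq_le h2
  have hG0 : ∀ x, x ∉ Set.Ico a b → G x = 0 := by
    intro x hx
    simp only [hG]
    rw [← integral_indicator measurableSet_Iic]
    rcases lt_or_ge x a with h | h
    · refine integral_eq_zero_of_ae ?_
      filter_upwards [hg] with t ht
      by_cases h2 : t ≤ x
      · simp [h2, ht fun h3 => by linarith [h3.1]]
      · simp [h2]
    · have hbx : b ≤ x := by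
        by_contra h3
        exact hx ⟨h, not_le.1 h3⟩
      rw [← h0]
      refine integral_congr_ae ?_
      filter_upwards [hg] with t ht
      by_cases h2 : t ≤ x
      · simp [h2]
      · simp [h2, ht fun h3 => by linarith [h3.2]]
  set χ : L2 := ((√(b - a) * ‖g‖ : ℝ) : ℂ) • chi a b
  have hle : ∀ᵐ x, ‖G x‖ ≤ ‖χ x‖ := by
    filter_upwards [Lp.coeFn_smul ((√(b - a) * ‖g‖ : ℝ) : ℂ) (chi a b),
      indicatorConstLp_coeFn (p := 2) (hs := measurableSet_Ico (a := a) (b := b))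
      (hμs := by simp) (c := (1 : ℂ)) (μ := volume)] with x hx h
    rw [hx, Pi.smul_apply, chi, h]
    by_cases h2 : x ∈ Set.Ico a b
    · rw [Set.indicator_of_mem h2, norm_smul, norm_one, mul_one, Complex.norm_real,
        Real.norm_of_nonneg (by positivity)]
      exact hGb x
    · rw [hG0 x h2, norm_zero]
      exact norm_nonneg _
  have hmem : MemLp G 2 volume := (Lp.memLp χ).of_le hGc.aestronglyMeasurable hle
  refine ⟨hmem.toLp G, ?_, ?_, ?_⟩
  · rw [isWeakDeriv_iff_integral]
    intro f
    rw [← integral_deriv_mul_primitive hgi f]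
    refine integral_congr_ae ?_
    filter_upwards [hmem.coeFn_toLp] with x hx
    rw [hx]
  · have h1 : ‖hmem.toLp G‖ ≤ ‖χ‖ := by
      refine Lp.norm_le_norm_of_ae_le ?_
      filter_upwards [hmem.coeFn_toLp, hle] with x hx h
      rwa [hx]
    refine h1.trans (le_of_eq ?_)
    have h2 : ‖chi a b‖ = √(b - a) := by
      rw [← norm_chi_sq hab, Real.sqrt_sq (norm_nonneg _)]
    rw [norm_smul, h2, Complex.norm_real, Real.norm_of_nonneg (by positivity)]
    rw [mul_right_comm, Real.mul_self_sqrt hs]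
  · filter_upwards [hmem.coeFn_toLp] with x hx h
    rw [hx, hG0 x h]

/-- Poincaré's inequality by duality. Let g be z minus its mean on the interval and ψ its primitive,
supported there. Then ‖g‖² = ⟨g, z⟩ = -⟨ψ, z'⟩ ≤ (b-a)‖g‖ times the local norm of z', and no
boundary values of z appear. -/
lemma norm_indOp_sq_le {a b : ℝ} (hab : a < b) {z z' : L2} (h : IsWeakDeriv z z') :
    ‖indOp (Set.Ico a b) z‖ ^ 2 ≤ (b - a) ^ 2 * ‖indOp (Set.Ico a b) z'‖ ^ 2 +
      (b - a)⁻¹ * ‖inner ℂ (chi a b) z‖ ^ 2 := by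
  have hs : 0 < b - a := sub_pos.2 hab
  have hI : MeasurableSet (Set.Ico a b) := measurableSet_Ico
  set J := indOp (Set.Ico a b)
  set χ := chi a b
  have hχ : J χ = χ := indOp_eq_self hI (chi_eq_zero a b)
  have hχn : inner ℂ χ χ = ((b - a : ℝ) : ℂ) := by
    rw [inner_self_eq_norm_sq_to_K]
    rw [← norm_chi_sq hab.le]
    norm_cast
  set m : ℂ := ((b - a : ℝ) : ℂ)⁻¹ * inner ℂ χ z
  set g : L2 := J z - m • χ
  have hJz : inner ℂ χ (J z) = inner ℂ χ z := by rw [← inner_indOp_left hI, hχ]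
  have hχg : inner ℂ χ g = 0 := by
    rw [inner_sub_right, inner_smul_right, hχn, hJz]
    have : ((b - a : ℝ) : ℂ) ≠ 0 := by exact_mod_cast hs.ne'
    field_simp
    simp only [m]
    field_simp
    ring
  have hg0 : ∀ᵐ x, x ∉ Set.Ico a b → g x = 0 := by
    filter_upwards [indOp_eq_zero hI z, chi_eq_zero a b, Lp.coeFn_sub (J z) (m • χ),
      Lp.coeFn_smul m χ] with x h1 h2 h3 h4 hx
    rw [h3, Pi.sub_apply, h4, Pi.smul_apply, h1 hx, h2 hx]
    simp
  have hJg : J g = g := indOp_eq_self hI hg0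
  have hint : ∫ x, g x = 0 := by
    rw [← hχg, inner_chi, ← integral_indicator hI]
    refine integral_congr_ae ?_
    filter_upwards [hg0] with x hx
    by_cases h : x ∈ Set.Ico a b
    · simp only [Set.indicator_of_mem h]
    · simp only [Set.indicator_of_notMem h]
      exact hx h
  obtain ⟨ψ, hψ, hψn, hψ0⟩ := exists_primitive hab.le hg0 hint
  have hJψ : J ψ = ψ := indOp_eq_self hI hψ0
  have e1 : inner ℂ g (J z) = -inner ℂ ψ (J z') := by
    rw [← inner_indOp_left hI, ← inner_indOp_left hI]
    change inner ℂ (J g) z = -inner ℂ (J ψ) z'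
    rw [hJg, hJψ, hψ.inner_eq h]
  have hgχ : inner ℂ g χ = 0 := by rw [← inner_conj_symm, hχg, map_zero]
  have e2 : inner ℂ g (J z) = inner ℂ g g := by
    have : J z = g + m • χ := by simp [g]
    rw [this, inner_add_right, inner_smul_right, hgχ]
    simp
  have hgn : ‖g‖ ^ 2 ≤ (b - a) * ‖g‖ * ‖J z'‖ := by
    have h3 : ‖g‖ ^ 2 = ‖inner ℂ g g‖ := by
      rw [inner_self_eq_norm_sq_to_K]
      simp
    rw [h3, ← e2, e1, norm_neg]
    exact (norm_inner_le_norm _ _).trans (mul_le_mul_of_nonneg_right hψn (norm_nonneg _))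
  have hgn' : ‖g‖ ≤ (b - a) * ‖J z'‖ := by
    rcases (norm_nonneg g).eq_or_lt with h0 | h0
    · rw [← h0]; positivity
    · nlinarith
  have hpy : ‖J z‖ ^ 2 = ‖g‖ ^ 2 + ‖m • χ‖ ^ 2 := by
    have h4 := norm_add_sq_eq_norm_sq_add_norm_sq_of_inner_eq_zero g (m • χ)
      (by rw [inner_smul_right, hgχ, mul_zero] : inner ℂ g (m • χ) = 0)
    have h5 : J z = g + m • χ := by simp [g]
    rw [h5]
    nlinarith
  have hm : ‖m • χ‖ ^ 2 = (b - a)⁻¹ * ‖inner ℂ χ z‖ ^ 2 := by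
    rw [norm_smul, mul_pow, norm_chi_sq hab.le]
    simp only [m, norm_mul, norm_inv, Complex.norm_real, Real.norm_of_nonneg hs.le]
    field_simp
  rw [hpy, hm, ← mul_pow]
  gcongr

/-! ### The localised quadratic form is small up to finite rank -/

lemma mem_cell_iff {h : ℝ} (hh : 0 < h) (k : ℤ) (x : ℝ) :
    x ∈ Set.Ico (k * h) ((k + 1) * h) ↔ ⌊x / h⌋ = k := by
  rw [Int.floor_eq_iff, le_div_iff₀ hh, div_lt_iff₀ hh, Set.mem_Ico]

lemma sum_cell_indicator {h : ℝ} (hh : 0 < h) (F : Finset ℤ) (f : ℝ → ℝ) (x : ℝ) :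
    ∑ k ∈ F, (Set.Ico (k * h) ((k + 1) * h)).indicator f x = if ⌊x / h⌋ ∈ F then f x else 0 := by
  classical
  simp only [Set.indicator, mem_cell_iff hh, Finset.sum_ite_eq]

lemma sum_norm_indOp_sq {h : ℝ} (hh : 0 < h) (F : Finset ℤ) (w : L2) :
    ∑ k ∈ F, ‖indOp (Set.Ico (k * h) ((k + 1) * h)) w‖ ^ 2 =
      ∫ x, if ⌊x / h⌋ ∈ F then ‖w x‖ ^ 2 else 0 := by
  simp_rw [norm_indOp_sq measurableSet_Ico]
  rw [← integral_finsetSum _ fun k _ => (integrable_norm_sq w).indicator measurableSet_Ico]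
  simp_rw [sum_cell_indicator hh]

lemma integrable_ite_floor {h : ℝ} (hh : 0 < h) (F : Finset ℤ) (w : L2) :
    Integrable fun x => if ⌊x / h⌋ ∈ F then ‖w x‖ ^ 2 else 0 := by
  simp_rw [← sum_cell_indicator hh F (fun x => ‖w x‖ ^ 2)]
  exact integrable_finsetSum _ fun k _ => (integrable_norm_sq w).indicator measurableSet_Ico

lemma tendsto_theta_sq {c : ℝ} (hc : 0 < c) :
    Tendsto (fun x => 1 - theta c x ^ 2) (cocompact ℝ) (𝓝 0) := by
  have h1 : ∀ x, 1 - theta c x ^ 2 = (Real.cosh (√c * x / 2) ^ 2)⁻¹ := fun x => one_sub_tanh_sq _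
  have h2 : Tendsto (fun y : ℝ => (Real.cosh y ^ 2)⁻¹) (cocompact ℝ) (𝓝 0) := by
    refine Tendsto.inv_tendsto_atTop ?_
    refine tendsto_atTop_mono (fun y => ?_) (tendsto_norm_cocompact_atTop (E := ℝ))
    have h3 : |y| ≤ Real.cosh y := by
      have := Real.add_one_le_exp |y|
      rw [← Real.cosh_abs, Real.cosh_eq]
      have h4 := Real.quadratic_le_exp_of_nonneg (abs_nonneg y)
      nlinarith [Real.exp_pos (-|y|), sq_nonneg (|y| - 1)]
    rw [Real.norm_eq_abs]
    nlinarith [Real.one_le_cosh y]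
  simp_rw [h1]
  refine h2.comp ?_
  have : (fun x : ℝ => √c * x / 2) = fun x => (√c / 2) * x := by funext x; ring
  rw [this]
  exact (Homeomorph.mulLeft₀ (√c / 2) (by positivity)).isClosedEmbedding.tendsto_cocompact

/-- Let z = (1 - θ²)u. Outside finitely many cells of length h the factor 1 - θ² is small; inside,
Poincaré's inequality bounds z by h times z' up to the cell averages, which constitute the finite
rank part. -/
lemma exists_locForm_le {c : ℝ} (hc : 0 < c) {δ : ℝ} (hδ : 0 < δ) :
    ∃ (ι : Type) (_ : Fintype ι) (ψ : ι → L2), ∀ u u' : L2, IsWeakDeriv u u' →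
      locForm c u ≤ δ * (locForm c u' + ‖u‖ ^ 2) + ∑ i, ‖inner ℂ (ψ i) u‖ ^ 2 := by
  set η : ℝ := δ / 3
  have hη : 0 < η := by positivity
  -- Chosen so that the Poincaré factor h² times the constant 2c + 2 in the bound for ‖z'‖² equals
  -- η². Three errors of size η appear in all, hence η = δ/3.
  set h : ℝ := η / √(2 * c + 2)
  have hh : 0 < h := by positivity
  have hh2 : h ^ 2 * (2 * c + 2) = η ^ 2 := by
    simp only [h]
    rw [div_pow, Real.sq_sqrt (by positivity)]
    field_simp
  obtain ⟨F, hF⟩ : ∃ F : Finset ℤ, ∀ x, ⌊x / h⌋ ∉ F → 1 - theta c x ^ 2 ≤ η := by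
    have h1 := (tendsto_theta_sq hc).eventually (gt_mem_nhds hη)
    obtain ⟨r, hr⟩ := Metric.closedBall_compl_subset_of_mem_cocompact h1 0
    refine ⟨Finset.Icc ⌊-r / h⌋ ⌊r / h⌋, fun x hx => ?_⟩
    have h2 : x ∈ (Metric.closedBall (0 : ℝ) r)ᶜ := by
      intro h3
      rw [mem_closedBall_zero_iff, Real.norm_eq_abs, abs_le] at h3
      refine hx (Finset.mem_Icc.2 ⟨Int.floor_le_floor ?_, Int.floor_le_floor ?_⟩)
      · exact div_le_div_of_nonneg_right h3.1 hh.le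
      · exact div_le_div_of_nonneg_right h3.2 hh.le
    exact le_of_lt (hr h2)
  set p : ℝ[X] := 1 - X ^ 2
  -- The scaling (ηh)^{-1/2} absorbs the factors η⁻¹ and h⁻¹, and multiplication by 1 - θ² is moved
  -- from u to the cell indicator by symmetry.
  refine ⟨F, inferInstance, fun k => ((√(η * h))⁻¹ : ℂ) •
    thetaMul c p (chi (k * h) ((k + 1) * h)), fun u u' hu => ?_⟩
  have hz := hu.thetaMul c p
  set z := thetaMul c p u
  set z' := thetaMul c (polyD c p) u + thetaMul c p u'
  -- Pointwise 1 - θ² ≤ η + (1 - θ²)²/η, which trades the form for ‖z‖².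
  have s1 : locForm c u ≤ η * ‖u‖ ^ 2 + η⁻¹ * ‖z‖ ^ 2 := by
    have : locForm c u ≤ thetaForm c (C η + C η⁻¹ * p ^ 2) u := by
      refine thetaForm_mono c (fun y hy => ?_) u
      have e : (C η + C η⁻¹ * p ^ 2).eval y - p.eval y =
          η⁻¹ * ((η - p.eval y / 2) ^ 2 + 3 / 4 * p.eval y ^ 2) := by
        simp
        field_simp
        ring
      have : 0 ≤ η⁻¹ * ((η - p.eval y / 2) ^ 2 + 3 / 4 * p.eval y ^ 2) := by positivity
      change p.eval y ≤ _
      linarith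
    rwa [thetaForm_add, thetaForm_C_mul, thetaForm_C, ← norm_thetaMul_sq] at this
  have s2 : ‖z‖ ^ 2 ≤ η ^ 2 * ‖u‖ ^ 2 +
      ∑ k ∈ F, ‖indOp (Set.Ico (k * h) ((k + 1) * h)) z‖ ^ 2 := by
    rw [sum_norm_indOp_sq hh, norm_sq_eq_integral, norm_sq_eq_integral, ← integral_const_mul,
      ← integral_add ((integrable_norm_sq u).const_mul _) (integrable_ite_floor hh F z)]
    refine integral_mono_ae (integrable_norm_sq z)
      (((integrable_norm_sq u).const_mul _).add (integrable_ite_floor hh F z)) ?_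
    filter_upwards [coeFn_thetaMul c p u] with x hx
    by_cases hxF : ⌊x / h⌋ ∈ F
    · simp only [hxF, if_true]
      have : 0 ≤ η ^ 2 * ‖u x‖ ^ 2 := by positivity
      linarith
    · simp only [hxF, if_false, add_zero]
      rw [hx, norm_mul, mul_pow]
      have h1 : thetaPoly c p x = 1 - theta c x ^ 2 := by simp [thetaPoly, p]
      have h2 := theta_sq_lt_one c x
      have h3 := hF x hxF
      rw [Complex.norm_real, h1, Real.norm_of_nonneg (by linarith)]
      gcongr
  have s3 : ∀ k : ℤ, ‖indOp (Set.Ico (k * h) ((k + 1) * h)) z‖ ^ 2 ≤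
      h ^ 2 * ‖indOp (Set.Ico (k * h) ((k + 1) * h)) z'‖ ^ 2 +
        h⁻¹ * ‖inner ℂ (chi (k * h) ((k + 1) * h)) z‖ ^ 2 := by
    intro k
    have h1 := norm_indOp_sq_le (a := k * h) (b := (k + 1) * h) (by linarith) hz
    have h2 : ((k : ℝ) + 1) * h - k * h = h := by ring
    rwa [h2] at h1
  have s4 : ∑ k ∈ F, ‖indOp (Set.Ico (k * h) ((k + 1) * h)) z'‖ ^ 2 ≤ ‖z'‖ ^ 2 := by
    rw [sum_norm_indOp_sq hh, norm_sq_eq_integral]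
    refine integral_mono (integrable_ite_floor hh F z') (integrable_norm_sq z') fun x => ?_
    dsimp only
    split_ifs
    · exact le_rfl
    · positivity
  have s5 : ‖z'‖ ^ 2 ≤ (2 * c + 2) * (locForm c u' + ‖u‖ ^ 2) := by
    have h1 : ‖z'‖ ^ 2 ≤ 2 * ‖thetaMul c (polyD c p) u‖ ^ 2 + 2 * ‖thetaMul c p u'‖ ^ 2 := by
      have := norm_add_le (thetaMul c (polyD c p) u) (thetaMul c p u')
      have h2 := pow_le_pow_left₀ (norm_nonneg _) this 2
      nlinarith [sq_nonneg (‖thetaMul c (polyD c p) u‖ - ‖thetaMul c p u'‖)]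
    have h2 : ‖thetaMul c (polyD c p) u‖ ^ 2 ≤ c * ‖u‖ ^ 2 := by
      rw [norm_thetaMul_sq, ← thetaForm_C]
      refine thetaForm_mono c (fun y hy => ?_) u
      have h3 : y ^ 2 ≤ 1 := by nlinarith [hy.1, hy.2]
      have e : (polyD c p ^ 2).eval y = c * ((1 - y ^ 2) ^ 2 * y ^ 2) := by
        simp [polyD, p]
        have := Real.sq_sqrt hc.le
        linear_combination ((1 - y ^ 2) ^ 2 * y ^ 2) * this
      rw [e, Polynomial.eval_C]
      have h4 : (1 - y ^ 2) ^ 2 * y ^ 2 ≤ 1 := by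
        have : (1 - y ^ 2) ^ 2 ≤ 1 := by nlinarith [sq_nonneg y]
        nlinarith [sq_nonneg y]
      nlinarith
    have h3 : ‖thetaMul c p u'‖ ^ 2 ≤ locForm c u' := by
      rw [norm_thetaMul_sq]
      refine thetaForm_mono c (fun y hy => ?_) u'
      have h3 : y ^ 2 ≤ 1 := by nlinarith [hy.1, hy.2]
      simp [p]
      nlinarith [sq_nonneg y]
    nlinarith [locForm_nonneg c u', sq_nonneg ‖u‖]
  have s6 : ∑ k ∈ F, ‖indOp (Set.Ico (k * h) ((k + 1) * h)) z‖ ^ 2 ≤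
      η ^ 2 * (locForm c u' + ‖u‖ ^ 2) +
        h⁻¹ * ∑ k ∈ F, ‖inner ℂ (chi (k * h) ((k + 1) * h)) z‖ ^ 2 := by
    refine (Finset.sum_le_sum fun k _ => s3 k).trans ?_
    rw [Finset.sum_add_distrib, ← Finset.mul_sum, ← Finset.mul_sum]
    have := mul_le_mul_of_nonneg_left (s4.trans s5) (sq_nonneg h)
    rw [← mul_assoc, hh2] at this
    linarith
  have s7 : ∑ k : F, ‖inner ℂ (((√(η * h))⁻¹ : ℂ) •
      thetaMul c p (chi ((k : ℤ) * h) (((k : ℤ) + 1) * h))) u‖ ^ 2 =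
      η⁻¹ * (h⁻¹ * ∑ k ∈ F, ‖inner ℂ (chi (k * h) ((k + 1) * h)) z‖ ^ 2) := by
    rw [Finset.sum_coe_sort F (fun k : ℤ => ‖inner ℂ (((√(η * h))⁻¹ : ℂ) •
      thetaMul c p (chi (k * h) ((k + 1) * h))) u‖ ^ 2), ← mul_assoc, Finset.mul_sum]
    refine Finset.sum_congr rfl fun k _ => ?_
    rw [inner_smul_left, inner_thetaMul_left, norm_mul, mul_pow, RCLike.norm_conj, norm_inv,
      Complex.norm_real, inv_pow, Real.norm_of_nonneg (by positivity),
      Real.sq_sqrt (by positivity), mul_inv]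
  rw [s7]
  have s8 : η⁻¹ * ‖z‖ ^ 2 ≤ η * ‖u‖ ^ 2 + η * (locForm c u' + ‖u‖ ^ 2) +
      η⁻¹ * (h⁻¹ * ∑ k ∈ F, ‖inner ℂ (chi (k * h) ((k + 1) * h)) z‖ ^ 2) := by
    have h1 := mul_le_mul_of_nonneg_left (s2.trans (add_le_add_right s6 _)) (inv_nonneg.2 hη.le)
    refine h1.trans (le_of_eq ?_)
    field_simp
    ring
  have hδη : δ = 3 * η := by simp only [η]; ring
  rw [hδη]
  nlinarith [locForm_nonneg c u', sq_nonneg ‖u‖]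

end ZKLine

/-! ### The continuity method and finite rank corrections. -/

namespace ZKLine

section Family

variable {X : Type*} [NormedAddCommGroup X] [InnerProductSpace ℂ X] [CompleteSpace X]

/-! ### Perturbation of resolvents and the continuity method -/

lemma IsRes.exists_solution_add {A : X →ₗ.[ℂ] X} {z : ℂ} {R : X →L[ℂ] X} (hR : IsRes A z R)
    (T : X →L[ℂ] X) (hT : ‖T.comp R‖ < 1) (f : X) :
    ∃ u : A.domain, z • (u : X) - A u + T u = f := by
  have hu : IsUnit (1 - -(T.comp R) : X →L[ℂ] X) :=
    isUnit_one_sub_of_norm_lt_one (by rwa [norm_neg])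
  obtain ⟨U, hU⟩ := hu
  have h1 : (U * (U⁻¹ : (X →L[ℂ] X)ˣ) : X →L[ℂ] X) f = f := by simp
  set g := (U⁻¹ : (X →L[ℂ] X)ˣ).val f
  have h2 : g + T (R g) = f := by
    rw [mul_apply_eq_comp, hU] at h1
    simpa using h1
  obtain ⟨h, h3⟩ := hR.1 g
  exact ⟨⟨R g, h⟩, by rw [h3]; exact h2⟩

/-- A uniform a priori bound propagates solvability by Neumann series in steps shorter than 1/|M|;
convexity keeps the subdivided segment inside S. -/
lemma exists_solution_of_convex {A : X →ₗ.[ℂ] X} {S : Set ℂ} (hS : Convex ℝ S) {M : ℝ}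
    (hb : ∀ z ∈ S, ∀ u : A.domain, ‖(u : X)‖ ≤ M * ‖z • (u : X) - A u‖) {z₀ : ℂ} (hz₀ : z₀ ∈ S)
    (hs : ∀ f, ∃ u : A.domain, z₀ • (u : X) - A u = f) {z : ℂ} (hz : z ∈ S) (f : X) :
    ∃ u : A.domain, z • (u : X) - A u = f := by
  have step : ∀ z₁ ∈ S, (∀ f, ∃ u : A.domain, z₁ • (u : X) - A u = f) → ∀ z₂,
      ‖z₂ - z₁‖ * |M| < 1 → ∀ f, ∃ u : A.domain, z₂ • (u : X) - A u = f := by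
    intro z₁ h1 h2 z₂ h3 f
    obtain ⟨R, hR, hRM⟩ := exists_isRes h2 (hb z₁ h1)
    have h4 : ‖((z₂ - z₁) • ContinuousLinearMap.id ℂ X).comp R‖ < 1 := by
      refine lt_of_le_of_lt (ContinuousLinearMap.opNorm_le_bound _ (by positivity) fun g => ?_) h3
      change ‖(z₂ - z₁) • R g‖ ≤ _
      rw [norm_smul, mul_assoc]
      refine mul_le_mul_of_nonneg_left ((hRM g).trans ?_) (norm_nonneg _)
      exact mul_le_mul_of_nonneg_right (le_abs_self M) (norm_nonneg _)
    obtain ⟨u, hu⟩ := hR.exists_solution_add _ h4 f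
    refine ⟨u, ?_⟩
    rw [← hu]
    change _ = z₁ • (u : X) - A u + (z₂ - z₁) • (u : X)
    rw [sub_smul]
    abel
  obtain ⟨n, hn⟩ := exists_nat_gt (‖z - z₀‖ * |M|)
  have hn0 : 0 < (n : ℝ) := lt_of_le_of_lt (by positivity) hn
  have hmem : ∀ k : ℕ, k ≤ n → z₀ + ((k : ℝ) / n) • (z - z₀) ∈ S := by
    intro k hk
    have h1 : (k : ℝ) / n ≤ 1 := (div_le_one hn0).2 (by exact_mod_cast hk)
    have h2 := hS.add_smul_sub_mem hz₀ hz (t := (k : ℝ) / n) ⟨by positivity, h1⟩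
    exact h2
  have key : ∀ k : ℕ, k ≤ n → ∀ f, ∃ u : A.domain,
      (z₀ + ((k : ℝ) / n) • (z - z₀)) • (u : X) - A u = f := by
    intro k
    induction k with
    | zero => simpa using hs
    | succ k ih =>
      intro hk
      refine step _ (hmem k (by omega)) (ih (by omega)) _ ?_
      have h1 : z₀ + (((k + 1 : ℕ) : ℝ) / n) • (z - z₀) - (z₀ + ((k : ℝ) / n) • (z - z₀)) =
          (1 / n : ℝ) • (z - z₀) := by
        rw [add_sub_add_left_eq_sub, ← sub_smul]
        congr 1
        push_cast
        ring
      rw [h1, norm_smul, Real.norm_of_nonneg (by positivity), mul_assoc, one_div,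
        inv_mul_lt_iff₀ hn0, mul_one]
      exact hn
  have h := key n le_rfl f
  rwa [div_self hn0.ne', one_smul, add_sub_cancel] at h

/-! ### Affine families of operators with a common domain -/

variable {D : Submodule ℂ X}

/-- The operator `A₀ + a B` with domain `D`. -/
def famOp (A₀ B : D →ₗ[ℂ] X) (a : ℝ) : X →ₗ.[ℂ] X := ⟨D, A₀ + (a : ℂ) • B⟩

lemma famOp_apply (A₀ B : D →ₗ[ℂ] X) (a : ℝ) (u : D) :
    famOp A₀ B a u = A₀ u + (a : ℂ) • B u := rfl

variable {ι : Type} [Fintype ι]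

/-- The finite rank operator `u ↦ ∑ᵢ ⟪ψᵢ, u⟫ φᵢ`. -/
def finRank (ψ φ : ι → X) : X →L[ℂ] X := ∑ i, (innerSL ℂ (ψ i)).smulRight (φ i)

lemma finRank_apply (ψ φ : ι → X) (u : X) : finRank ψ φ u = ∑ i, (inner ℂ (ψ i) u : ℂ) • φ i := by
  simp [finRank]

/-- The operator `A₀ + a B - ∑ᵢ ⟪ψᵢ, ·⟫ φᵢ` with domain `D`. -/
def famCorr (A₀ B : D →ₗ[ℂ] X) (ψ φ : ι → X) (a : ℝ) : X →ₗ.[ℂ] X :=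
  ⟨D, A₀ + (a : ℂ) • B - (finRank ψ φ).toLinearMap ∘ₗ D.subtype⟩

lemma famCorr_apply (A₀ B : D →ₗ[ℂ] X) (ψ φ : ι → X) (a : ℝ) (u : D) :
    famCorr A₀ B ψ φ a u = A₀ u + (a : ℂ) • B u - finRank ψ φ u := rfl

variable (A₀ B : D →ₗ[ℂ] X) in
/-- A finite rank correction of the family `A₀ + a B`, `a ≥ 0`, whose resolvent exists and is
uniformly bounded on the half plane `Re λ ≥ w`. -/
structure Correction (w : ℝ) where
  ι : Type
  fintype : Fintype ι
  decEq : DecidableEq ι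
  ψ : ι → X
  φ : ι → D
  M : ℝ
  nonneg : 0 ≤ M
  bound : ∀ a : ℝ, 0 ≤ a → ∀ l : ℂ, w ≤ l.re → ∀ u : D,
    ‖(u : X)‖ ≤ M * ‖l • (u : X) - famCorr A₀ B ψ (fun i => (φ i : X)) a u‖
  surj : ∀ a : ℝ, 0 ≤ a → ∀ l : ℂ, w ≤ l.re → ∀ f, ∃ u : D,
    l • (u : X) - famCorr A₀ B ψ (fun i => (φ i : X)) a u = f

/-- The image of D under P is dense: a vector v orthogonal to it satisfies ⟨Pv, v⟩ = 0, and
coercivity gives v = 0. -/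
lemma exists_approx {P : X →L[ℂ] X} {k : ℝ} (hk : 0 < k)
    (hP : ∀ u, k * ‖u‖ ^ 2 ≤ (inner ℂ (P u) u).re) (hD : Dense (D : Set X)) (x : X) {η : ℝ}
    (hη : 0 < η) : ∃ u : D, ‖P u - x‖ < η := by
  have h : Dense ((D.map P.toLinearMap : Submodule ℂ X) : Set X) := by
    rw [Submodule.dense_iff_topologicalClosure_eq_top, Submodule.topologicalClosure_eq_top_iff,
      Submodule.eq_bot_iff]
    intro v hv
    have h1 : ∀ u : X, inner ℂ (P u) v = 0 := by
      refine hD.induction (P := fun u => inner ℂ (P u) v = 0) (fun u hu => ?_)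
        (isClosed_eq (by fun_prop) continuous_const)
      exact (Submodule.mem_orthogonal _ _).1 hv _ ⟨u, hu, rfl⟩
    have h2 := hP v
    rw [h1 v, Complex.zero_re] at h2
    have h3 : ‖v‖ ^ 2 ≤ 0 := by nlinarith
    simpa using h3
  obtain ⟨y, ⟨u, hu, rfl⟩, h1⟩ := Metric.mem_closure_iff.1 (h x) η hη
  exact ⟨⟨u, hu⟩, by rwa [← dist_eq_norm, dist_comm]⟩

/-- If Pφᵢ were equal to ψᵢ, the form would be Σ|⟨ψᵢ, u⟩|²; the subtracted term accounts for the
approximation. -/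
lemma re_inner_finRank_ge (P : X →L[ℂ] X) (ψ φ : ι → X) {η : ℝ}
    (h : ∀ i, ‖P (φ i) - ψ i‖ ≤ η) (u : X) :
    ∑ i, ‖inner ℂ (ψ i) u‖ ^ 2 - η * (∑ i, ‖ψ i‖) * ‖u‖ ^ 2 ≤
      (inner ℂ (P (finRank ψ φ u)) u).re := by
  rw [finRank_apply, map_sum, sum_inner, Complex.re_sum, mul_assoc, Finset.sum_mul,
    Finset.mul_sum, ← Finset.sum_sub_distrib]
  refine Finset.sum_le_sum fun i _ => ?_
  rw [map_smul, inner_smul_left]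
  have e : inner ℂ (P (φ i)) u = inner ℂ (ψ i) u + inner ℂ (P (φ i) - ψ i) u := by
    rw [← inner_add_left, add_sub_cancel]
  have e2 : (starRingEnd ℂ (inner ℂ (ψ i) u) * inner ℂ (ψ i) u).re = ‖inner ℂ (ψ i) u‖ ^ 2 := by
    rw [← Complex.normSq_eq_conj_mul_self, Complex.ofReal_re, Complex.normSq_eq_norm_sq]
  rw [e, mul_add, Complex.add_re, e2, sub_eq_add_neg]
  gcongr
  rw [neg_le]
  refine (neg_le_abs _).trans ((Complex.abs_re_le_norm _).trans ?_)
  rw [norm_mul, RCLike.norm_conj]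
  have h1 : ‖inner ℂ (ψ i) u‖ ≤ ‖ψ i‖ * ‖u‖ := norm_inner_le_norm _ _
  have h2 : ‖inner ℂ (P (φ i) - ψ i) u‖ ≤ η * ‖u‖ :=
    (norm_inner_le_norm _ _).trans (mul_le_mul_of_nonneg_right (h i) (norm_nonneg _))
  calc _ ≤ (‖ψ i‖ * ‖u‖) * (η * ‖u‖) := mul_le_mul h1 h2 (norm_nonneg _) (by positivity)
    _ = _ := by ring

/-- With Pφᵢ close to ψᵢ, subtracting Σ⟨ψᵢ, ·⟩φᵢ cancels the finite rank defect of the P-weighted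
form, which bounds the corrected operator below on Re l ≥ w; Im l drops out because ⟨Pu, u⟩ is real.
The φᵢ are taken in D, as the decay of the determinant for large |l| requires. Surjectivity starts
from a large real point and spreads over the half plane by continuity. -/
theorem nonempty_correction {A₀ B : D →ₗ[ℂ] X} {P : X →L[ℂ] X} {w ω l₀ : ℝ} (hw : 0 < w)
    (hD : Dense (D : Set X)) (hP : ∀ u, 1 / 2 * ‖u‖ ^ 2 ≤ (inner ℂ (P u) u).re)
    (hP0 : ∀ u, (inner ℂ (P u) u).im = 0) (ψ : ι → X)
    (hA : ∀ a : ℝ, 0 ≤ a → ∀ u : D, (inner ℂ (P (famOp A₀ B a u)) (u : X)).re ≤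
      w / 16 * ‖(u : X)‖ ^ 2 + ∑ i, ‖inner ℂ (ψ i) (u : X)‖ ^ 2)
    (hd : ∀ a : ℝ, 0 ≤ a → ∀ u : D, (inner ℂ (famOp A₀ B a u) (u : X)).re ≤ ω * ‖(u : X)‖ ^ 2)
    (hs : ∀ l ≥ l₀, ∀ a : ℝ, 0 ≤ a → ∀ f, ∃ u : D, (l : ℂ) • (u : X) - famOp A₀ B a u = f) :
    Nonempty (Correction A₀ B w) := by
  classical
  set σ := ∑ i, ‖ψ i‖
  have hσ : 0 ≤ σ := Finset.sum_nonneg fun i _ => norm_nonneg _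
  -- The approximation error is then at most w/16. With the w/16 from `hA` this leaves at least w/4
  -- of the coercivity w/2.
  set η : ℝ := w / 16 / (1 + σ)
  have hη : 0 < η := by positivity
  choose φ hφ using fun i => exists_approx (by norm_num) hP hD (ψ i) hη
  set φ' : ι → X := fun i => φ i
  have hησ : η * σ ≤ w / 16 := by
    simp only [η]
    rw [div_mul_eq_mul_div, div_le_iff₀ (by positivity)]
    nlinarith
  have hbound : ∀ a : ℝ, 0 ≤ a → ∀ l : ℂ, w ≤ l.re → ∀ u : D,
      ‖(u : X)‖ ≤ ‖P‖ * (4 / w) * ‖l • (u : X) - famCorr A₀ B ψ φ' a u‖ := by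
    intro a ha l hl u
    set f := l • (u : X) - famCorr A₀ B ψ φ' a u with hf
    have h1 := re_inner_finRank_ge P ψ φ' (fun i => (hφ i).le) (u : X)
    have h2 := hA a ha u
    have h3 := hP (u : X)
    have h4 : (inner ℂ (P f) (u : X)).re = l.re * (inner ℂ (P u) (u : X)).re -
        (inner ℂ (P (famOp A₀ B a u)) (u : X)).re + (inner ℂ (P (finRank ψ φ' u)) (u : X)).re := by
      have e : f = l • (u : X) - famOp A₀ B a u + finRank ψ φ' u := by
        rw [hf, famCorr_apply, famOp_apply]; abel
      rw [e, map_add, map_sub, map_smul, inner_add_left, inner_sub_left, inner_smul_left]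
      simp [hP0]
    have h5 : (inner ℂ (P f) (u : X)).re ≤ ‖P‖ * ‖f‖ * ‖(u : X)‖ :=
      (Complex.re_le_norm _).trans ((norm_inner_le_norm _ _).trans
        (mul_le_mul_of_nonneg_right (P.le_opNorm f) (norm_nonneg _)))
    have h6 : w * (1 / 2 * ‖(u : X)‖ ^ 2) ≤ l.re * (inner ℂ (P u) (u : X)).re :=
      mul_le_mul hl h3 (by positivity) (hw.le.trans hl)
    have h7 : η * σ * ‖(u : X)‖ ^ 2 ≤ w / 16 * ‖(u : X)‖ ^ 2 :=
      mul_le_mul_of_nonneg_right hησ (sq_nonneg _)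
    have h8 : w / 4 * ‖(u : X)‖ ^ 2 ≤ ‖P‖ * ‖f‖ * ‖(u : X)‖ := by
      nlinarith [mul_nonneg hw.le (sq_nonneg ‖(u : X)‖)]
    rcases (norm_nonneg (u : X)).eq_or_lt with h0 | h0
    · rw [← h0]; positivity
    · have h9 : w / 4 * ‖(u : X)‖ ≤ ‖P‖ * ‖f‖ := by nlinarith
      have h10 : ‖(u : X)‖ = 4 / w * (w / 4 * ‖(u : X)‖) := by field_simp
      rw [h10]
      calc _ ≤ 4 / w * (‖P‖ * ‖f‖) := mul_le_mul_of_nonneg_left h9 (by positivity)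
        _ = _ := by ring
  refine ⟨⟨ι, inferInstance, inferInstance, ψ, φ, ‖P‖ * (4 / w), by positivity, hbound, ?_⟩⟩
  intro a ha l hl f
  set K := finRank ψ φ'
  set l₁ : ℝ := max (max l₀ w) (ω + ‖K‖ + 1)
  have hl1 : ω + ‖K‖ + 1 ≤ l₁ := le_max_right _ _
  have hl2 : w ≤ l₁ := (le_max_right _ _).trans (le_max_left _ _)
  have hl3 : l₀ ≤ l₁ := (le_max_left _ _).trans (le_max_left _ _)
  have hpos : 0 < l₁ - ω := by linarith [norm_nonneg K]
  have hb : ∀ u : (famOp A₀ B a).domain, ‖(u : X)‖ ≤ (l₁ - ω)⁻¹ *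
      ‖(l₁ : ℂ) • (u : X) - famOp A₀ B a u‖ := by
    intro u
    rw [← div_eq_inv_mul, le_div_iff₀ hpos, mul_comm]
    exact norm_le_of_dissipative (hd a ha) l₁ u
  obtain ⟨R, hR, hRM⟩ := exists_isRes (hs l₁ hl3 a ha) hb
  have hKR : ‖K.comp R‖ < 1 := by
    have h1 : ‖R‖ ≤ (l₁ - ω)⁻¹ := R.opNorm_le_bound (by positivity) hRM
    refine lt_of_le_of_lt ((K.opNorm_comp_le R).trans
      (mul_le_mul_of_nonneg_left h1 (norm_nonneg _))) ?_
    rw [← div_eq_mul_inv, div_lt_one hpos]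
    linarith
  refine exists_solution_of_convex (A := famCorr A₀ B ψ φ' a) (S := {z : ℂ | w ≤ z.re})
    (convex_halfSpace_re_ge w) (fun z hz u => hbound a ha z hz u) (z₀ := (l₁ : ℂ)) hl2
    (fun g => ?_) hl f
  obtain ⟨u, hu⟩ := hR.exists_solution_add K hKR g
  have e : ∀ x y z : X, x - (y - z) = x - y + z := fun x y z => by abel
  exact ⟨u, (e _ _ _).trans hu⟩

end Family

end ZKLine

/-! ### The determinant whose zeros are the spectrum. -/

namespace ZKLine

section Det

variable {X : Type*} [NormedAddCommGroup X] [InnerProductSpace ℂ X] [CompleteSpace X]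
variable {D : Submodule ℂ X} {A₀ B : D →ₗ[ℂ] X} {w : ℝ}

/-! ### The perturbation determinant -/

open Matrix

/-- Compactness of the set of matrices with bounded entries. With it, a lower bound for the
determinant alone controls the inverse of 1 - G. -/
lemma exists_norm_adjugate_le {ι : Type} [Fintype ι] [DecidableEq ι] (r : ℝ) :
    ∃ K : ℝ, 0 ≤ K ∧ ∀ G : Matrix ι ι ℂ, (∀ i j, ‖G i j‖ ≤ r) →
      ∀ i j, ‖(1 - G).adjugate i j‖ ≤ K := by
  have hc : IsCompact (Set.pi Set.univ fun _ : ι => Set.pi Set.univ fun _ : ι =>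
      Metric.closedBall (0 : ℂ) r) :=
    isCompact_univ_pi fun _ => isCompact_univ_pi fun _ => isCompact_closedBall _ _
  have hf : Continuous fun G : Matrix ι ι ℂ => fun i j => (1 - G).adjugate i j :=
    (continuous_const.sub continuous_id).matrix_adjugate
  obtain ⟨K, hK⟩ := hc.exists_bound_of_continuousOn
    (f := fun G : ι → ι → ℂ => fun i j => (1 - Matrix.of G).adjugate i j) hf.continuousOn
  refine ⟨max K 0, le_max_right _ _, fun G hG i j => ?_⟩
  have h1 := hK G (fun i _ j _ => mem_closedBall_zero_iff.2 (hG i j))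
  exact ((norm_le_pi_norm _ j).trans (norm_le_pi_norm _ i)).trans (h1.trans (le_max_left _ _))

lemma exists_half_le_norm_det {ι : Type} [Fintype ι] [DecidableEq ι] :
    ∃ η : ℝ, 0 < η ∧ ∀ G : Matrix ι ι ℂ, (∀ i j, ‖G i j‖ < η) → 1 / 2 ≤ ‖(1 - G).det‖ := by
  have hf : Continuous fun G : ι → ι → ℂ => ‖(1 - Matrix.of G).det‖ :=
    ((continuous_const.sub continuous_id).matrix_det).norm
  have h0 : (1 / 2 : ℝ) < ‖(1 - Matrix.of (0 : ι → ι → ℂ)).det‖ := by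
    have : Matrix.of (0 : ι → ι → ℂ) = 0 := rfl
    rw [this, sub_zero, det_one, norm_one]
    norm_num
  obtain ⟨η, hη, h⟩ := Metric.mem_nhds_iff.1 (hf.continuousAt.eventually (lt_mem_nhds h0))
  refine ⟨η, hη, fun G hG => le_of_lt (h (a := fun i j => G i j) ?_)⟩
  rw [mem_ball_zero_iff, pi_norm_lt_iff hη]
  exact fun i => (pi_norm_lt_iff hη).2 fun j => hG i j

namespace Correction

attribute [instance] Correction.fintype Correction.decEq

variable (F : Correction A₀ B w)

/-- The corrected operators. -/
def op (a : ℝ) : X →ₗ.[ℂ] X := famCorr A₀ B F.ψ (fun i => (F.φ i : X)) a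

lemma op_apply (a : ℝ) (u : D) :
    F.op a u = famOp A₀ B a u - ∑ i, (inner ℂ (F.ψ i) (u : X) : ℂ) • (F.φ i : X) := by
  rw [← finRank_apply]; rfl

open Classical in
/-- The resolvent of the corrected operator. -/
def res (a : ℝ) (l : ℂ) : X →L[ℂ] X :=
  if h : ∃ R, IsRes (F.op a) l R ∧ ∀ f, ‖R f‖ ≤ F.M * ‖f‖ then h.choose else 0

lemma res_spec {a : ℝ} (ha : 0 ≤ a) {l : ℂ} (hl : w ≤ l.re) :
    IsRes (F.op a) l (F.res a l) ∧ ∀ f, ‖F.res a l f‖ ≤ F.M * ‖f‖ := by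
  have h : ∃ R, IsRes (F.op a) l R ∧ ∀ f, ‖R f‖ ≤ F.M * ‖f‖ :=
    exists_isRes (F.surj a ha l hl) (F.bound a ha l hl)
  rw [res, dif_pos h]
  exact h.choose_spec

/-- The matrix of the corrected resolvent. -/
def gram (a : ℝ) (l : ℂ) : Matrix F.ι F.ι ℂ :=
  Matrix.of fun i j => inner ℂ (F.ψ i) (F.res a l (F.φ j))

/-- The perturbation determinant. -/
def det (a : ℝ) (l : ℂ) : ℂ := (1 - F.gram a l).det

lemma exists_res {a : ℝ} (ha : 0 ≤ a) {l : ℂ} (hl : w ≤ l.re) (f : X) :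
    ∃ u : D, (u : X) = F.res a l f ∧ l • (u : X) - F.op a u = f := by
  obtain ⟨h, h1⟩ := (F.res_spec ha hl).1.1 f
  exact ⟨⟨_, h⟩, rfl, h1⟩

lemma res_apply {a : ℝ} (ha : 0 ≤ a) {l : ℂ} (hl : w ≤ l.re) (u : D) :
    F.res a l (l • (u : X) - F.op a u) = u := (F.res_spec ha hl).1.2 u

lemma norm_gram_le {a : ℝ} (ha : 0 ≤ a) {l : ℂ} (hl : w ≤ l.re) (i j : F.ι) :
    ‖F.gram a l i j‖ ≤ ‖F.ψ i‖ * (F.M * ‖(F.φ j : X)‖) :=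
  (norm_inner_le_norm _ _).trans
    (mul_le_mul_of_nonneg_left ((F.res_spec ha hl).2 _) (norm_nonneg _))

lemma eq_res {a : ℝ} (ha : 0 ≤ a) {l : ℂ} (hl : w ≤ l.re) (u : D) :
    (u : X) = F.res a l (l • (u : X) - famOp A₀ B a u) +
      ∑ j, (inner ℂ (F.ψ j) (u : X) : ℂ) • F.res a l (F.φ j) := by
  conv_lhs => rw [← F.res_apply ha hl u, op_apply]
  rw [← sub_add, map_add, map_sum]
  simp_rw [map_smul]

/-- If x is the vector of the ⟨ψᵢ, u⟩ and R the corrected resolvent, then u = Rf + Σ xⱼ Rφⱼ with f =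
(l - A)u. Pairing with the ψᵢ gives a finite linear system for x. -/
lemma one_sub_gram_mulVec {a : ℝ} (ha : 0 ≤ a) {l : ℂ} (hl : w ≤ l.re) (u : D) :
    (1 - F.gram a l) *ᵥ (fun i => inner ℂ (F.ψ i) (u : X)) =
      fun i => inner ℂ (F.ψ i) (F.res a l (l • (u : X) - famOp A₀ B a u)) := by
  rw [sub_mulVec, one_mulVec]
  ext i
  have h := congrArg (inner ℂ (F.ψ i)) (F.eq_res ha hl u)
  rw [inner_add_right, inner_sum] at h
  rw [Pi.sub_apply, sub_eq_iff_eq_add, h]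
  congr 1
  simp only [mulVec, dotProduct, gram, of_apply, inner_smul_right]
  exact Finset.sum_congr rfl fun j _ => mul_comm _ _

/-- The adjugate and the lower bound on the determinant bound the coefficients ⟨ψᵢ, u⟩ by ‖f‖, and
`eq_res` then bounds u. All constants are uniform in a and l. -/
lemma exists_norm_le {m : ℝ} (hm : 0 < m) :
    ∃ K : ℝ, 0 ≤ K ∧ ∀ a : ℝ, 0 ≤ a → ∀ l : ℂ, w ≤ l.re → m ≤ ‖F.det a l‖ → ∀ u : D,
      ‖(u : X)‖ ≤ K * ‖l • (u : X) - famOp A₀ B a u‖ := by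
  obtain ⟨r, hr⟩ : ∃ r : ℝ, ∀ i j, ‖F.ψ i‖ * (F.M * ‖(F.φ j : X)‖) ≤ r := by
    refine ⟨(∑ i, ‖F.ψ i‖) * (F.M * ∑ j, ‖(F.φ j : X)‖), fun i j => ?_⟩
    have h1 := Finset.single_le_sum (f := fun i => ‖F.ψ i‖) (fun _ _ => norm_nonneg _)
      (Finset.mem_univ i)
    have h2 := Finset.single_le_sum (f := fun j => ‖(F.φ j : X)‖) (fun _ _ => norm_nonneg _)
      (Finset.mem_univ j)
    have := F.nonneg
    gcongr
  obtain ⟨K, hK0, hK⟩ := exists_norm_adjugate_le (ι := F.ι) r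
  have hM := F.nonneg
  refine ⟨F.M + ∑ i, (m⁻¹ * ∑ j, K * (‖F.ψ j‖ * F.M)) * (F.M * ‖(F.φ i : X)‖), by positivity,
    fun a ha l hl hd u => ?_⟩
  set f := l • (u : X) - famOp A₀ B a u
  set x : F.ι → ℂ := fun i => inner ℂ (F.ψ i) (u : X)
  have hx : ∀ i, ‖x i‖ ≤ (m⁻¹ * ∑ j, K * (‖F.ψ j‖ * F.M)) * ‖f‖ := by
    intro i
    have h1 := congrArg ((1 - F.gram a l).adjugate *ᵥ ·) (F.one_sub_gram_mulVec ha hl u)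
    simp only [mulVec_mulVec, adjugate_mul, smul_mulVec, one_mulVec] at h1
    have h2 := congrFun h1 i
    rw [Pi.smul_apply, smul_eq_mul] at h2
    have h3 : ‖F.det a l‖ * ‖x i‖ ≤ ∑ j, K * (‖F.ψ j‖ * (F.M * ‖f‖)) := by
      rw [← norm_mul]
      refine (congrArg norm h2).le.trans ?_
      refine norm_sum_le_of_le _ fun j _ => ?_
      rw [norm_mul]
      refine mul_le_mul (hK _ (fun i j => (F.norm_gram_le ha hl i j).trans (hr i j)) _ _)
        ((norm_inner_le_norm _ _).trans
          (mul_le_mul_of_nonneg_left ((F.res_spec ha hl).2 _) (norm_nonneg _))) (norm_nonneg _) hK0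
    have h4 : m * ‖x i‖ ≤ ∑ j, K * (‖F.ψ j‖ * (F.M * ‖f‖)) :=
      (mul_le_mul_of_nonneg_right hd (norm_nonneg _)).trans h3
    have h5 : ∑ j, K * (‖F.ψ j‖ * (F.M * ‖f‖)) = (∑ j, K * (‖F.ψ j‖ * F.M)) * ‖f‖ := by
      rw [Finset.sum_mul]
      exact Finset.sum_congr rfl fun j _ => by ring
    rw [h5] at h4
    rw [mul_assoc, ← div_eq_inv_mul, le_div_iff₀ hm, mul_comm]
    exact h4
  have h6 : ‖(u : X)‖ ≤ F.M * ‖f‖ + ∑ i, ‖x i‖ * (F.M * ‖(F.φ i : X)‖) := by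
    conv_lhs => rw [F.eq_res ha hl u]
    refine (norm_add_le _ _).trans (add_le_add ((F.res_spec ha hl).2 _) ?_)
    refine norm_sum_le_of_le _ fun j _ => ?_
    rw [norm_smul]
    exact mul_le_mul_of_nonneg_left ((F.res_spec ha hl).2 _) (norm_nonneg _)
  refine h6.trans ?_
  rw [add_mul, Finset.sum_mul]
  refine add_le_add_right (Finset.sum_le_sum fun i _ => ?_) _
  calc ‖x i‖ * (F.M * ‖(F.φ i : X)‖) ≤ ((m⁻¹ * ∑ j, K * (‖F.ψ j‖ * F.M)) * ‖f‖) *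
        (F.M * ‖(F.φ i : X)‖) := mul_le_mul_of_nonneg_right (hx i) (by positivity)
    _ = _ := by ring

/-- A kernel vector x of 1 - `gram` gives the eigenvector u = R Σ xⱼφⱼ, nonzero because its pairings
with the ψᵢ recover x. If the determinant does not vanish, solving for the coefficients produces
preimages. -/
lemma mem_opSpectrum_iff {a : ℝ} (ha : 0 ≤ a) {l : ℂ} (hl : w ≤ l.re) :
    l ∈ opSpectrum (famOp A₀ B a) ↔ F.det a l = 0 := by
  constructor
  · intro h
    by_contra hd
    obtain ⟨K, -, hK⟩ := F.exists_norm_le (norm_pos_iff.2 hd)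
    have hsurj : ∀ f, ∃ u : D, l • (u : X) - famOp A₀ B a u = f := by
      intro f
      set b : F.ι → ℂ := fun i => inner ℂ (F.ψ i) (F.res a l f)
      set x := (1 - F.gram a l)⁻¹ *ᵥ b
      have hx : (1 - F.gram a l) *ᵥ x = b := by
        rw [mulVec_mulVec, mul_nonsing_inv _ (isUnit_iff_ne_zero.2 hd), one_mulVec]
      obtain ⟨u, hu, h1⟩ := F.exists_res ha hl (f + ∑ j, x j • (F.φ j : X))
      have hxi : ∀ i, inner ℂ (F.ψ i) (u : X) = x i := by
        intro i
        have h2 := congrFun hx i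
        rw [sub_mulVec, one_mulVec, Pi.sub_apply, sub_eq_iff_eq_add] at h2
        rw [hu, map_add, map_sum, inner_add_right, inner_sum, h2]
        congr 1
        simp only [mulVec, dotProduct, gram, of_apply, map_smul, inner_smul_right]
        exact Finset.sum_congr rfl fun j _ => mul_comm _ _
      refine ⟨u, ?_⟩
      rw [op_apply] at h1
      simp_rw [hxi] at h1
      rw [← sub_add] at h1
      exact add_right_cancel h1
    obtain ⟨R, hR, -⟩ := exists_isRes (A := famOp A₀ B a) hsurj (hK a ha l hl le_rfl)
    exact h ⟨R, hR⟩
  · rintro hd ⟨R, hR⟩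
    obtain ⟨x, hx0, hx⟩ := exists_mulVec_eq_zero_iff.2 hd
    obtain ⟨u, hu, h1⟩ := F.exists_res ha hl (∑ j, x j • (F.φ j : X))
    have hxi : ∀ i, inner ℂ (F.ψ i) (u : X) = x i := by
      intro i
      have h2 := congrFun hx i
      rw [sub_mulVec, one_mulVec, Pi.sub_apply, Pi.zero_apply, sub_eq_zero] at h2
      rw [hu, map_sum, inner_sum, h2]
      simp only [mulVec, dotProduct, gram, of_apply, map_smul, inner_smul_right]
      exact Finset.sum_congr rfl fun j _ => mul_comm _ _
    rw [op_apply] at h1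
    simp_rw [hxi] at h1
    rw [← sub_add, add_eq_right] at h1
    have h3 := hR.2 u
    change R (l • (u : X) - famOp A₀ B a u) = u at h3
    rw [h1, map_zero] at h3
    refine hx0 (funext fun i => ?_)
    rw [← hxi i, ← h3, inner_zero_right, Pi.zero_apply]

/-- The change of a and l is evaluated on the fixed vector g in D, so no bound for B composed with
the resolvent is needed. Joint strong continuity follows. -/
lemma norm_res_sub_le {a a₀ : ℝ} (ha : 0 ≤ a) (ha₀ : 0 ≤ a₀) {l l₀ : ℂ} (hl : w ≤ l.re)
    (hl₀ : w ≤ l₀.re) {f : X} {g : D} (hg : (g : X) = F.res a₀ l₀ f) :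
    ‖F.res a l f - F.res a₀ l₀ f‖ ≤ F.M * (‖l - l₀‖ * ‖(g : X)‖ + |a - a₀| * ‖B g‖) := by
  have h1 : l₀ • (g : X) - F.op a₀ g = f := by
    obtain ⟨u, hu, h⟩ := F.exists_res ha₀ hl₀ f
    have : g = u := Subtype.ext (hg.trans hu.symm)
    rwa [this]
  have h2 : l • (g : X) - F.op a g = f + (l - l₀) • (g : X) - ((a - a₀ : ℝ) : ℂ) • B g := by
    rw [← h1, op_apply, op_apply, famOp_apply, famOp_apply]
    push_cast
    simp only [sub_smul]
    abel
  have h3 := F.res_apply ha hl g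
  rw [h2, map_sub, map_add] at h3
  have h4 : F.res a l f - F.res a₀ l₀ f =
      F.res a l (((a - a₀ : ℝ) : ℂ) • B g - (l - l₀) • (g : X)) := by
    rw [map_sub, ← hg, eq_sub_of_add_eq (sub_eq_iff_eq_add.1 h3)]
    abel
  rw [h4]
  refine ((F.res_spec ha hl).2 _).trans (mul_le_mul_of_nonneg_left ?_ F.nonneg)
  refine (norm_sub_le _ _).trans (le_of_eq ?_)
  rw [norm_smul, norm_smul, Complex.norm_real, Real.norm_eq_abs, add_comm]

/-- The parameters for which the corrected resolvent is controlled. -/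
def region (w : ℝ) : Set (ℝ × ℂ) := {p | 0 ≤ p.1 ∧ w ≤ p.2.re}

lemma continuousOn_res (f : X) : ContinuousOn (fun p : ℝ × ℂ => F.res p.1 p.2 f) (region w) := by
  intro p hp
  obtain ⟨g, hg, -⟩ := F.exists_res hp.1 hp.2 f
  rw [ContinuousWithinAt, tendsto_iff_norm_sub_tendsto_zero]
  refine squeeze_zero' (Eventually.of_forall fun _ => norm_nonneg _)
    (eventually_nhdsWithin_of_forall fun q hq => F.norm_res_sub_le hq.1 hp.1 hq.2 hp.2 hg) ?_
  have hc : Continuous fun q : ℝ × ℂ => F.M * (‖q.2 - p.2‖ * ‖(g : X)‖ + |q.1 - p.1| * ‖B g‖) := by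
    fun_prop
  have := hc.tendsto p
  simp only [sub_self, norm_zero, abs_zero, zero_mul, add_zero, mul_zero] at this
  exact this.mono_left nhdsWithin_le_nhds

lemma continuousOn_det : ContinuousOn (fun p : ℝ × ℂ => F.det p.1 p.2) (region w) := by
  have h1 : ContinuousOn (fun p : ℝ × ℂ => F.gram p.1 p.2) (region w) := by
    refine continuousOn_pi.2 fun i => continuousOn_pi.2 fun j => ?_
    exact continuousOn_const.inner (F.continuousOn_res _)
  have h2 : Continuous fun G : Matrix F.ι F.ι ℂ => (1 - G).det :=
    (continuous_const.sub continuous_id).matrix_det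
  exact h2.comp_continuousOn h1

lemma hasDerivAt_res {a : ℝ} (ha : 0 ≤ a) {l : ℂ} (hl : w < l.re) (f : X) :
    HasDerivAt (fun z => F.res a z f) (-F.res a l (F.res a l f)) l := by
  obtain ⟨g, hg, h1⟩ := F.exists_res ha hl.le f
  have hnhds : ∀ᶠ z : ℂ in 𝓝 l, w < z.re :=
    Complex.continuous_re.continuousAt.eventually (lt_mem_nhds hl)
  rw [hasDerivAt_iff_tendsto_slope]
  have h2 : Tendsto (fun z => -F.res a z (F.res a l f)) (𝓝[≠] l)
      (𝓝 (-F.res a l (F.res a l f))) := by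
    have hc := (F.continuousOn_res (F.res a l f)) (a, l) ⟨ha, hl.le⟩
    refine (Tendsto.neg (hc.tendsto.comp (f := fun z : ℂ => (a, z)) ?_))
    refine tendsto_nhdsWithin_iff.2 ⟨?_, ?_⟩
    · exact (Continuous.tendsto (by fun_prop : Continuous fun z : ℂ => (a, z)) l).mono_left
        nhdsWithin_le_nhds
    · filter_upwards [nhdsWithin_le_nhds hnhds] with z hz
      exact ⟨ha, le_of_lt hz⟩
  refine h2.congr' ?_
  filter_upwards [nhdsWithin_le_nhds hnhds, self_mem_nhdsWithin] with z hz hne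
  have h3 := F.res_apply ha (le_of_lt hz) g
  have h4 : z • (g : X) - F.op a g = f + (z - l) • (g : X) := by
    rw [← h1, sub_smul]; abel
  rw [h4, map_add, map_smul] at h3
  rw [slope_def_module, ← hg, ← h3]
  have h5 : z - l ≠ 0 := sub_ne_zero.2 hne
  rw [sub_add_cancel_left, smul_neg, smul_smul, inv_mul_cancel₀ h5, one_smul, h3]

lemma differentiableAt_det {a : ℝ} (ha : 0 ≤ a) {l : ℂ} (hl : w < l.re) :
    DifferentiableAt ℂ (F.det a) l := by
  have h1 : ∀ i j, DifferentiableAt ℂ (fun z => (1 - F.gram a z) i j) l := by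
    intro i j
    have h := ((innerSL ℂ (F.ψ i)).hasFDerivAt.comp_hasDerivAt l
      (F.hasDerivAt_res ha hl (F.φ j))).differentiableAt
    exact (differentiableAt_const _).sub h
  have h2 : F.det a = fun z => ∑ σ : Equiv.Perm F.ι, ((Equiv.Perm.sign σ : ℤ) : ℂ) *
      ∏ i, (1 - F.gram a z) (σ i) i := by
    funext z
    exact det_apply' _
  rw [h2]
  refine DifferentiableAt.fun_sum fun σ _ => (differentiableAt_const _).mul ?_
  exact DifferentiableAt.fun_finsetProd fun i _ => h1 _ _

/-- Since φⱼ lies in D, l Rφⱼ = φⱼ + R(Aφⱼ) with A the corrected operator, and this is bounded for a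
≤ a₁. The matrix is thus O(1/|l|) and the determinant is close to 1. -/
lemma exists_half_le (a₁ : ℝ) :
    ∃ r : ℝ, ∀ a : ℝ, 0 ≤ a → a ≤ a₁ → ∀ l : ℂ, w ≤ l.re → r ≤ ‖l‖ → 1 / 2 ≤ ‖F.det a l‖ := by
  obtain ⟨η, hη, h⟩ := exists_half_le_norm_det (ι := F.ι)
  set k : F.ι → ℝ := fun j => ‖(F.φ j : X)‖ +
    F.M * (‖F.op 0 (F.φ j)‖ + a₁ * ‖B (F.φ j)‖)
  have hnorm : ∀ a : ℝ, 0 ≤ a → a ≤ a₁ → ∀ l : ℂ, w ≤ l.re → ∀ j,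
      ‖l‖ * ‖F.res a l (F.φ j)‖ ≤ k j := by
    intro a ha ha1 l hl j
    have h1 := F.res_apply ha hl (F.φ j)
    rw [map_sub, map_smul, sub_eq_iff_eq_add] at h1
    rw [← norm_smul, h1]
    refine (norm_add_le _ _).trans (add_le_add_right (((F.res_spec ha hl).2 _).trans
      (mul_le_mul_of_nonneg_left ?_ F.nonneg)) _)
    have h2 : F.op a (F.φ j) = F.op 0 (F.φ j) + (a : ℂ) • B (F.φ j) := by
      rw [op_apply, op_apply, famOp_apply, famOp_apply]
      simp
      abel
    rw [h2]
    refine (norm_add_le _ _).trans (add_le_add_right ?_ _)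
    rw [norm_smul, Complex.norm_real, Real.norm_of_nonneg ha]
    gcongr
  set m : ℝ := ∑ i, ∑ j, ‖F.ψ i‖ * |k j|
  have hm : 0 ≤ m := by positivity
  refine ⟨(m + 1) / η, fun a ha ha1 l hl hr => h _ fun i j => ?_⟩
  have hl0 : 0 < ‖l‖ := lt_of_lt_of_le (by positivity) hr
  have h1 : ‖F.gram a l i j‖ * ‖l‖ ≤ m := by
    calc ‖F.gram a l i j‖ * ‖l‖ ≤ (‖F.ψ i‖ * ‖F.res a l (F.φ j)‖) * ‖l‖ :=
          mul_le_mul_of_nonneg_right (norm_inner_le_norm _ _) hl0.le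
      _ = ‖F.ψ i‖ * (‖l‖ * ‖F.res a l (F.φ j)‖) := by ring
      _ ≤ ‖F.ψ i‖ * |k j| :=
          mul_le_mul_of_nonneg_left ((hnorm a ha ha1 l hl j).trans (le_abs_self _)) (norm_nonneg _)
      _ ≤ ∑ j, ‖F.ψ i‖ * |k j| :=
          Finset.single_le_sum (f := fun j => ‖F.ψ i‖ * |k j|) (fun _ _ => by positivity)
            (Finset.mem_univ j)
      _ ≤ m := Finset.single_le_sum (f := fun i => ∑ j, ‖F.ψ i‖ * |k j|)
            (fun _ _ => by positivity) (Finset.mem_univ i)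
  rw [div_le_iff₀ hη] at hr
  by_contra hcon
  rw [not_lt] at hcon
  nlinarith

end Correction

end Det

end ZKLine

/-! ### Existence of the spectral bound and uniform resolvent estimates. -/

namespace ZKLine

section Spectrum

variable {X : Type*} [NormedAddCommGroup X] [InnerProductSpace ℂ X] [CompleteSpace X]
variable {D : Submodule ℂ X} {A₀ B : D →ₗ[ℂ] X} {w : ℝ}

/-! ### The spectral bound and uniform resolvent estimates -/

/-- If l₁ is in the spectrum with Re l₁ > 0, take the correction for w = Re l₁: the spectrum in Re l
≥ Re l₁ is a closed zero set inside a bounded region, hence compact. Otherwise the maximum is 0,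
attained at the origin. -/
theorem exists_isGreatest_re_opSpectrum (hF : ∀ w : ℝ, 0 < w → Nonempty (Correction A₀ B w))
    {a : ℝ} (ha : 0 ≤ a) (h0 : (0 : ℂ) ∈ opSpectrum (famOp A₀ B a)) :
    ∃ m, IsGreatest (Complex.re '' opSpectrum (famOp A₀ B a)) m := by
  by_cases h : ∃ l ∈ opSpectrum (famOp A₀ B a), 0 < l.re
  · obtain ⟨l₁, hl₁, hpos⟩ := h
    obtain ⟨F⟩ := hF l₁.re hpos
    obtain ⟨r, hr⟩ := F.exists_half_le a
    set S : Set ℂ := Metric.closedBall 0 r ∩ {z | l₁.re ≤ z.re}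
    have hS : IsCompact S := (isCompact_closedBall _ _).inter_right
      (isClosed_le continuous_const Complex.continuous_re)
    have hcont : ContinuousOn (F.det a) S := by
      have := F.continuousOn_det.comp (f := fun z : ℂ => (a, z)) (s := S) (by fun_prop)
        (fun z hz => ⟨ha, hz.2⟩)
      exact this
    set Z : Set ℂ := S ∩ F.det a ⁻¹' {0}
    have hZ : IsCompact Z := hS.of_isClosed_subset
      (hcont.preimage_isClosed_of_isClosed hS.isClosed isClosed_singleton) Set.inter_subset_left
    have hmem : ∀ l ∈ opSpectrum (famOp A₀ B a), l₁.re ≤ l.re → l ∈ Z := by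
      intro l hl hre
      have hd := (F.mem_opSpectrum_iff ha hre).1 hl
      refine ⟨⟨mem_closedBall_zero_iff.2 ?_, hre⟩, hd⟩
      by_contra hcon
      have := hr a ha le_rfl l hre (not_le.1 hcon).le
      rw [hd, norm_zero] at this
      norm_num at this
    obtain ⟨z, hz, hmax⟩ := hZ.exists_isMaxOn ⟨l₁, hmem l₁ hl₁ le_rfl⟩
      Complex.continuous_re.continuousOn
    refine ⟨z.re, ⟨z, (F.mem_opSpectrum_iff ha hz.1.2).2 hz.2, rfl⟩, ?_⟩
    rintro _ ⟨l, hl, rfl⟩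
    rcases le_total l₁.re l.re with hre | hre
    · exact hmax (hmem l hl hre)
    · exact hre.trans hz.1.2
  · push Not at h
    refine ⟨0, ⟨0, h0, rfl⟩, ?_⟩
    rintro _ ⟨l, hl, rfl⟩
    exact h l hl

namespace Correction

variable (F : Correction A₀ B w)

/-- Identity theorem on the half plane: the determinant is not identically zero, being at least 1/2
in modulus far out on the real axis. -/
lemma eventually_det_ne_zero {a : ℝ} (ha : 0 ≤ a) {l : ℂ} (hl : w < l.re) :
    ∀ᶠ z in 𝓝[≠] l, F.det a z ≠ 0 := by
  have hU : IsOpen {z : ℂ | w < z.re} := isOpen_lt continuous_const Complex.continuous_re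
  have hd : AnalyticOnNhd ℂ (F.det a) {z : ℂ | w < z.re} :=
    DifferentiableOn.analyticOnNhd
      (fun z hz => (F.differentiableAt_det ha hz).differentiableWithinAt) hU
  by_contra hcon
  rw [not_eventually] at hcon
  have h := hd.eqOn_zero_of_preconnected_of_frequently_eq_zero
    (convex_halfSpace_re_gt w).isPreconnected hl (hcon.mono fun z hz => not_not.1 hz)
  obtain ⟨r, hr⟩ := F.exists_half_le a
  set t : ℝ := max (w + 1) |r|
  have h1 : w < (t : ℂ).re := by
    rw [Complex.ofReal_re]
    exact lt_of_lt_of_le (lt_add_one w) (le_max_left _ _)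
  have h2 : r ≤ ‖(t : ℂ)‖ := by
    rw [Complex.norm_real]
    exact (le_abs_self r).trans ((le_max_right _ _).trans (le_abs_self _))
  have h3 := hr a ha le_rfl t h1.le h2
  rw [h h1] at h3
  norm_num at h3

/-- The delicate case is a zero l₀ at a₀. On a small circle around it the determinant is bounded
below, also for a near a₀. If some point of the disc has real part at least μ(a) + 2w, then for this
a the disc contains no zero, and the maximum principle for the reciprocal carries the bound inside.
-/
lemma exists_le_norm_det_near (hw : 0 < w) {μ : ℝ → ℝ}
    (hμ : ∀ a, 0 ≤ a → ∀ l ∈ opSpectrum (famOp A₀ B a), l.re ≤ μ a) {a₀ : ℝ} (ha₀ : 0 ≤ a₀)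
    {l₀ : ℂ} (hl₀ : 2 * w ≤ l₀.re) :
    ∃ m : ℝ, 0 < m ∧ ∀ᶠ p : ℝ × ℂ in 𝓝 (a₀, l₀), 0 ≤ p.1 → 2 * w ≤ p.2.re →
      μ p.1 + 2 * w ≤ p.2.re → m ≤ ‖F.det p.1 p.2‖ := by
  have hcont : ∀ a : ℝ, 0 ≤ a → ∀ l : ℂ, w ≤ l.re → ∀ k < ‖F.det a l‖,
      ∀ᶠ p : ℝ × ℂ in 𝓝 (a, l), 0 ≤ p.1 → w ≤ p.2.re → k < ‖F.det p.1 p.2‖ := by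
    intro a ha l hl k hk
    have h1 := (F.continuousOn_det (a, l) ⟨ha, hl⟩).norm.eventually (lt_mem_nhds hk)
    filter_upwards [eventually_nhdsWithin_iff.1 h1] with p hp h2 h3 using hp ⟨h2, h3⟩
  by_cases hd : F.det a₀ l₀ = 0
  · have h1 := F.eventually_det_ne_zero ha₀ (l := l₀) (by linarith)
    rw [eventually_nhdsWithin_iff, Metric.eventually_nhds_iff] at h1
    obtain ⟨r₀, hr₀, h1⟩ := h1
    -- The circle avoids other zeros since r < r₀. The disc has diameter at most w, less than the
    -- gap 2w, and stays in Re z > w because Re l₀ ≥ 2w.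
    set r : ℝ := min (r₀ / 2) (w / 2)
    have hr : 0 < r := by positivity
    have hrw : r ≤ w / 2 := min_le_right _ _
    have hre : ∀ z ∈ Metric.closedBall l₀ r, l₀.re - r ≤ z.re := by
      intro z hz
      have h2 := (Complex.abs_re_le_norm (z - l₀)).trans (mem_closedBall_iff_norm.1 hz)
      rw [Complex.sub_re, abs_le] at h2
      linarith
    have hne : ∀ z ∈ Metric.sphere l₀ r, F.det a₀ z ≠ 0 := by
      intro z hz
      rw [Metric.mem_sphere] at hz
      refine h1 ?_ ?_
      · rw [hz]
        exact lt_of_le_of_lt (min_le_left _ _) (by linarith)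
      · rintro rfl
        rw [dist_self] at hz
        exact hr.ne hz
    have hsub : ∀ z ∈ Metric.sphere l₀ r, w ≤ z.re := fun z hz => by
      have := hre z (Metric.sphere_subset_closedBall hz)
      linarith
    obtain ⟨z₀, hz₀, hmin⟩ := (isCompact_sphere l₀ r).exists_isMinOn
      (NormedSpace.sphere_nonempty.2 hr.le) (f := fun z => ‖F.det a₀ z‖)
      ((F.continuousOn_det.comp (f := fun z : ℂ => (a₀, z)) (by fun_prop)
        (fun z hz => ⟨ha₀, hsub z hz⟩)).norm)
    set m : ℝ := ‖F.det a₀ z₀‖ / 2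
    have hm : 0 < m := half_pos (norm_pos_iff.2 (hne z₀ hz₀))
    have h3 : ∀ᶠ a in 𝓝 a₀, ∀ z ∈ Metric.sphere l₀ r, 0 ≤ a → w ≤ z.re → m < ‖F.det a z‖ := by
      refine (isCompact_sphere l₀ r).eventually_forall_of_forall_eventually fun z hz => ?_
      refine hcont a₀ ha₀ z (hsub z hz) m (lt_of_lt_of_le ?_ (hmin hz))
      exact half_lt_self (norm_pos_iff.2 (hne z₀ hz₀))
    refine ⟨m, hm, ?_⟩
    rw [nhds_prod_eq]
    filter_upwards [h3.prod_mk (Metric.ball_mem_nhds l₀ hr)] with p hp ha h2w hgood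
    obtain ⟨hp1, hp2⟩ := hp
    have hnz : ∀ z ∈ Metric.closedBall l₀ r, F.det p.1 z ≠ 0 := by
      intro z hz hz0
      have h4 : w ≤ z.re := by linarith [hre z hz]
      have h5 := hμ p.1 ha z ((F.mem_opSpectrum_iff ha h4).2 hz0)
      have h6 : ‖p.2 - z‖ ≤ r + r := by
        rw [← sub_add_sub_cancel p.2 l₀ z]
        refine (norm_add_le _ _).trans (add_le_add (mem_ball_iff_norm.1 hp2).le ?_)
        rw [norm_sub_rev]
        exact mem_closedBall_iff_norm.1 hz
      have h7 := (Complex.re_le_norm _).trans h6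
      rw [Complex.sub_re] at h7
      linarith
    have hdc : DiffContOnCl ℂ (fun z => (F.det p.1 z)⁻¹) (Metric.ball l₀ r) := by
      refine DifferentiableOn.diffContOnCl fun z hz => ?_
      rw [closure_ball l₀ hr.ne'] at hz
      exact ((F.differentiableAt_det ha (by linarith [hre z hz])).inv
        (hnz z hz)).differentiableWithinAt
    have h8 := Complex.norm_le_of_forall_mem_frontier_norm_le Metric.isBounded_ball hdc (C := m⁻¹)
      (fun z hz => by
        rw [frontier_ball l₀ hr.ne'] at hz
        rw [norm_inv]
        exact inv_anti₀ hm (hp1 z hz ha (hsub z hz)).le) (subset_closure hp2)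
    rw [norm_inv] at h8
    exact (inv_le_inv₀ (norm_pos_iff.2 (hnz _ (Metric.ball_subset_closedBall hp2))) hm).1 h8
  · have hpos := norm_pos_iff.2 hd
    refine ⟨‖F.det a₀ l₀‖ / 2, half_pos hpos, ?_⟩
    filter_upwards [hcont a₀ ha₀ l₀ (by linarith) _ (half_lt_self hpos)] with p hp ha hre _
    exact (hp ha (by linarith)).le

/-- Large |l| is covered by `exists_half_le`; the remaining (a, l) form a compact set, on which the
local lower bounds combine to a global one. -/
theorem exists_norm_le_of_re_ge (F : Correction A₀ B w) (hw : 0 < w) {μ : ℝ → ℝ}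
    (hμ : ∀ a, 0 ≤ a → ∀ l ∈ opSpectrum (famOp A₀ B a), l.re ≤ μ a)
    (hμ0 : ∀ a, 0 ≤ a → 0 ≤ μ a) (a₁ : ℝ) :
    ∃ K : ℝ, 0 ≤ K ∧ ∀ a, 0 ≤ a → a ≤ a₁ → ∀ l : ℂ, μ a + 2 * w ≤ l.re → ∀ u : D,
      ‖(u : X)‖ ≤ K * ‖l • (u : X) - famOp A₀ B a u‖ := by
  obtain ⟨r, hr⟩ := F.exists_half_le a₁
  set S : Set (ℝ × ℂ) := Set.Icc 0 a₁ ×ˢ (Metric.closedBall 0 r ∩ {z | 2 * w ≤ z.re})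
  have hS : IsCompact S := isCompact_Icc.prod ((isCompact_closedBall _ _).inter_right
      (isClosed_le continuous_const Complex.continuous_re))
  obtain ⟨m, hm, h⟩ : ∃ m : ℝ, 0 < m ∧ ∀ p ∈ S, μ p.1 + 2 * w ≤ p.2.re → m ≤ ‖F.det p.1 p.2‖ := by
    refine hS.induction_on (p := fun s => ∃ m : ℝ, 0 < m ∧
      ∀ p ∈ s, μ p.1 + 2 * w ≤ p.2.re → m ≤ ‖F.det p.1 p.2‖) ⟨1, one_pos, by simp⟩ ?_ ?_ ?_
    · rintro s t hst ⟨m, hm, h⟩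
      exact ⟨m, hm, fun p hp => h p (hst hp)⟩
    · rintro s t ⟨m, hm, h⟩ ⟨m', hm', h'⟩
      refine ⟨min m m', lt_min hm hm', ?_⟩
      rintro p (hp | hp) hgood
      · exact (min_le_left _ _).trans (h p hp hgood)
      · exact (min_le_right _ _).trans (h' p hp hgood)
    · rintro ⟨a, l⟩ ⟨ha, hl⟩
      obtain ⟨m, hm, h⟩ := F.exists_le_norm_det_near hw hμ ha.1 hl.2
      refine ⟨_, inter_mem self_mem_nhdsWithin (mem_nhdsWithin_of_mem_nhds h), m, hm, ?_⟩
      rintro p ⟨hp, hp2⟩ hgood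
      exact hp2 hp.1.1 hp.2.2 hgood
  obtain ⟨K, hK0, hK⟩ := F.exists_norm_le (lt_min hm (by norm_num : (0 : ℝ) < 1 / 2))
  refine ⟨K, hK0, fun a ha ha1 l hl => ?_⟩
  have h2 : 2 * w ≤ l.re := by linarith [hμ0 a ha]
  refine hK a ha l (by linarith) ?_
  rcases le_total ‖l‖ r with h3 | h3
  · exact (min_le_left _ _).trans (h (a, l) ⟨⟨ha, ha1⟩, mem_closedBall_zero_iff.2 h3, h2⟩ hl)
  · exact (min_le_right _ _).trans (hr a ha ha1 l (by linarith) h3)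

end Correction

end Spectrum

end ZKLine

/-! ### The spectrum of the linearized operators on L². -/

namespace ZKLine

open scoped FourierTransform

/-! ### The linearized operators as an affine family -/

lemma mem_domain_linearized {c a : ℝ} {s : ℕ} {u : Sobolev s} :
    u ∈ (linearized c a s).domain ↔ ∃ v : ℕ → L2, IsChain (s + 3) v ∧ ∀ j ≤ s, v j = seq u j := by
  constructor
  · intro h
    obtain ⟨v, hv, hu, -⟩ := linearized_chain (⟨u, h⟩ : (linearized c a s).domain)
    exact ⟨v, hv, hu⟩
  · rintro ⟨v, hv, hu⟩
    have hf := hv.linSeq c (c + a)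
    obtain ⟨h, -⟩ := (linearized_apply_eq_iff (c := c) (a := a) (u := u) (f := hf.toSobolev)).2
      ⟨v, hv, hu, fun j hj => (hf.seq_toSobolev hj).symm⟩
    exact h

lemma domain_linearized_eq (c a b : ℝ) (s : ℕ) :
    (linearized c a s).domain = (linearized c b s).domain := by
  ext u
  rw [mem_domain_linearized, mem_domain_linearized]

lemma eq_of_seq_eq {s : ℕ} {u v : Sobolev s} (h : seq u 0 = seq v 0) : u = v := by
  refine ext_wD ?_
  rwa [seq_of_le u (Nat.zero_le s), seq_of_le v (Nat.zero_le s)] at h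

lemma seq_neg {s : ℕ} (u : Sobolev s) (j : ℕ) : seq (-u) j = -seq u j := by
  have := seq_smul (-1) u j
  simpa using this

lemma seq_sub {s : ℕ} (u v : Sobolev s) (j : ℕ) : seq (u - v) j = seq u j - seq v j := by
  rw [sub_eq_add_neg, seq_add, seq_neg, ← sub_eq_add_neg]

/-- The operator `∂ₓ 𝓛_c`, as a linear map on its domain. -/
def linZero (c : ℝ) (s : ℕ) : (linearized c 0 s).domain →ₗ[ℂ] Sobolev s := (linearized c 0 s).toFun

/-- The operator `∂ₓ`, on the domain of `∂ₓ 𝓛_c`. -/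
def linDiff (c : ℝ) (s : ℕ) : (linearized c 0 s).domain →ₗ[ℂ] Sobolev s :=
  (linearized c 1 s).toFun ∘ₗ Submodule.inclusion (domain_linearized_eq c 0 1 s).le -
    (linearized c 0 s).toFun

/-- The domain is the same for all a and the operator is affine in a, so it is determined by its
values at a = 0 and a = 1. -/
lemma famOp_linearized (c a : ℝ) (s : ℕ) :
    famOp (linZero c s) (linDiff c s) a = linearized c a s := by
  refine LinearPMap.ext (domain_linearized_eq c 0 a s) fun x hx ha => ?_
  have h0 : x ∈ (linearized c 0 s).domain := hx
  have h1 : x ∈ (linearized c 1 s).domain := (domain_linearized_eq c 0 1 s).le h0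
  have e : famOp (linZero c s) (linDiff c s) a ⟨x, hx⟩ = linearized c 0 s ⟨x, h0⟩ +
      (a : ℂ) • (linearized c 1 s ⟨x, h1⟩ - linearized c 0 s ⟨x, h0⟩) := rfl
  rw [e]
  obtain ⟨v, hv, hu, hf⟩ := linearized_chain (⟨x, h0⟩ : (linearized c 0 s).domain)
  obtain ⟨v₁, hv₁, hu₁, hf₁⟩ := linearized_chain (⟨x, h1⟩ : (linearized c 1 s).domain)
  obtain ⟨v₂, hv₂, hu₂, hf₂⟩ := linearized_chain (⟨x, ha⟩ : (linearized c a s).domain)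
  have e1 : ∀ j ≤ s + 3, v₁ j = v j := hv₁.eq hv (by rw [hu₁ 0 (by omega), hu 0 (by omega)])
  have e2 : ∀ j ≤ s + 3, v₂ j = v j := hv₂.eq hv (by rw [hu₂ 0 (by omega), hu 0 (by omega)])
  refine eq_of_seq_eq ?_
  rw [seq_add, seq_smul, seq_sub, ← hf 0 (by omega), ← hf₁ 0 (by omega), ← hf₂ 0 (by omega)]
  simp only [linSeq, leibnizSum_one, zero_add]
  rw [e1 3 (by omega), e1 1 (by omega), e1 0 (by omega), e2 3 (by omega), e2 1 (by omega),
    e2 0 (by omega)]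
  push_cast
  simp only [add_smul]
  module

/-! ### The identification of `H⁰(ℝ)` and `L²(ℝ)` -/

/-- The isometry between `H⁰(ℝ)` and `L²(ℝ)`. -/
def sobolevZero : Sobolev 0 ≃ₗᵢ[ℂ] L2 where
  toFun u := seq u 0
  map_add' u v := seq_add u v 0
  map_smul' k u := seq_smul k u 0
  invFun f := IsChain.toSobolev (v := fun _ => f) (fun j hj => absurd hj (Nat.not_lt_zero j))
  left_inv u := eq_of_seq_eq (IsChain.seq_toSobolev _ le_rfl)
  right_inv f := IsChain.seq_toSobolev _ le_rfl
  norm_map' u := by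
    have h := norm_sq_sobolev u
    simp only [zero_add, Finset.sum_range_one] at h
    rw [sq_eq_sq₀ (norm_nonneg _) (norm_nonneg _)] at h
    exact h.symm

lemma sobolevZero_apply (u : Sobolev 0) : sobolevZero u = seq u 0 := rfl

/-- Multiplication by the weight `1 + θ / 2`, on `H⁰(ℝ)`. -/
def wtMul (c : ℝ) : Sobolev 0 →L[ℂ] Sobolev 0 :=
  sobolevZero.symm.toContinuousLinearEquiv.toContinuousLinearMap ∘L thetaMul c wt ∘L
    sobolevZero.toContinuousLinearEquiv.toContinuousLinearMap

lemma inner_wtMul (c : ℝ) (u v : Sobolev 0) :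
    inner ℂ (wtMul c u) v = inner ℂ (thetaMul c wt (seq u 0)) (seq v 0) := by
  rw [← sobolevZero.inner_map_map]
  change inner ℂ (sobolevZero (sobolevZero.symm _)) _ = _
  rw [LinearIsometryEquiv.apply_symm_apply]
  rfl

lemma norm_seq_zero (u : Sobolev 0) : ‖seq u 0‖ = ‖u‖ := sobolevZero.norm_map u

lemma re_inner_wtMul_ge (c : ℝ) (u : Sobolev 0) :
    1 / 2 * ‖u‖ ^ 2 ≤ (inner ℂ (wtMul c u) u).re := by
  rw [inner_wtMul, ← norm_seq_zero]
  exact thetaForm_wt_ge c _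

lemma re_inner_wtMul_le (c : ℝ) (u : Sobolev 0) :
    (inner ℂ (wtMul c u) u).re ≤ 3 / 2 * ‖u‖ ^ 2 := by
  rw [inner_wtMul, ← norm_seq_zero]
  exact thetaForm_wt_le c _

lemma im_inner_wtMul (c : ℝ) (u : Sobolev 0) : (inner ℂ (wtMul c u) u).im = 0 := by
  rw [inner_wtMul, ← Complex.conj_eq_iff_im, inner_conj_symm, inner_thetaMul_left]

lemma re_inner_wtMul_comm (c : ℝ) (u v : Sobolev 0) :
    (inner ℂ (wtMul c u) v).re = (inner ℂ (wtMul c v) u).re := by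
  rw [inner_wtMul, inner_wtMul]
  exact re_inner_thetaMul_comm c wt _ _

lemma dense_domain_linearized {c : ℝ} (hc : 0 < c) {a : ℝ} (ha : 0 ≤ a) (s : ℕ) :
    Dense ((linearized c a s).domain : Set (Sobolev s)) := by
  obtain ⟨ω, -, hd⟩ := linearized_dissipative c s
  obtain ⟨l₀, -, hs⟩ := linearized_surjective c hc s
  exact dense_domain_of_dissipative (l := max l₀ (ω + 1)) (hd a)
    (lt_of_lt_of_le (lt_add_one ω) (le_max_right _ _)) (hs _ (le_max_left _ _) a ha)

theorem nonempty_correction_linearized {c : ℝ} (hc : 0 < c) {w : ℝ} (hw : 0 < w) :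
    Nonempty (Correction (linZero c 0) (linDiff c 0) w) := by
  obtain ⟨κ, K, hκ, hK0, hK⟩ := exists_re_inner_wt_le hc
  -- Then Kδ ≤ κ, so the smoothing gain absorbs the derivative term, and Kδ ≤ w/16, the defect
  -- allowed by `nonempty_correction`. The contribution of c + a has a favourable sign and is
  -- dropped.
  set δ : ℝ := min κ (w / 16) / (K + 1)
  have hδ : 0 < δ := by positivity
  have hKδ : K * δ ≤ min κ (w / 16) := by
    simp only [δ]
    rw [mul_div_assoc', div_le_iff₀ (by positivity)]
    nlinarith [lt_min hκ (by positivity : 0 < w / 16)]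
  have hKκ : K * δ ≤ κ := hKδ.trans (min_le_left _ _)
  have hKw : K * δ ≤ w / 16 := hKδ.trans (min_le_right _ _)
  obtain ⟨ι, _, ψ, hψ⟩ := exists_locForm_le hc hδ
  obtain ⟨ω, -, hd⟩ := linearized_dissipative c 0
  obtain ⟨l₀, -, hs⟩ := linearized_surjective c hc 0
  refine nonempty_correction (P := wtMul c) (ω := ω) (l₀ := l₀) hw
    (dense_domain_linearized hc le_rfl 0) (re_inner_wtMul_ge c) (im_inner_wtMul c)
    (fun i => sobolevZero.symm (((√K : ℝ) : ℂ) • ψ i)) ?_ ?_ ?_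
  · intro a ha
    have key : ∀ u : (linearized c a 0).domain, (inner ℂ (wtMul c (linearized c a 0 u))
        (u : Sobolev 0)).re ≤ w / 16 * ‖(u : Sobolev 0)‖ ^ 2 +
        ∑ i, ‖inner ℂ (sobolevZero.symm (((√K : ℝ) : ℂ) • ψ i)) (u : Sobolev 0)‖ ^ 2 := by
      intro u
      obtain ⟨v, hv, hu, hf⟩ := linearized_chain u
      rw [inner_wtMul, ← hf 0 le_rfl, ← hu 0 le_rfl, ← norm_seq_zero, ← hu 0 le_rfl]
      have h1 := hK (c + a) v hv
      have h2 := hψ (v 0) (v 1) (hv 0 (by omega))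
      have e : ∀ i, ‖inner ℂ (sobolevZero.symm (((√K : ℝ) : ℂ) • ψ i)) (u : Sobolev 0)‖ ^ 2 =
          K * ‖inner ℂ (ψ i) (v 0)‖ ^ 2 := by
        intro i
        rw [← sobolevZero.inner_map_map, LinearIsometryEquiv.apply_symm_apply,
          sobolevZero_apply, ← hu 0 le_rfl, inner_smul_left, norm_mul, mul_pow, RCLike.norm_conj, Complex.norm_real,
          Real.norm_of_nonneg (Real.sqrt_nonneg K), Real.sq_sqrt hK0]
      simp_rw [e]
      rw [← Finset.mul_sum]
      have h3 := mul_le_mul_of_nonneg_left h2 hK0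
      have h4 := mul_le_mul_of_nonneg_right hKκ (locForm_nonneg c (v 1))
      have h5 := mul_le_mul_of_nonneg_right hKw (sq_nonneg ‖v 0‖)
      have h6 : 0 ≤ κ / 3 * (c + a) * locForm c (v 0) := by
        have := locForm_nonneg c (v 0)
        positivity
      nlinarith
    rw [← famOp_linearized] at key
    exact key
  · intro a _
    have h := hd a
    rw [← famOp_linearized] at h
    exact h
  · intro l hl a ha
    have h := hs l hl a ha
    rw [← famOp_linearized] at h
    exact h

/-! ### The origin belongs to the spectrum -/

/-- A primitive would have the transform 1/(2πiξ) on (0, 1). This is not integrable at 0, whereas L²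
functions are integrable on bounded intervals. -/
lemma exists_not_range_deriv : ∃ f : L2, ∀ w : L2, ¬ IsWeakDeriv w f := by
  refine ⟨𝓕⁻ (chi 0 1), fun w hw => ?_⟩
  rw [isWeakDeriv_iff_fourier, FourierTransform.fourier_fourierInv_eq] at hw
  have h1 : IntegrableOn (𝓕 w : L2) (Set.Ioc 0 1) :=
    ((Lp.memLp (𝓕 w : L2)).restrict (Set.Ioc 0 1)).integrable (by norm_num)
  have h2 : IntegrableOn (fun ξ : ℝ => ξ⁻¹) (Set.Ioc 0 1) := by
    refine (h1.norm.const_mul (2 * Real.pi)).mono' (by fun_prop) ?_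
    rw [ae_restrict_iff' measurableSet_Ioc]
    filter_upwards [hw, indicatorConstLp_coeFn (p := 2)
      (hs := measurableSet_Ico (a := (0 : ℝ)) (b := 1))
      (hμs := by simp) (c := (1 : ℂ)) (μ := volume), Measure.ae_ne volume (1 : ℝ)]
      with ξ h3 h4 h5 h6
    rw [chi, h4, Set.indicator_of_mem (show ξ ∈ Set.Ico (0 : ℝ) 1 from
      ⟨h6.1.le, lt_of_le_of_ne h6.2 h5⟩)] at h3
    have h7 := congrArg norm h3
    rw [norm_one, norm_mul, norm_mul, Complex.norm_I, mul_one, Complex.norm_real,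
      Real.norm_of_nonneg (by have := h6.1; positivity)] at h7
    have h8 : 0 < ξ := h6.1
    rw [Real.norm_of_nonneg (by positivity), inv_le_iff_one_le_mul₀ h8]
    linarith
  have h3 : IntervalIntegrable (fun ξ : ℝ => ξ⁻¹) volume 0 1 :=
    (intervalIntegrable_iff_integrableOn_Ioc_of_le zero_le_one).2 h2
  rw [intervalIntegrable_inv_iff] at h3
  simp at h3

/-- Every value of the operator is a weak derivative of an L² function, so its range is not all of
L². -/
lemma zero_mem_opSpectrum (c a : ℝ) : (0 : ℂ) ∈ opSpectrum (linearized c a 0) := by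
  rintro ⟨R, hR, -⟩
  obtain ⟨f, hf⟩ := exists_not_range_deriv
  obtain ⟨h, h1⟩ := hR (sobolevZero.symm (-f))
  have h2 : (R (sobolevZero.symm (-f)), sobolevZero.symm f) ∈ (linearized c a 0).graph := by
    rw [LinearPMap.mem_graph_iff]
    refine ⟨⟨_, h⟩, rfl, ?_⟩
    rw [zero_smul, zero_sub, neg_eq_iff_eq_neg] at h1
    rw [h1, map_neg, neg_neg]
  rw [linearized_graph] at h2
  obtain ⟨v, -, w, -, hw⟩ := h2
  refine hf w ?_
  have e : wD (sobolevZero.symm f) 0 = f := rfl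
  rwa [e] at hw

theorem isGreatest_specBound {c : ℝ} (hc : 0 < c) {a : ℝ} (ha : 0 ≤ a) :
    IsGreatest (spectralAbscissae c a) (specBound c a) := by
  obtain ⟨m, hm⟩ := exists_isGreatest_re_opSpectrum (A₀ := linZero c 0) (B := linDiff c 0)
    (fun w hw => nonempty_correction_linearized hc hw) ha
    (by rw [famOp_linearized]; exact zero_mem_opSpectrum c a)
  rw [famOp_linearized] at hm
  have : specBound c a = m := hm.csSup_eq
  rwa [this]

lemma specBound_nonneg {c : ℝ} (hc : 0 < c) {a : ℝ} (ha : 0 ≤ a) : 0 ≤ specBound c a :=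
  (isGreatest_specBound hc ha).2 ⟨0, zero_mem_opSpectrum c a, rfl⟩

theorem exists_resolvent_bound {c : ℝ} (hc : 0 < c) {ε : ℝ} (hε : 0 < ε) (a₁ : ℝ) :
    ∃ K : ℝ, 0 ≤ K ∧ ∀ a, 0 ≤ a → a ≤ a₁ → ∀ l : ℂ, specBound c a + ε ≤ l.re →
      ∀ u : (linearized c a 0).domain,
        ‖(u : Sobolev 0)‖ ≤ K * ‖l • (u : Sobolev 0) - linearized c a 0 u‖ := by
  obtain ⟨F⟩ := nonempty_correction_linearized hc (half_pos hε)
  obtain ⟨K, hK0, hK⟩ := F.exists_norm_le_of_re_ge (half_pos hε) (μ := specBound c)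
    (fun a ha l hl => by
      rw [famOp_linearized] at hl
      exact (isGreatest_specBound hc ha).2 ⟨l, hl, rfl⟩)
    (fun a ha => specBound_nonneg hc ha) a₁
  refine ⟨K, hK0, fun a ha ha1 l hl => ?_⟩
  have h : ∀ u : (famOp (linZero c 0) (linDiff c 0) a).domain, ‖(u : Sobolev 0)‖ ≤
      K * ‖l • (u : Sobolev 0) - famOp (linZero c 0) (linDiff c 0) a u‖ :=
    hK a ha ha1 l (by linarith)
  rw [famOp_linearized] at h
  exact h

end ZKLine

/-! ### Uniform growth bounds in L² and in H^s. -/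

namespace ZKLine

/-! ### The semigroups generated by the linearized operators -/

theorem existsUnique_semigroup {c : ℝ} (hc : 0 < c) (s : ℕ) {a : ℝ} (ha : 0 ≤ a) :
    ∃! T : C0Semigroup (Sobolev s), T.HasGenerator (linearized c a s) := by
  obtain ⟨ω, hω, hd⟩ := linearized_dissipative c s
  obtain ⟨l₀, -, hs⟩ := linearized_surjective c hc s
  obtain ⟨T, hT⟩ := exists_semigroup hω (hd a) (fun l hl => hs l hl a ha)
  exact ⟨T, hT, fun S hS => hS.unique hT (hd a) (dense_domain_linearized hc ha s)⟩

section Form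

variable {X : Type*} [NormedAddCommGroup X] [InnerProductSpace ℂ X] [CompleteSpace X]
variable {A : X →ₗ.[ℂ] X}

lemma C0Semigroup.growth_of_dense {T : C0Semigroup X} {N w : ℝ} {D : Set X} (hD : Dense D)
    (h : ∀ x ∈ D, ∀ t, 0 ≤ t → ‖T.orbit x t‖ ≤ N * Real.exp (w * t) * ‖x‖) : T.Growth N w := by
  intro x t ht
  refine hD.induction (P := fun x => ‖T.orbit x t‖ ≤ N * Real.exp (w * t) * ‖x‖)
    (fun x hx => h x hx t ht) (isClosed_le ?_ (by fun_prop)) x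
  exact (T.toFun t.toNNReal).continuous.norm

lemma C0Semigroup.Growth.mono {T : C0Semigroup X} {N N' w w' : ℝ} (h : T.Growth N w)
    (hN : 0 ≤ N) (hNN : N ≤ N') (hw : w ≤ w') : T.Growth N' w' := by
  intro x t ht
  have hN' := hN.trans hNN
  refine (h x t ht).trans ?_
  gcongr

/-- Re⟨Pu, u⟩ is an equivalent squared norm that does not increase along orbits; the ratio of its
bounds is 3, and √3 ≤ 2. -/
lemma C0Semigroup.HasGenerator.growth_of_form {T : C0Semigroup X} (hT : T.HasGenerator A)
    (hD : Dense (A.domain : Set X)) {P : X →L[ℂ] X}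
    (h1 : ∀ u, 1 / 2 * ‖u‖ ^ 2 ≤ (inner ℂ (P u) u).re)
    (h2 : ∀ u, (inner ℂ (P u) u).re ≤ 3 / 2 * ‖u‖ ^ 2)
    (hs : ∀ u v, (inner ℂ (P u) v).re = (inner ℂ (P v) u).re)
    (hA : ∀ u : A.domain, (inner ℂ (P (A u)) (u : X)).re ≤ 0) : T.Growth 2 0 := by
  refine C0Semigroup.growth_of_dense hD fun x hx t ht => ?_
  have h3 := gronwall_right (K := 0) (f := fun t => (inner ℂ (P (T.orbit x t)) (T.orbit x t)).re)
    (Continuous.continuousOn (Complex.continuous_re.comp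
      ((P.continuous.comp (T.continuous_orbit x)).inner (T.continuous_orbit x))))
    (fun r hr => hasDerivWithinAt_form P (hT.hasDerivWithinAt ⟨x, hx⟩ hr))
    (fun r hr => by
      obtain ⟨h, e⟩ := hT.domain_orbit ⟨x, hx⟩ r
      have h4 := hA ⟨_, h⟩
      rw [e] at h4
      rw [hs]
      simp only [zero_mul]
      linarith) ht
  simp only [T.orbit_zero, zero_mul, Real.exp_zero, mul_one] at h3 ⊢
  have h5 := h1 (T.orbit x t)
  have h6 := h2 x
  refine abs_le_of_sq_le_sq' ?_ (by positivity) |>.2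
  nlinarith [sq_nonneg ‖x‖]

end Form

/-- For a ≥ 3K/κ the coefficient K - κ(c + a)/3 is nonpositive, so the weighted form is dissipative.
-/
lemma exists_growth_large {c : ℝ} (hc : 0 < c) :
    ∃ a₁ : ℝ, ∀ a, 0 ≤ a → a₁ ≤ a → ∀ T : C0Semigroup (Sobolev 0),
      T.HasGenerator (linearized c a 0) → T.Growth 2 0 := by
  obtain ⟨κ, K, hκ, hK0, hK⟩ := exists_re_inner_wt_le hc
  refine ⟨3 * K / κ, fun a ha ha1 T hT => ?_⟩
  refine hT.growth_of_form (dense_domain_linearized hc ha 0) (re_inner_wtMul_ge c)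
    (re_inner_wtMul_le c) (re_inner_wtMul_comm c) fun u => ?_
  obtain ⟨v, hv, hu, hf⟩ := linearized_chain u
  rw [inner_wtMul, ← hf 0 le_rfl, ← hu 0 le_rfl]
  refine (hK (c + a) v hv).trans ?_
  rw [div_le_iff₀ hκ] at ha1
  have h1 := mul_nonneg hκ.le (locForm_nonneg c (v 1))
  have h2 : K - κ / 3 * (c + a) ≤ 0 := by nlinarith
  have h3 := mul_nonpos_of_nonpos_of_nonneg h2 (locForm_nonneg c (v 0))
  linarith

/-- Large a need no spectral information because μ(a) ≥ 0. For a ≤ a₁ the resolvent bound is uniform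
and `gearhart_pruss` applies, unless μ(a) + ε exceeds ω + 1, where quasi-dissipativity already
suffices. -/
theorem exists_growth_zero {c : ℝ} (hc : 0 < c) {ε : ℝ} (hε : 0 < ε) :
    ∃ N : ℝ, 0 ≤ N ∧ ∀ a, 0 ≤ a → ∀ T : C0Semigroup (Sobolev 0),
      T.HasGenerator (linearized c a 0) → T.Growth N (specBound c a + ε) := by
  obtain ⟨a₁, ha₁⟩ := exists_growth_large hc
  obtain ⟨ω, hω, hd⟩ := linearized_dissipative c 0
  obtain ⟨M, hM0, hM⟩ := exists_resolvent_bound hc hε a₁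
  set N : ℝ := max 2 (√(C0Semigroup.gpBound 1 ω M))
  have hN2 : 2 ≤ N := le_max_left _ _
  refine ⟨N, by linarith, fun a ha T hT => ?_⟩
  have hμ := specBound_nonneg hc ha
  rcases le_total a₁ a with h | h
  · exact (ha₁ a ha h T hT).mono (by norm_num) hN2 (by linarith)
  · have h1 : T.Growth 1 ω := fun x t ht => by
      rw [one_mul]
      exact hT.orbit_le_of_dissipative (hd a) (dense_domain_linearized hc ha 0) x ht
    rcases le_total (specBound c a + ε) (ω + 1) with h2 | h2
    · exact (h1.gearhart_pruss zero_le_one hω hT hM0 (by linarith) h2 (hM a ha h)).mono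
        (Real.sqrt_nonneg _) (le_max_right _ _) le_rfl
    · exact h1.mono zero_le_one (by linarith) (by linarith)

/-! ### Growth in Sobolev norms -/

/-- The `j`-th weak derivative, as a bounded operator. -/
def seqL (s j : ℕ) : Sobolev s →L[ℂ] L2 :=
  LinearMap.mkContinuous
    { toFun := fun u => seq u j
      map_add' := fun u v => seq_add u v j
      map_smul' := fun k u => seq_smul k u j } 1 (fun u => by
        rw [one_mul]
        exact norm_seq_le u j)

/-- The embedding of `H^s(ℝ)` into `H⁰(ℝ)`. -/
def toZero (s : ℕ) : Sobolev s →L[ℂ] Sobolev 0 :=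
  sobolevZero.symm.toContinuousLinearEquiv.toContinuousLinearMap ∘L seqL s 0

lemma seq_toZero {s : ℕ} (u : Sobolev s) : seq (toZero s u) 0 = seq u 0 :=
  sobolevZero.apply_symm_apply (seq u 0)

lemma linearized_toZero {c a : ℝ} {s : ℕ} (u : (linearized c a s).domain) :
    ∃ h : toZero s u ∈ (linearized c a 0).domain,
      linearized c a 0 ⟨toZero s u, h⟩ = toZero s (linearized c a s u) := by
  obtain ⟨v, hv, hu, hf⟩ := linearized_chain u
  refine linearized_apply_eq_iff.2 ⟨v, hv.mono (by omega), fun j hj => ?_, fun j hj => ?_⟩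
  · obtain rfl := Nat.le_zero.1 hj
    rw [seq_toZero, hu 0 (Nat.zero_le s)]
  · obtain rfl := Nat.le_zero.1 hj
    rw [seq_toZero, hf 0 (Nat.zero_le s)]

/-- The image in H⁰ of an H^s orbit solves the same equation, so the difference of the two orbits
vanishes by dissipativity. This transfers the L² growth bound to H^s orbits. -/
lemma toZero_orbit {c a : ℝ} (s : ℕ) {T : C0Semigroup (Sobolev s)} {T₀ : C0Semigroup (Sobolev 0)}
    (hT : T.HasGenerator (linearized c a s)) (hT₀ : T₀.HasGenerator (linearized c a 0))
    (u : (linearized c a s).domain) {t : ℝ} (ht : 0 ≤ t) :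
    toZero s (T.orbit u t) = T₀.orbit (toZero s u) t := by
  obtain ⟨ω, -, hd⟩ := linearized_dissipative c 0
  obtain ⟨h₀, e₀⟩ := linearized_toZero u
  have h := norm_le_exp_of_dissipative (w := ω)
    (y := fun t => toZero s (T.orbit u t) - T₀.orbit (toZero s u) t)
    (y' := fun t => toZero s (T.orbit (linearized c a s u) t) -
      T₀.orbit (linearized c a 0 ⟨toZero s u, h₀⟩) t)
    (((toZero s).continuous.comp (T.continuous_orbit _)).sub (T₀.continuous_orbit _)).continuousOn
    (fun r hr => ?_) (fun r hr => ?_) ht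
  · simp only [C0Semigroup.orbit_zero, sub_self, norm_zero, mul_zero] at h
    exact sub_eq_zero.1 (norm_le_zero_iff.1 h)
  · exact ((toZero s).restrictScalars ℝ).hasFDerivAt.comp_hasDerivWithinAt r
      (hT.hasDerivWithinAt u hr) |>.sub (hT₀.hasDerivWithinAt ⟨toZero s u, h₀⟩ hr)
  · obtain ⟨h1, e1⟩ := hT.domain_orbit u r
    obtain ⟨h2, e2⟩ := linearized_toZero ⟨_, h1⟩
    obtain ⟨h3, e3⟩ := hT₀.domain_orbit ⟨toZero s u, h₀⟩ r
    have h4 := hd a (⟨_, h2⟩ - ⟨_, h3⟩)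
    rw [LinearPMap.map_sub, e2, e3, e1] at h4
    exact h4

/-- The energy F = Σ βⱼ∫(1 + θ/2)|∂ⱼu|², with ∂ⱼ the derivative of order j, is comparable to the
squared H^s norm. By `exists_weights` its derivative is at most 2K times the localised form of u
itself, which the L² growth bound controls. -/
theorem exists_growth {c : ℝ} (hc : 0 < c) (s : ℕ) {ε : ℝ} (hε : 0 < ε) :
    ∃ N : ℝ, 0 ≤ N ∧ ∀ a, 0 ≤ a → ∀ T : C0Semigroup (Sobolev s),
      T.HasGenerator (linearized c a s) → T.Growth N (specBound c a + ε) := by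
  obtain ⟨N₀, hN₀, h₀⟩ := exists_growth_zero hc hε
  obtain ⟨β, K, hβ, hK0, hK⟩ := exists_weights hc s
  obtain ⟨b, hb, hbβ⟩ : ∃ b : ℝ, 0 < b ∧ ∀ j ∈ Finset.range (s + 1), b ≤ β j :=
    ⟨(Finset.range (s + 1)).inf' ⟨0, by simp⟩ β, (Finset.lt_inf'_iff _).2 fun j _ => hβ j,
      fun j hj => Finset.inf'_le _ hj⟩
  set b' : ℝ := ∑ j ∈ Finset.range (s + 1), β j
  have hb' : ∀ j ∈ Finset.range (s + 1), β j ≤ b' := fun j hj =>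
    Finset.single_le_sum (fun i _ => (hβ i).le) hj
  have hb'0 : 0 ≤ b' := Finset.sum_nonneg fun i _ => (hβ i).le
  -- With this k the derivative of k‖u‖²e^{2wr} dominates the source term 2K N₀²e^{2wr}‖u‖², since w
  -- = μ(a) + ε ≥ ε; this is where μ(a) ≥ 0 enters.
  set k : ℝ := K * N₀ ^ 2 / ε
  have hk : 0 ≤ k := by positivity
  refine ⟨√(2 / b * (3 / 2 * b' + k)), Real.sqrt_nonneg _, fun a ha T hT => ?_⟩
  obtain ⟨T₀, hT₀, -⟩ := existsUnique_semigroup hc 0 ha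
  have hG := h₀ a ha T₀ hT₀
  have hμ := specBound_nonneg hc ha
  set w := specBound c a + ε
  refine C0Semigroup.growth_of_dense (dense_domain_linearized hc ha s) fun u hu t ht => ?_
  set F : ℝ → ℝ := fun t => ∑ j ∈ Finset.range (s + 1), β j * thetaForm c wt (seq (T.orbit u t) j)
  have hFc : Continuous F := by
    refine continuous_finsetSum _ fun j _ => continuous_const.mul ?_
    have h1 : Continuous fun t => seq (T.orbit u t) j :=
      (seqL s j).continuous.comp (T.continuous_orbit u)
    exact Complex.continuous_re.comp (((thetaMul c wt).continuous.comp h1).inner h1)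
  have hexp : ∀ r : ℝ, HasDerivAt (fun r => k * ‖u‖ ^ 2 * Real.exp (2 * w * r))
      (k * ‖u‖ ^ 2 * (Real.exp (2 * w * r) * (2 * w))) r := by
    intro r
    have := ((hasDerivAt_id r).const_mul (2 * w)).exp.const_mul (k * ‖u‖ ^ 2)
    simpa using this
  set y' : ℝ → ℕ → L2 := fun r j => seq (T.orbit (linearized c a s ⟨u, hu⟩) r) j
  have hFd : ∀ r, 0 ≤ r → HasDerivWithinAt F (∑ j ∈ Finset.range (s + 1), β j *
      (2 * (inner ℂ (thetaMul c wt (y' r j)) (seq (T.orbit u r) j)).re)) (Set.Ici r) r := by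
    intro r hr
    refine HasDerivWithinAt.fun_sum fun j _ => HasDerivWithinAt.const_mul _ ?_
    have h1 : HasDerivWithinAt (fun t => seq (T.orbit u t) j) (y' r j) (Set.Ici r) r :=
      ((seqL s j).restrictScalars ℝ).hasFDerivAt.comp_hasDerivWithinAt r
        (hT.hasDerivWithinAt ⟨u, hu⟩ hr)
    have h2 := hasDerivWithinAt_form (thetaMul c wt) h1
    rw [re_inner_thetaMul_comm, ← two_mul] at h2
    exact h2
  have hbound : ∀ r, 0 ≤ r → ∑ j ∈ Finset.range (s + 1), β j *
      (2 * (inner ℂ (thetaMul c wt (y' r j)) (seq (T.orbit u r) j)).re) ≤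
      2 * K * (N₀ ^ 2 * Real.exp (2 * w * r) * ‖u‖ ^ 2) := by
    intro r hr
    obtain ⟨h1, e1⟩ := hT.domain_orbit ⟨u, hu⟩ r
    obtain ⟨v, hv, hvu, hf⟩ := linearized_chain ⟨_, h1⟩
    rw [e1] at hf
    have h2 := hK (c + a) v (by linarith) hv
    have h3 : ∑ j ∈ Finset.range (s + 1), β j *
        (2 * (inner ℂ (thetaMul c wt (y' r j)) (seq (T.orbit u r) j)).re) =
        2 * ∑ j ∈ Finset.range (s + 1), β j *
          (inner ℂ (thetaMul c wt (linSeq c (c + a) v j)) (v j)).re := by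
      rw [Finset.mul_sum]
      refine Finset.sum_congr rfl fun j hj => ?_
      have hj' := Finset.mem_range_succ_iff.1 hj
      rw [hf j hj', hvu j hj']
      ring
    have h4 : 0 ≤ ∑ j ∈ Finset.range (s + 1), locForm c (v (j + 1)) :=
      Finset.sum_nonneg fun j _ => locForm_nonneg c _
    have h5 : ‖v 0‖ ≤ N₀ * Real.exp (w * r) * ‖u‖ := by
      have h6 := hG (toZero s u) r hr
      rw [← toZero_orbit s hT hT₀ ⟨u, hu⟩ hr, ← norm_seq_zero, ← norm_seq_zero, seq_toZero,
        seq_toZero] at h6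
      rw [hvu 0 (Nat.zero_le s)]
      exact h6.trans (mul_le_mul_of_nonneg_left (norm_seq_le u 0) (by positivity))
    have h7 : ‖v 0‖ ^ 2 ≤ N₀ ^ 2 * Real.exp (2 * w * r) * ‖u‖ ^ 2 := by
      refine (pow_le_pow_left₀ (norm_nonneg _) h5 2).trans (le_of_eq ?_)
      rw [mul_pow, mul_pow, ← Real.exp_nat_mul]
      push_cast
      ring_nf
    have h8 := (locForm_le c (v 0)).trans h7
    rw [h3]
    nlinarith
  have hmain := gronwall_right (K := 0) (f := fun r => F r - k * ‖u‖ ^ 2 * Real.exp (2 * w * r))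
    (hFc.sub (by fun_prop)).continuousOn
    (fun r hr => (hFd r hr).sub (hexp r).hasDerivWithinAt)
    (fun r hr => by
      have h1 := hbound r hr
      have h2 : 2 * K * (N₀ ^ 2 * Real.exp (2 * w * r) * ‖u‖ ^ 2) =
          k * ε * 2 * (Real.exp (2 * w * r) * ‖u‖ ^ 2) := by
        simp only [k]
        field_simp
      have h3 : k * ε * 2 * (Real.exp (2 * w * r) * ‖u‖ ^ 2) ≤
          k * w * 2 * (Real.exp (2 * w * r) * ‖u‖ ^ 2) := by
        gcongr
        simp only [w]
        linarith
      simp only [zero_mul]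
      nlinarith) ht
  simp only [mul_zero, Real.exp_zero, zero_mul, mul_one] at hmain
  have hF0 : F 0 ≤ 3 / 2 * b' * ‖u‖ ^ 2 := by
    simp only [F, T.orbit_zero]
    rw [norm_sq_sobolev, Finset.mul_sum]
    refine Finset.sum_le_sum fun j hj => ?_
    have h1 := mul_le_mul_of_nonneg_left (thetaForm_wt_le c (seq u j)) (hβ j).le
    have h2 := mul_le_mul_of_nonneg_right (hb' j hj) (sq_nonneg ‖seq u j‖)
    linarith
  have hFt : b / 2 * ‖T.orbit u t‖ ^ 2 ≤ F t := by
    rw [norm_sq_sobolev, Finset.mul_sum]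
    refine Finset.sum_le_sum fun j hj => ?_
    have h1 := mul_le_mul_of_nonneg_left (thetaForm_wt_ge c (seq (T.orbit u t) j)) (hβ j).le
    have h2 := mul_le_mul_of_nonneg_right (hbβ j hj) (sq_nonneg ‖seq (T.orbit u t) j‖)
    linarith
  have hle1 : 1 ≤ Real.exp (2 * w * t) := Real.one_le_exp (by positivity)
  have hsq : ‖T.orbit u t‖ ^ 2 ≤ (2 / b * (3 / 2 * b' + k)) * (Real.exp (2 * w * t) * ‖u‖ ^ 2) := by
    have h1 : b / 2 * ‖T.orbit u t‖ ^ 2 ≤ (3 / 2 * b' + k) * (Real.exp (2 * w * t) * ‖u‖ ^ 2) := by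
      have h2 : 3 / 2 * b' * ‖u‖ ^ 2 * 1 ≤ 3 / 2 * b' * ‖u‖ ^ 2 * Real.exp (2 * w * t) := by gcongr
      have h3 : 0 ≤ k * ‖u‖ ^ 2 := by positivity
      nlinarith
    have h4 := mul_le_mul_of_nonneg_left h1 (by positivity : 0 ≤ 2 / b)
    have h5 : 2 / b * (b / 2 * ‖T.orbit u t‖ ^ 2) = ‖T.orbit u t‖ ^ 2 := by field_simp
    rw [h5] at h4
    linarith
  refine abs_le_of_sq_le_sq' (hsq.trans (le_of_eq ?_)) (by positivity) |>.2
  rw [mul_pow, mul_pow, Real.sq_sqrt (by positivity), ← Real.exp_nat_mul]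
  push_cast
  ring_nf

end ZKLine

end

theorem mainTheorem6 (c : ℝ) (hc : 0 < c) (s : ℕ) :
    (∀ a : ℝ, 0 ≤ a → IsGreatest (ZKLine.spectralAbscissae c a) (ZKLine.specBound c a)) ∧
    (∀ a : ℝ, 0 ≤ a → ∃! T : ZKLine.C0Semigroup (ZKLine.Sobolev s),
      T.HasGenerator (ZKLine.linearized c a s)) ∧
    (∀ ε : ℝ, 0 < ε → ∃ C : ℝ, 0 < C ∧ ∀ a : ℝ, 0 ≤ a →
      ∀ T : ZKLine.C0Semigroup (ZKLine.Sobolev s), T.HasGenerator (ZKLine.linearized c a s) →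
        ∀ (u : ZKLine.Sobolev s) (t : NNReal), 0 < t →
          ‖T.toFun t u‖ ≤ C * Real.exp ((ZKLine.specBound c a + ε) * t) * ‖u‖) := by
  refine ⟨fun a ha => ZKLine.isGreatest_specBound hc ha,
    fun a ha => ZKLine.existsUnique_semigroup hc s ha, fun ε hε => ?_⟩
  obtain ⟨N, hN, h⟩ := ZKLine.exists_growth hc s hε
  -- Only N ≥ 0 is known, and the constant has to be positive.
  refine ⟨N + 1, by positivity, fun a ha T hT u t _ => ?_⟩
  have h1 := h a ha T hT u t t.2
  rw [T.orbit_coe] at h1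
  refine h1.trans ?_
  gcongr
  linarith
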